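/- Let $(R,\mathfrak m)$ be a Noetherian Cohen-Macaulay local ring with $\dim R=1$, let $\mathrm Q(R)$ be its total ring of fractions and $\overline R$ the integral closure of $R$ in $\mathrm Q(R)$. Suppose that $R$ admits a fractional canonical ideal, that is, an $R$-submodule $K$ of $\mathrm Q(R)$ with $R\subseteq K\subseteq\overline R$ which is isomorphic to a canonical module of $R$ (a maximal Cohen-Macaulay module of type one and of finite injective dimension), and suppose that $R$ is not a discrete valuation ring. Set $E=\mathfrak m:\mathfrak m=\{x\in \mathrm Q(R)\mid x\mathfrak m\subseteq\mathfrak m\}$. For a Noetherian ring $A$ let $\mathrm{CM}(A)$ be the full subcategory of finitely generated $A$-modules $M$ that are maximal Cohen-Macaulay, i.e. $\operatorname{depth} M_{\mathfrak p}\ge\dim A_{\mathfrak p}$ for all $\mathfrak p\in\operatorname{Spec}A$ (with $\operatorname{depth} 0=\infty$), and let $\Omega\mathrm{CM}(A)$ be the full subcategory of those $M$ for which there is an exact sequence $0\to M\to F\to X\to 0$ with $F$ finitely generated free and $X\in\mathrm{CM}(A)$. Let $\Omega\mathrm{CM}_{\mathcal P}(R)$ be the full subcategory of $\Omega\mathrm{CM}(R)$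 of modules without nonzero free direct summands. Subcategories of $E$-modules are regarded as (isomorphism-closed) subcategories of $R$-modules by restriction of scalars along $R\to E$. The ideal $\mathfrak m$ is called stable if $\mathfrak m^2=a\mathfrak m$ for some $a\in\mathfrak m$. The ring $R$ is called almost Gorenstein if it has an ideal $I\ne R$ that is a canonical module of $R$ with $e_1(I)\le r(R)$, where $r(R)=\ell_R(\operatorname{Ext}^1_R(R/\mathfrak m,R))$ is the Cohen-Macaulay type and $e_1(I)$ is the first Hilbert coefficient, defined by $\ell_R(R/I^{n+1})=e_0(I)(n+1)-e_1(I)$ for $n\gg0$. A Noetherian ring is called Gorenstein if each of its localizations at a prime ideal has finite injective dimension over itself. Then the following hold. 1. $\Omega\mathrm{CM}(E)=\Omega\mathrm{CM}_{\mathcal P}(R)$ if and only if $\mathfrak m$ is stable. 2. $\Omega\mathrm{CM}_{\mathcal P}(R)=\mathrm{CM}(E)$ if and only if $R$ is an almost Gorenstein ring. 3. $E$ is a Gorenstein ring if and only if $R$ is an almost Gorenstein ring and $\mathfrak m$ is stable. -/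

import Mathlib

universe u

/-- A finitely generated module `M` over a Noetherian ring `A` is maximal Cohen-Macaulay if
`depth M_p ≥ dim A_p` for every prime `p`. The inequality of the depth is expressed by an
`M_p`-regular sequence of length `dim A_p` in the maximal ideal of `A_p`. (Weak regularity is used
so that the zero module, of depth `∞`, is included; for `M_p ≠ 0` it is the same as regularity,
by Nakayama's lemma.) -/
def IsMCM (A : Type u) [CommRing A] (M : Type u) [AddCommGroup M] [Module A M] : Prop :=
  Module.Finite A M ∧
  ∀ (p : Ideal A) [p.IsPrime], ∃ rs : List (Localization.AtPrime p),
    (∀ r ∈ rs, r ∈ IsLocalRing.maximalIdeal (Localization.AtPrime p)) ∧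
    (rs.length : WithBot ℕ∞) = ringKrullDim (Localization.AtPrime p) ∧
    RingTheory.Sequence.IsWeaklyRegular (LocalizedModule p.primeCompl M) rs

/-- A Cohen-Macaulay ring: Noetherian, and `depth A_p = dim A_p` for all primes `p`. -/
def IsCohenMacaulay (A : Type u) [CommRing A] : Prop :=
  IsNoetherianRing A ∧ IsMCM A A

/-- `M` is a first syzygy of a maximal Cohen-Macaulay module: there is an exact sequence
`0 → M → F → X → 0` with `F` free of finite rank and `X` maximal Cohen-Macaulay. -/
def IsSyzygyOfMCM (A : Type u) [CommRing A] (M : Type u) [AddCommGroup M] [Module A M] : Prop :=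
  ∃ (n : ℕ) (f : M →ₗ[A] (Fin n → A)), Function.Injective f ∧
    IsMCM A ((Fin n → A) ⧸ LinearMap.range f)

/-- `M` has no nonzero free direct summand. -/
def HasNoFreeSummand (A : Type u) [CommRing A] (M : Type u) [AddCommGroup M] [Module A M] : Prop :=
  ∀ p q : Submodule A M, IsCompl p q → Module.Free A p → p = ⊥

/-- The full subcategory `CM(A)` of maximal Cohen-Macaulay modules. -/
def catCM (A : Type u) [CommRing A] : CategoryTheory.ObjectProperty (ModuleCat.{u} A) :=
  fun M => IsMCM A M

/-- The full subcategory `ΩCM(A)` of first syzygies of maximal Cohen-Macaulay modules. -/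
def catOmegaCM (A : Type u) [CommRing A] : CategoryTheory.ObjectProperty (ModuleCat.{u} A) :=
  fun M => IsSyzygyOfMCM A M

/-- The full subcategory `ΩCM_P(A)` of modules in `ΩCM(A)` without free summands. -/
def catOmegaCMP (A : Type u) [CommRing A] : CategoryTheory.ObjectProperty (ModuleCat.{u} A) :=
  fun M => IsSyzygyOfMCM A M ∧ HasNoFreeSummand A M

/-- A full subcategory of `A`-modules, regarded as a full subcategory of `R`-modules by restriction
of scalars along `R → A`: the `R`-modules isomorphic to the restriction of a member. -/
def CategoryTheory.ObjectProperty.restrictTo {A : Type u} [CommRing A]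
    (P : CategoryTheory.ObjectProperty (ModuleCat.{u} A)) (R : Type u) [CommRing R] [Algebra R A] :
    CategoryTheory.ObjectProperty (ModuleCat.{u} R) :=
  P.map (ModuleCat.restrictScalars.{u} (algebraMap R A))

/-- `M` has finite injective dimension over `A`. -/
def HasFiniteInjDim (A : Type u) [CommRing A] (M : Type u) [AddCommGroup M] [Module A M] : Prop :=
  ∃ n : ℕ, CategoryTheory.HasInjectiveDimensionLE (ModuleCat.of A M) n

/-- A Gorenstein ring: Noetherian, and each localization at a prime ideal has finite injective
dimension over itself. -/
def IsGorenstein (A : Type u) [CommRing A] : Prop :=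
  IsNoetherianRing A ∧ ∀ (p : Ideal A) [p.IsPrime],
    HasFiniteInjDim (Localization.AtPrime p) (Localization.AtPrime p)

/-- The Bass number `ℓ_R(Ext^i_R(k, M)) = dim_k Ext^i_R(k, M)` of a module over a local ring `R`
with residue field `k`. For `R` Cohen-Macaulay and `M ≠ 0` maximal Cohen-Macaulay, the
(Cohen-Macaulay) type of `M` is its Bass number for `i = dim R`. -/
noncomputable def bassNumber (R : Type u) [CommRing R] [IsLocalRing R]
    (M : Type u) [AddCommGroup M] [Module R M] (i : ℕ) : ℕ∞ :=
  Module.length R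
    (CategoryTheory.Abelian.Ext.{u} (ModuleCat.of R (IsLocalRing.ResidueField R))
      (ModuleCat.of R M) i)

/-- `M` is a canonical module of the Cohen-Macaulay local ring `R`: maximal Cohen-Macaulay, of
type one and of finite injective dimension. -/
def IsCanonicalModule (R : Type u) [CommRing R] [IsLocalRing R]
    (M : Type u) [AddCommGroup M] [Module R M] : Prop :=
  IsMCM R M ∧ HasFiniteInjDim R M ∧ ∀ d : ℕ, ringKrullDim R = d → bassNumber R M d = 1

/-- A fractional canonical ideal: a submodule `R ⊆ K ⊆ R̄` of the total ring of fractions, where `R̄`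
is the integral closure of `R`, which is a canonical module. -/
def IsFractionalCanonicalIdeal (R : Type u) [CommRing R] [IsLocalRing R]
    (K : Submodule R (FractionRing R)) : Prop :=
  1 ≤ K ∧ K ≤ Subalgebra.toSubmodule (integralClosure R (FractionRing R)) ∧ IsCanonicalModule R K

/-- `e₀` and `e₁` are the Hilbert coefficients of the ideal `I` of a one-dimensional ring:
`ℓ(R / I ^ (n + 1)) = e₀ (n + 1) - e₁` for all large `n`. -/
def HasHilbertCoefficients {R : Type u} [CommRing R] (I : Ideal R) (e₀ e₁ : ℤ) : Prop :=
  ∃ N : ℕ, ∀ n ≥ N, ∃ l : ℕ,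
    Module.length R (R ⧸ I ^ (n + 1)) = l ∧ (l : ℤ) = e₀ * (n + 1) - e₁

/-- A Cohen-Macaulay local ring `R` of dimension one is almost Gorenstein (Goto, Matsuoka, Phuong)
if it has a canonical ideal `I`, i.e. a proper ideal which is a canonical module, such that
`e₁(I) ≤ r(R)`, where `r(R) = ℓ(Ext^1(k, R))` is the Cohen-Macaulay type. -/
def IsAlmostGorenstein (R : Type u) [CommRing R] [IsLocalRing R] : Prop :=
  ∃ I : Ideal R, I ≠ ⊤ ∧ IsCanonicalModule R I ∧
    ∃ e₀ e₁ : ℤ, HasHilbertCoefficients I e₀ e₁ ∧ ∃ r : ℕ, bassNumber R R 1 = r ∧ e₁ ≤ r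

/-- An ideal `I` is stable if `I² = a I` for some `a ∈ I`. -/
def Ideal.IsStable {R : Type u} [CommRing R] (I : Ideal R) : Prop :=
  ∃ a ∈ I, I ^ 2 = Ideal.span {a} * I

/-- The ring `I : I = {x ∈ Q(R) | x I ⊆ I}` of an ideal `I`. -/
def Ideal.colonRing {R : Type u} [CommRing R] (I : Ideal R) : Subalgebra R (FractionRing R) where
  carrier := {x | ∀ y ∈ IsLocalization.coeSubmodule (FractionRing R) I,
    x * y ∈ IsLocalization.coeSubmodule (FractionRing R) I}
  mul_mem' {a b} ha hb y hy := by
    rw [mul_assoc]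
    exact ha _ (hb _ hy)
  add_mem' {a b} ha hb y hy := by
    rw [add_mul]
    exact add_mem (ha _ hy) (hb _ hy)
  algebraMap_mem' r y hy := by
    rw [← Algebra.smul_def]
    exact Submodule.smul_mem _ _ hy

/-!
# The ring `E = 𝔪 : 𝔪` and almost Gorenstein rings of dimension one

Fix a parameter `t` of `R`, and write `Q` for the total ring of fractions. Over `R` and over its
finite overring `E` the maximal Cohen-Macaulay modules are the finitely generated modules on which
`t` is regular. The three classes of modules are described by lattices `W` in `Q`: a module is
*saturated* in a power of `W` if it is isomorphic to an `E`-submodule `N` of `Q ^ n` contained in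
`W ^ n` such that `t z ∈ N` implies `z ∈ N` for `z` in `W ^ n`. As `R` is not a discrete valuation
ring, `E = R : 𝔪` (`one_div_maximalIdeal`), and then

* `ΩCM_P(R)` consists of the modules saturated in powers of `𝔪` (`catOmegaCMP_iff`), since a module
  without free summands maps to `R` only through `𝔪`;
* `ΩCM(E)` consists of the modules saturated in powers of `E` (`restrictTo_catOmegaCM_iff`);
* `CM(E)` consists of the modules saturated in powers of the canonical lattice `K : E = 𝔪 K` of `E`
  (`isSaturatedIn_of_restrictTo_catCM`, `IsSaturatedIn.restrictTo_catCM`).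

The last description rests on duality: if `K` has finite injective dimension, then `K / t K` is
self-injective modulo `t` (`quotInjective_of_hasFiniteInjDim`), homomorphisms to `K` lift modulo
`t`, and hence `K : (K : X) = X` for every lattice `X` (`isDualizing_of_hasFiniteInjDim`).

Two classes are compared through their lattices, because a lattice `X` that is saturated in a power
of `W` is `W`-reflexive, that is, `W : (W : X) = X` (`IsSaturatedIn.div_div_eq`).

* If `ΩCM(E) = ΩCM_P(R)`, then `𝔪` is reflexive over `E`. Its endomorphism ring being `E`, it is
  invertible (`mul_div_eq_of_reflexive`), hence principal over the semilocal ring `E`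
  (`exists_eq_span_mul_of_mul_eq`), which means that `𝔪` is stable (`isStable_maximalIdeal_iff`).
  Conversely, multiplication by a generator of `𝔪` over `E` carries powers of `E` to powers of `𝔪`.
* If `ΩCM_P(R) = CM(E)`, then `𝔪 K` is reflexive with respect to `𝔪`. By duality this gives
  `𝔪 K D = 𝔪` for a lattice `D`, and iteration gives `𝔪 K = 𝔪`, since the powers of `K`, which
  consists of integral elements, stabilize (`IsDualizing.mul_eq_of_reflexive`). Conversely,
  `𝔪 K = 𝔪` makes the two descriptions coincide.
* `E` is Gorenstein if and only if `E : (E : X) = X` for all lattices `X` over `E`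
  (`isGorenstein_of_div_div_eq`, `div_div_eq_of_isGorenstein`). In that case `𝔪` and `𝔪 K` are
  invertible over `E`, so that `𝔪` is stable and `𝔪 K = 𝔪`. Conversely, these two conditions make
  `E` isomorphic to its canonical lattice.

It remains to see that `R` is almost Gorenstein if and only if `𝔪 K = 𝔪`
(`isAlmostGorenstein_iff`). Every canonical ideal is a multiple of `K` by a unit of `Q`, so that its
`e₁` is `ℓ(S / R)`, where `S = K ^ n` for large `n`, and the type of `R` is `r = ℓ((R : 𝔪) / R)`.
Duality gives `ℓ(S / R) + 1 = ℓ(R / 𝔠) + r + ℓ(𝔪 K / 𝔪)` with `𝔠 = K : S`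
(`IsDualizing.quotLength_add_one`). If `e₁ ≤ r`, then at most one of the lengths of `R / 𝔠` and
`𝔪 K / 𝔪` is nonzero, and `𝔠 = R` only for `K = R`, so that `𝔪 K = 𝔪` in any case. Conversely,
`𝔪 K = 𝔪` implies that `𝔪 S = 𝔪`, and `𝔪 ⊆ 𝔠` leaves at most length one for `R / 𝔠`.
-/

namespace OneDim

open CategoryTheory Abelian
open scoped Pointwise nonZeroDivisors

/-! ### Vanishing of `Ext` and self-injectivity modulo a parameter -/

section Ext

variable {A : Type u} [CommRing A]

lemma subsingleton_ext_middle {N₁ N₂ N₃ : Type u} [AddCommGroup N₁] [Module A N₁]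
    [AddCommGroup N₂] [Module A N₂] [AddCommGroup N₃] [Module A N₃]
    {f : N₁ →ₗ[A] N₂} {g : N₂ →ₗ[A] N₃} (hf : Function.Injective f)
    (hg : Function.Surjective g) (hfg : Function.Exact f g) (M : ModuleCat.{u} A) (i : ℕ)
    (h₁ : Subsingleton (Ext.{u} (ModuleCat.of A N₁) M i))
    (h₃ : Subsingleton (Ext.{u} (ModuleCat.of A N₃) M i)) :
    Subsingleton (Ext.{u} (ModuleCat.of A N₂) M i) := by
  have hS := ModuleCat.shortComplex_shortExact
    (ModuleCat.shortComplexOfCompEqZero f g hfg.linearMap_comp_eq_zero) hfg hf hg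
  refine subsingleton_of_forall_eq 0 fun x => ?_
  obtain ⟨y, rfl⟩ := Ext.contravariant_sequence_exact₂ hS M x (h₁.elim _ _)
  rw [h₃.elim y 0, Ext.comp_zero]

lemma subsingleton_ext_left {N₁ N₂ N₃ : Type u} [AddCommGroup N₁] [Module A N₁]
    [AddCommGroup N₂] [Module A N₂] [AddCommGroup N₃] [Module A N₃]
    {f : N₁ →ₗ[A] N₂} {g : N₂ →ₗ[A] N₃} (hf : Function.Injective f)
    (hg : Function.Surjective g) (hfg : Function.Exact f g) (M : ModuleCat.{u} A) (i : ℕ)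
    (h₂ : Subsingleton (Ext.{u} (ModuleCat.of A N₂) M i))
    (h₃ : Subsingleton (Ext.{u} (ModuleCat.of A N₃) M (i + 1))) :
    Subsingleton (Ext.{u} (ModuleCat.of A N₁) M i) := by
  have hS := ModuleCat.shortComplex_shortExact
    (ModuleCat.shortComplexOfCompEqZero f g hfg.linearMap_comp_eq_zero) hfg hf hg
  refine subsingleton_of_forall_eq 0 fun x => ?_
  obtain ⟨y, rfl⟩ := Ext.contravariant_sequence_exact₁ hS M x (add_comm 1 i) (h₃.elim _ _)
  rw [h₂.elim y 0, Ext.comp_zero]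

lemma subsingleton_ext_right {N₁ N₂ N₃ : Type u} [AddCommGroup N₁] [Module A N₁]
    [AddCommGroup N₂] [Module A N₂] [AddCommGroup N₃] [Module A N₃]
    {f : N₁ →ₗ[A] N₂} {g : N₂ →ₗ[A] N₃} (hf : Function.Injective f)
    (hg : Function.Surjective g) (hfg : Function.Exact f g) (M : ModuleCat.{u} A) (i : ℕ)
    (h₁ : Subsingleton (Ext.{u} (ModuleCat.of A N₁) M i))
    (h₂ : Subsingleton (Ext.{u} (ModuleCat.of A N₂) M (i + 1))) :
    Subsingleton (Ext.{u} (ModuleCat.of A N₃) M (i + 1)) := by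
  have hS := ModuleCat.shortComplex_shortExact
    (ModuleCat.shortComplexOfCompEqZero f g hfg.linearMap_comp_eq_zero) hfg hf hg
  refine subsingleton_of_forall_eq 0 fun x => ?_
  obtain ⟨y, rfl⟩ := Ext.contravariant_sequence_exact₃ hS M x (h₂.elim _ _) (add_comm 1 i)
  rw [h₁.elim y 0, Ext.comp_zero]

/-- A nonzero finitely generated module over a local ring that is killed by an element lying in no
prime but the maximal one has a nonzero socle. -/
lemma exists_socle_element [IsLocalRing A] [IsNoetherianRing A] {t : A}
    (ht : ∀ p : Ideal A, p.IsPrime → t ∈ p → p = IsLocalRing.maximalIdeal A)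
    (M : Type u) [AddCommGroup M] [Module A M] [Nontrivial M] (htM : ∀ x : M, t • x = 0) :
    ∃ x : M, x ≠ 0 ∧ ∀ r : A, r • x = 0 ↔ r ∈ IsLocalRing.maximalIdeal A := by
  obtain ⟨p, hp⟩ := associatedPrimes.nonempty A M
  obtain ⟨hprime, x, hx⟩ := isAssociatedPrime_iff.1 (AssociatedPrimes.mem_iff.1 hp)
  have hm : p = IsLocalRing.maximalIdeal A := by
    refine ht p hprime ?_
    rw [hx, Submodule.mem_colon_singleton]
    simp [htM]
  refine ⟨x, ?_, fun r => ?_⟩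
  · rintro rfl
    apply hprime.ne_top
    rw [hx]
    ext r
    simp [Submodule.mem_colon_singleton]
  · rw [← hm, hx, Submodule.mem_colon_singleton, Submodule.mem_bot]

/-- The residue field of a local ring embeds into any module with a nonzero socle element. -/
lemma exists_injective_of_socle [IsLocalRing A] {M : Type u} [AddCommGroup M] [Module A M] {x : M}
    (hx : ∀ r : A, r • x = 0 ↔ r ∈ IsLocalRing.maximalIdeal A) :
    ∃ f : (A ⧸ IsLocalRing.maximalIdeal A) →ₗ[A] M, Function.Injective f ∧
      f (Ideal.Quotient.mk _ 1) = x := by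
  refine ⟨Submodule.liftQ _ (LinearMap.toSpanSingleton A M x) ?_, ?_, ?_⟩
  · intro r hr
    simpa using (hx r).2 hr
  · rw [← LinearMap.ker_eq_bot, Submodule.ker_liftQ_eq_bot]
    intro r hr
    exact (hx r).1 (by simpa using hr)
  · exact one_smul A x

/-- Over a one-dimensional Cohen-Macaulay local ring, a module of finite injective dimension has
`Ext^i(N, M) = 0` for all `i ≥ 2` and all `N` killed by the parameter `t`: the residue field embeds
into `A / t`, which has projective dimension one, so that a vanishing in degree `i + 1` descends to
degree `i`. -/
lemma subsingleton_ext_of_hasFiniteInjDim [IsLocalRing A] [IsNoetherianRing A] {t : A}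
    (htreg : IsSMulRegular A t) (htm : t ∈ IsLocalRing.maximalIdeal A)
    (ht : ∀ p : Ideal A, p.IsPrime → t ∈ p → p = IsLocalRing.maximalIdeal A)
    (M : Type u) [AddCommGroup M] [Module A M] (hM : HasFiniteInjDim A M)
    (N : Type u) [AddCommGroup N] [Module A N] (hN : Module.Finite A N)
    (htN : ∀ x : N, t • x = 0) (i : ℕ) (hi : 2 ≤ i) :
    Subsingleton (Ext.{u} (ModuleCat.of A N) (ModuleCat.of A M) i) := by
  -- Descending induction on `i`, starting above the injective dimension of `M`.
  obtain ⟨n, hn⟩ := hM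
  obtain ⟨k, hk⟩ : ∃ k, n + 1 ≤ i + k := ⟨n + 1, by omega⟩
  induction k generalizing i N with
  | zero => exact HasInjectiveDimensionLT.subsingleton _ (n + 1) i (by omega) _
  | succ k ih =>
    have hQ : ∀ x : QuotSMulTop t A, t • x = 0 := fun x => by
      exact Module.mem_annihilator.1 (QuotSMulTop.mem_annihilator A t) x
    have hnt : Nontrivial (QuotSMulTop t A) := by
      refine Submodule.Quotient.nontrivial_iff.2 fun h => ?_
      have h1 : (1 : A) ∈ t • (⊤ : Submodule A A) := by rw [h]; exact Submodule.mem_top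
      obtain ⟨y, -, hy⟩ := (Submodule.mem_smul_pointwise_iff_exists _ _ _).1 h1
      exact (IsLocalRing.mem_maximalIdeal t).1 htm (IsUnit.of_mul_eq_one y (by simpa using hy))
    obtain ⟨s, -, hs⟩ := exists_socle_element ht (QuotSMulTop t A) hQ
    obtain ⟨f, hf, -⟩ := exists_injective_of_socle hs
    -- A prime filtration of `N` reduces to the residue field, as `t` kills `N`.
    induction hN using IsNoetherianRing.induction_on_isQuotientEquivQuotientPrime A with
    | subsingleton N =>
      refine subsingleton_of_forall_eq 0 fun x => ?_
      rw [← x.mk₀_id_comp, (ModuleCat.isZero_of_subsingleton (ModuleCat.of A N)).eq_of_src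
        (𝟙 _) 0, Ext.mk₀_zero, Ext.zero_comp]
    | quotient N p e =>
      have hp : p.1 = IsLocalRing.maximalIdeal A := by
        refine ht p.1 p.2 ?_
        rw [← Ideal.Quotient.eq_zero_iff_mem]
        have := htN (e.symm 1)
        rw [← map_smul] at this
        have h2 := (e.symm.map_eq_zero_iff).1 this
        rwa [Algebra.smul_def, mul_one] at h2
      let g : N →ₗ[A] QuotSMulTop t A :=
        f ∘ₗ ((Submodule.quotEquivOfEq _ _ hp).toLinearMap ∘ₗ e.toLinearMap)
      have hg : Function.Injective g := hf.comp
        ((Submodule.quotEquivOfEq _ _ hp).injective.comp e.injective)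
      refine subsingleton_ext_left hg (Submodule.mkQ_surjective (LinearMap.range g))
        (LinearMap.exact_map_mkQ_range g) _ i ?_ ?_
      · obtain ⟨j, rfl⟩ : ∃ j, i = j + 1 + 1 := ⟨i - 2, by omega⟩
        have hP : ∀ j, Subsingleton (Ext.{u} (ModuleCat.of A A) (ModuleCat.of A M) (j + 1)) :=
          fun j => subsingleton_of_forall_eq 0 fun x => x.eq_zero_of_projective
        exact subsingleton_ext_right (f := LinearMap.lsmul A A t)
          (g := (t • (⊤ : Submodule A A)).mkQ) htreg (Submodule.mkQ_surjective _)
          (LinearMap.exact_lsmul_mkQ_smul_top A t) _ (j + 1) (hP j) (hP (j + 1))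
      · refine ih _ inferInstance ?_ (i + 1) (by omega) (by omega)
        intro x
        obtain ⟨x, rfl⟩ := Submodule.mkQ_surjective _ x
        rw [← map_smul, hQ, map_zero]
    | exact N₁ N₂ N₃ f g hf hg hfg h₁ h₃ =>
      refine subsingleton_ext_middle hf hg hfg _ i (h₁ fun x => hf ?_) (h₃ fun x => ?_)
      · rw [map_smul, htN, map_zero]
      · obtain ⟨x, rfl⟩ := hg x
        rw [← map_smul, htN, map_zero]

/-- Injectivity of `M / t M` as a module over `A / t`, tested on finitely generated modules: every
homomorphism to `M / t M` from a submodule of a finitely generated module killed by `t` extends. -/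
def QuotInjective (A : Type u) [CommRing A] (t : A) (M : Type u) [AddCommGroup M] [Module A M] :
    Prop :=
  ∀ (N : Type u) [AddCommGroup N] [Module A N], Module.Finite A N → (∀ x : N, t • x = 0) →
    ∀ (X : Submodule A N) (f : X →ₗ[A] QuotSMulTop t M),
      ∃ g : N →ₗ[A] QuotSMulTop t M, ∀ x : X, g x = f x

/-- A criterion for extending `f : S.X₁ ⟶ T.X₃` along `S.f`: the obstruction in `Ext^1(S.X₁, T.X₁)`
comes from `Ext^1(S.X₂, T.X₁)`, hence from a morphism `g : S.X₂ ⟶ T.X₃`, and `f - g` on `S.X₁` lifts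
to `T.X₂`. -/
lemma exists_extension_of_shortExact {S T : ShortComplex (ModuleCat.{u} A)} (hS : S.ShortExact)
    (hT : T.ShortExact) (h2 : Subsingleton (Ext.{u} S.X₃ T.X₁ 2))
    (h1 : ∀ η : Ext.{u} S.X₂ T.X₁ 1, η.comp (Ext.mk₀ T.f) (add_zero 1) = 0)
    (h0 : ∀ h : S.X₁ ⟶ T.X₂, h = 0) (f : S.X₁ ⟶ T.X₃) : ∃ g : S.X₂ ⟶ T.X₃, S.f ≫ g = f := by
  obtain ⟨η, hη⟩ := Ext.contravariant_sequence_exact₁ hS T.X₁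
    ((Ext.mk₀ f).comp hT.extClass (zero_add 1)) (add_comm 1 1) (h2.elim _ _)
  obtain ⟨ψ, hψ⟩ := Ext.covariant_sequence_exact₁ _ hT η (h1 η) (zero_add 1)
  obtain ⟨g, rfl⟩ := (Ext.mk₀_bijective _ _).surjective ψ
  have hd : (Ext.mk₀ (f - S.f ≫ g)).comp hT.extClass (zero_add 1) = 0 := by
    rw [sub_eq_add_neg, Ext.mk₀_add, Ext.mk₀_neg, Ext.add_comp, Ext.neg_comp, ← Ext.mk₀_comp_mk₀,
      Ext.comp_assoc _ _ _ (zero_add 0) (zero_add 1) (by simp), hψ, hη, add_neg_cancel]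
  obtain ⟨χ, hχ⟩ := Ext.covariant_sequence_exact₃ _ hT _ (zero_add 1) hd
  obtain ⟨h, rfl⟩ := (Ext.mk₀_bijective _ _).surjective χ
  rw [h0 h, Ext.mk₀_zero, Ext.zero_comp] at hχ
  exact ⟨g, (sub_eq_zero.1 ((Ext.mk₀_eq_zero_iff _).1 hχ.symm)).symm⟩

/-- If `M` has finite injective dimension and `t` is a regular parameter on the one-dimensional
ring `A` and on `M`, then `M / t M` is injective over `A / t`. -/
lemma quotInjective_of_hasFiniteInjDim [IsLocalRing A] [IsNoetherianRing A] {t : A}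
    (htreg : IsSMulRegular A t) (htm : t ∈ IsLocalRing.maximalIdeal A)
    (ht : ∀ p : Ideal A, p.IsPrime → t ∈ p → p = IsLocalRing.maximalIdeal A)
    (M : Type u) [AddCommGroup M] [Module A M] (hM : HasFiniteInjDim A M)
    (htM : IsSMulRegular M t) : QuotInjective A t M := by
  intro N _ _ hN htN X f
  have hT := htM.smulShortComplex_shortExact (M := ModuleCat.of A M)
  have hS := ModuleCat.shortComplex_shortExact
    (ModuleCat.shortComplexOfCompEqZero X.subtype X.mkQ
      (LinearMap.exact_subtype_mkQ X).linearMap_comp_eq_zero)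
    (LinearMap.exact_subtype_mkQ X) X.injective_subtype X.mkQ_surjective
  have h2 : Subsingleton (Ext.{u} (ModuleCat.of A (N ⧸ X)) (ModuleCat.of A M) 2) := by
    refine subsingleton_ext_of_hasFiniteInjDim htreg htm ht M hM _ inferInstance ?_ 2 le_rfl
    intro x
    obtain ⟨x, rfl⟩ := Submodule.mkQ_surjective _ x
    rw [← map_smul, htN, map_zero]
  have hη (η : Ext.{u} (ModuleCat.of A N) (ModuleCat.of A M) 1) :
      η.comp (Ext.mk₀ (t • 𝟙 (ModuleCat.of A M))) (add_zero 1) = 0 := by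
    have h0 : t • 𝟙 (ModuleCat.of A N) = 0 := by
      ext x
      exact htN x
    rw [Ext.mk₀_smul, Ext.comp_smul, Ext.comp_mk₀_id, ← η.mk₀_id_comp, ← Ext.smul_comp,
      ← Ext.mk₀_smul, h0, Ext.mk₀_zero, Ext.zero_comp]
  obtain ⟨g, hg⟩ := exists_extension_of_shortExact hS hT h2 hη (fun h => by
    ext x
    apply htM
    change t • h.hom x = t • 0
    rw [← map_smul, smul_zero, show t • x = 0 from Subtype.ext (htN x), map_zero])
    (ModuleCat.ofHom f)
  exact ⟨g.hom, fun x => congrArg (fun k => k.hom x) hg⟩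

/-- `M / t M` cogenerates the finitely generated modules killed by `t`. -/
lemma exists_hom_quot_ne_zero [IsLocalRing A] [IsNoetherianRing A] {t : A}
    (htm : t ∈ IsLocalRing.maximalIdeal A)
    (ht : ∀ p : Ideal A, p.IsPrime → t ∈ p → p = IsLocalRing.maximalIdeal A)
    (M : Type u) [AddCommGroup M] [Module A M] [Module.Finite A M] [Nontrivial M]
    (hinj : QuotInjective A t M) (N : Type u) [AddCommGroup N] [Module A N]
    [hN : Module.Finite A N] (htN : ∀ x : N, t • x = 0) {x : N} (hx : x ≠ 0) :
    ∃ g : N →ₗ[A] QuotSMulTop t M, g x ≠ 0 := by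
  have hnt : Nontrivial (QuotSMulTop t M) := by
    refine Submodule.Quotient.nontrivial_iff.2 fun h => ?_
    refine (top_ne_bot (α := Submodule A M)) (Submodule.eq_bot_of_le_smul_of_le_jacobson_bot
      (Ideal.span {t}) ⊤ Module.Finite.fg_top ?_ ?_)
    · rw [Submodule.ideal_span_singleton_smul]
      exact h.ge
    · rw [Ideal.span_singleton_le_iff_mem, IsLocalRing.jacobson_eq_maximalIdeal _ bot_ne_top]
      exact htm
  obtain ⟨s, hs0, hs⟩ := exists_socle_element ht (QuotSMulTop t M)
    (Module.mem_annihilator.1 (QuotSMulTop.mem_annihilator M t))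
  let X := Submodule.span A {x}
  -- As the annihilator of `x` lies in `𝔪`, which annihilates `s`, there is a homomorphism
  -- `A x → M / t M` that maps `x` to `s`.
  let π : A →ₗ[A] X := LinearMap.toSpanSingleton A X ⟨x, Submodule.mem_span_singleton_self x⟩
  have hπ : Function.Surjective π := by
    rintro ⟨y, hy⟩
    obtain ⟨r, rfl⟩ := Submodule.mem_span_singleton.1 hy
    exact ⟨r, rfl⟩
  have hker : LinearMap.ker π ≤ LinearMap.ker (LinearMap.toSpanSingleton A _ s) := by
    intro r hr
    rw [LinearMap.mem_ker, LinearMap.toSpanSingleton_apply, hs, IsLocalRing.mem_maximalIdeal]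
    intro hu
    have h1 : r • x = 0 := congrArg Subtype.val (LinearMap.mem_ker.1 hr)
    exact hx ((hu.smul_eq_zero).1 h1)
  let f : X →ₗ[A] QuotSMulTop t M :=
    (Submodule.liftQ _ (LinearMap.toSpanSingleton A _ s) hker) ∘ₗ
      (π.quotKerEquivOfSurjective hπ).symm.toLinearMap
  obtain ⟨g, hg⟩ := hinj N hN htN X f
  refine ⟨g, ?_⟩
  have h1 : (⟨x, Submodule.mem_span_singleton_self x⟩ : X) = π 1 := (one_smul _ _).symm
  have h2 := hg ⟨x, Submodule.mem_span_singleton_self x⟩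
  have h3 : f (π 1) = s := by
    have : (π.quotKerEquivOfSurjective hπ).symm (π 1) = Submodule.Quotient.mk 1 := by
      rw [LinearEquiv.symm_apply_eq]
      rfl
    simp only [f, LinearMap.comp_apply, LinearEquiv.coe_coe, this]
    exact one_smul A s
  rw [h1, h3] at h2
  exact fun h => hs0 (h2.symm.trans ((congrArg (fun y : X => g y) h1).symm.trans h))

end Ext

/-! ### Lifting homomorphisms modulo a parameter -/

section Lift

variable {A : Type u} [CommRing A]

lemma exists_comp_eq_of_ker_le {Z X P : Type*} [AddCommGroup Z] [Module A Z] [AddCommGroup X]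
    [Module A X] [AddCommGroup P] [Module A P] {π : Z →ₗ[A] X} (hπ : Function.Surjective π)
    {φ : Z →ₗ[A] P} (h : LinearMap.ker π ≤ LinearMap.ker φ) :
    ∃ f : X →ₗ[A] P, ∀ z, f (π z) = φ z := by
  refine ⟨(Submodule.liftQ _ φ h) ∘ₗ (π.quotKerEquivOfSurjective hπ).symm.toLinearMap,
    fun z => ?_⟩
  have : (π.quotKerEquivOfSurjective hπ).symm (π z) = Submodule.Quotient.mk z := by
    rw [LinearEquiv.symm_apply_eq]
    rfl
  simp only [LinearMap.comp_apply, LinearEquiv.coe_coe, this]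
  rfl

lemma exists_smul_eq_of_forall_mem {Z M : Type*} [AddCommGroup Z] [Module A Z] [AddCommGroup M]
    [Module A M] {t : A} (ht : IsSMulRegular M t) {φ : Z →ₗ[A] M}
    (h : ∀ z, φ z ∈ t • (⊤ : Submodule A M)) : ∃ ψ : Z →ₗ[A] M, φ = t • ψ := by
  let e := LinearEquiv.ofInjective (LinearMap.lsmul A M t) ht
  have h' : ∀ z, φ z ∈ LinearMap.range (LinearMap.lsmul A M t) := fun z => by
    obtain ⟨y, -, hy⟩ := (Submodule.mem_smul_pointwise_iff_exists _ _ _).1 (h z)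
    exact ⟨y, hy⟩
  refine ⟨e.symm.toLinearMap ∘ₗ φ.codRestrict _ h', ?_⟩
  ext z
  have := congrArg Subtype.val (e.apply_symm_apply (φ.codRestrict _ h' z))
  exact this.symm

lemma mem_smul_top_iff {M : Type*} [AddCommGroup M] [Module A M] {t : A} {x : M} :
    x ∈ t • (⊤ : Submodule A M) ↔ ∃ y, t • y = x := by
  simp [Submodule.mem_smul_pointwise_iff_exists]

lemma smul_quotSMulTop_eq_zero (t : A) (M : Type*) [AddCommGroup M] [Module A M]
    (x : QuotSMulTop t M) : t • x = 0 :=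
  Module.mem_annihilator.1 (QuotSMulTop.mem_annihilator M t) x

/-- The vanishing of `Ext^1(F / Z, M)` for `F / Z` torsion-free: as `M / t M` is injective over
`A / t`, a homomorphism `Z → M` extends to `F` modulo `t`, and Nakayama's lemma applies to
`Hom(Z, M)`. -/
lemma QuotInjective.exists_extension [IsNoetherianRing A] {t : A}
    (htj : t ∈ (⊥ : Ideal A).jacobson) {M : Type u} [AddCommGroup M] [Module A M]
    [Module.Finite A M] (htM : IsSMulRegular M t) (hinj : QuotInjective A t M)
    {F : Type u} [AddCommGroup F] [Module A F] [Module.Finite A F] [Module.Projective A F]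
    {Z : Submodule A F} (hZ : ∀ x, t • x ∈ Z → x ∈ Z) (g : Z →ₗ[A] M) :
    ∃ h : F →ₗ[A] M, ∀ z : Z, h z = g z := by
  have key : (⊤ : Submodule A (Z →ₗ[A] M)) ≤ LinearMap.range (LinearMap.lcomp A M Z.subtype) := by
    refine Submodule.le_of_le_smul_of_le_jacobson_bot (I := Ideal.span {t}) Module.Finite.fg_top
      ((Ideal.span_singleton_le_iff_mem _).2 htj) ?_
    -- As `F / Z` is torsion-free, `Z ∩ t F = t Z`, so that `g` induces a homomorphism to `M / t M`
    -- on the image of `Z` in `F / t F`.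
    rintro g -
    let ρ : Z →ₗ[A] QuotSMulTop t F := (t • (⊤ : Submodule A F)).mkQ ∘ₗ Z.subtype
    obtain ⟨f, hf⟩ := exists_comp_eq_of_ker_le (π := ρ.rangeRestrict)
      ρ.surjective_rangeRestrict (φ := (t • (⊤ : Submodule A M)).mkQ ∘ₗ g) (by
        intro z hz
        rw [LinearMap.ker_rangeRestrict, LinearMap.mem_ker] at hz
        obtain ⟨y, hy⟩ := mem_smul_top_iff.1 ((Submodule.Quotient.mk_eq_zero _).1 hz)
        rw [LinearMap.mem_ker]
        refine (Submodule.Quotient.mk_eq_zero _).2 (mem_smul_top_iff.2 ?_)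
        have hyZ : y ∈ Z := hZ y (by rw [hy]; exact z.2)
        refine ⟨g ⟨y, hyZ⟩, ?_⟩
        rw [← map_smul]
        exact congrArg g (Subtype.ext hy))
    obtain ⟨ψ, hψ⟩ := hinj _ inferInstance (smul_quotSMulTop_eq_zero t F) _ f
    obtain ⟨h, hh⟩ := Module.projective_lifting_property (t • (⊤ : Submodule A M)).mkQ
      (ψ ∘ₗ (t • (⊤ : Submodule A F)).mkQ) (Submodule.mkQ_surjective _)
    obtain ⟨g', hg'⟩ := exists_smul_eq_of_forall_mem (φ := g - h ∘ₗ Z.subtype) htM (by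
      intro z
      rw [← Submodule.Quotient.mk_eq_zero, LinearMap.sub_apply, Submodule.Quotient.mk_sub,
        sub_eq_zero]
      have h1 := hf z
      rw [← hψ] at h1
      exact h1.symm.trans (LinearMap.congr_fun hh z).symm)
    rw [Submodule.ideal_span_singleton_smul, sub_eq_iff_eq_add'.1 hg']
    exact Submodule.add_mem_sup ⟨h, rfl⟩ (mem_smul_top_iff.2 ⟨g', rfl⟩)
  obtain ⟨h, hh⟩ := key (Submodule.mem_top : g ∈ ⊤)
  exact ⟨h, fun z => LinearMap.congr_fun hh z⟩

/-- Homomorphisms from a torsion-free module to `M / t M` lift to `M`. -/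
lemma QuotInjective.exists_lift [IsNoetherianRing A] {t : A}
    (htj : t ∈ (⊥ : Ideal A).jacobson) {M : Type u} [AddCommGroup M] [Module A M]
    [Module.Finite A M] (htM : IsSMulRegular M t) (hinj : QuotInjective A t M)
    {N : Type u} [AddCommGroup N] [Module A N] [Module.Finite A N] (htN : IsSMulRegular N t)
    (g : N →ₗ[A] QuotSMulTop t M) : ∃ h : N →ₗ[A] M, ∀ x, Submodule.Quotient.mk (h x) = g x := by
  -- Lift to a free cover of `N`; on its relations the lift is `t g'`, and subtracting `t` times an
  -- extension of `g'` makes it vanish there.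
  obtain ⟨n, π, hπ⟩ := Module.Finite.exists_fin' A N
  obtain ⟨h, hh⟩ := Module.projective_lifting_property (t • (⊤ : Submodule A M)).mkQ
    (g ∘ₗ π) (Submodule.mkQ_surjective _)
  have hZ : ∀ x, t • x ∈ LinearMap.ker π → x ∈ LinearMap.ker π := by
    intro x hx
    rw [LinearMap.mem_ker, map_smul] at hx
    exact htN (hx.trans (smul_zero t).symm)
  obtain ⟨g', hg'⟩ := exists_smul_eq_of_forall_mem (φ := h ∘ₗ (LinearMap.ker π).subtype) htM (by
    intro z
    rw [← Submodule.Quotient.mk_eq_zero]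
    refine (LinearMap.congr_fun hh z).trans ?_
    rw [LinearMap.comp_apply, LinearMap.mem_ker.1 z.2, map_zero])
  obtain ⟨k, hk⟩ := hinj.exists_extension htj htM hZ g'
  obtain ⟨f, hf⟩ := exists_comp_eq_of_ker_le hπ (φ := h - t • k) (by
    intro z hz
    have h1 := LinearMap.congr_fun hg' ⟨z, hz⟩
    have h2 := hk ⟨z, hz⟩
    rw [LinearMap.mem_ker, LinearMap.sub_apply, sub_eq_zero, LinearMap.smul_apply, h2]
    exact h1)
  refine ⟨f, fun x => ?_⟩
  obtain ⟨y, rfl⟩ := hπ x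
  rw [hf, LinearMap.sub_apply, Submodule.Quotient.mk_sub]
  have h1 : (Submodule.Quotient.mk ((t • k) y) : QuotSMulTop t M) = 0 :=
    (Submodule.Quotient.mk_eq_zero _).2 (mem_smul_top_iff.2 ⟨k y, rfl⟩)
  rw [h1, sub_zero]
  exact LinearMap.congr_fun hh y

/-- Elements outside `t N` of a torsion-free module are detected by homomorphisms to `M`. -/
lemma QuotInjective.exists_hom_notMem [IsLocalRing A] [IsNoetherianRing A] {t : A}
    (htm : t ∈ IsLocalRing.maximalIdeal A)
    (ht : ∀ p : Ideal A, p.IsPrime → t ∈ p → p = IsLocalRing.maximalIdeal A)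
    {M : Type u} [AddCommGroup M] [Module A M] [Module.Finite A M] [Nontrivial M]
    (htM : IsSMulRegular M t) (hinj : QuotInjective A t M)
    {N : Type u} [AddCommGroup N] [Module A N] [Module.Finite A N] (htN : IsSMulRegular N t)
    {x : N} (hx : ∀ y, t • y ≠ x) : ∃ g : N →ₗ[A] M, ∀ y, t • y ≠ g x := by
  have hx0 : (Submodule.Quotient.mk x : QuotSMulTop t N) ≠ 0 := by
    intro h
    obtain ⟨y, hy⟩ := mem_smul_top_iff.1 ((Submodule.Quotient.mk_eq_zero _).1 h)
    exact hx y hy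
  obtain ⟨g, hg⟩ := exists_hom_quot_ne_zero htm ht M hinj (QuotSMulTop t N)
    (smul_quotSMulTop_eq_zero t N) hx0
  have htj : t ∈ (⊥ : Ideal A).jacobson := by
    rwa [IsLocalRing.jacobson_eq_maximalIdeal _ bot_ne_top]
  obtain ⟨h, hh⟩ := hinj.exists_lift htj htM htN (g ∘ₗ (t • (⊤ : Submodule A N)).mkQ)
  refine ⟨h, fun y hy => hg ?_⟩
  have h1 := hh x
  rw [(Submodule.Quotient.mk_eq_zero _).2 (mem_smul_top_iff.2 ⟨y, hy⟩)] at h1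
  exact h1.symm

/-- If homomorphisms to `A` extend from kernels of linear forms to free modules, i.e. if
`Ext^1(I, A) = 0` for all ideals `I`, then `A` has injective dimension at most one: for an injective
module `J ⊇ A` the quotient `J / A` satisfies Baer's criterion. -/
lemma hasInjectiveDimensionLE_one [IsNoetherianRing A]
    (H : ∀ (n : ℕ) (f : (Fin n → A) →ₗ[A] A) (g : LinearMap.ker f →ₗ[A] A),
      ∃ h : (Fin n → A) →ₗ[A] A, ∀ z : LinearMap.ker f, h z = g z) :
    HasInjectiveDimensionLE (ModuleCat.of A A) 1 := by
  obtain ⟨J, hJ, j, hj⟩ := EnoughInjectives.presentation (ModuleCat.of A A)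
  have injj : Function.Injective j.hom := (ModuleCat.mono_iff_injective j).mp ‹_›
  let S : ShortComplex (ModuleCat.{u} A) :=
    ModuleCat.shortComplexOfCompEqZero _ _ j.hom.exact_map_mkQ_range.linearMap_comp_eq_zero
  have exactS := ModuleCat.shortComplex_shortExact S
    j.hom.exact_map_mkQ_range injj (Submodule.mkQ_surjective _)
  refine (exactS.hasInjectiveDimensionLT_X₃_iff 0 hJ).1 ?_
  rw [zero_add, ← injective_iff_hasInjectiveDimensionLT_one,
    ← Module.injective_iff_injective_object]
  have hJ' : Module.Baer A J :=
    Module.Baer.of_injective (Module.injective_module_of_injective_object A J)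
  rw [← Module.Baer.iff_injective]
  change Module.Baer A (J ⧸ LinearMap.range j.hom)
  intro I g
  obtain ⟨n, π, hπ⟩ := Module.Finite.exists_fin' A I
  obtain ⟨h, hh⟩ := Module.projective_lifting_property (LinearMap.range j.hom).mkQ
    (g ∘ₗ π) (Submodule.mkQ_surjective _)
  let f : (Fin n → A) →ₗ[A] A := I.subtype ∘ₗ π
  have hker : LinearMap.ker f = LinearMap.ker π := by
    rw [LinearMap.ker_comp, Submodule.ker_subtype]
    rfl
  have hmem : ∀ z : LinearMap.ker f,
      (h ∘ₗ (LinearMap.ker f).subtype) z ∈ LinearMap.range j.hom := by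
    intro z
    rw [← Submodule.Quotient.mk_eq_zero]
    refine (LinearMap.congr_fun hh z).trans ?_
    have : π z = 0 := Subtype.ext (LinearMap.mem_ker.1 z.2)
    rw [LinearMap.comp_apply, this, map_zero]
  let e := LinearEquiv.ofInjective j.hom injj
  obtain ⟨k, hk⟩ := H n f (e.symm.toLinearMap ∘ₗ
    (h ∘ₗ (LinearMap.ker f).subtype).codRestrict _ hmem)
  have hk' : ∀ z : LinearMap.ker f, j.hom (k z) = h z := by
    intro z
    rw [hk]
    exact congrArg Subtype.val (e.apply_symm_apply _)
  obtain ⟨l, hl⟩ := exists_comp_eq_of_ker_le hπ (φ := h - j.hom ∘ₗ k) (by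
    intro z hz
    rw [LinearMap.mem_ker, LinearMap.sub_apply, sub_eq_zero]
    exact (hk' ⟨z, hker ▸ hz⟩).symm)
  obtain ⟨g', hg'⟩ := hJ' I l
  refine ⟨(LinearMap.range j.hom).mkQ ∘ₗ g', fun x hx => ?_⟩
  obtain ⟨y, hy⟩ := hπ ⟨x, hx⟩
  rw [LinearMap.comp_apply, hg' x hx, ← hy, hl, LinearMap.sub_apply, map_sub]
  have h1 : (LinearMap.range j.hom).mkQ ((j.hom ∘ₗ k) y) = 0 :=
    (Submodule.Quotient.mk_eq_zero _).2 ⟨k y, rfl⟩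
  rw [h1, sub_zero]
  exact LinearMap.congr_fun hh y

/-- A Noetherian ring in which every ideal is an annihilator is injective over itself. -/
lemma baer_of_exists_annihilator {B : Type u} [CommRing B] [IsNoetherianRing B]
    (H : ∀ (I : Ideal B) (x : B), x ∉ I → ∃ b : B, (∀ y ∈ I, b * y = 0) ∧ b * x ≠ 0) :
    Module.Baer B B := by
  -- `ann (I ∩ J) = ann I + ann J`, as both ideals have the same annihilator.
  have hann : ∀ I J : Ideal B, ∀ b, (∀ x ∈ I ⊓ J, b * x = 0) →
      ∃ c d, b = c + d ∧ (∀ x ∈ I, c * x = 0) ∧ ∀ x ∈ J, d * x = 0 := by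
    intro I J b hb
    by_contra! hcon
    have hb' : b ∉ Submodule.annihilator I ⊔ Submodule.annihilator J := by
      intro hmem
      obtain ⟨c, hc, d, hd, rfl⟩ := Submodule.mem_sup.1 hmem
      obtain ⟨x, hx, hx0⟩ := hcon c d rfl fun x hx => Submodule.mem_annihilator.1 hc x hx
      exact hx0 (Submodule.mem_annihilator.1 hd x hx)
    obtain ⟨a, ha, hab⟩ := H _ b hb'
    have mem_of : ∀ I : Ideal B, (∀ y ∈ Submodule.annihilator I, a * y = 0) → a ∈ I := by
      intro I hI
      by_contra haI
      obtain ⟨y, hy, hya⟩ := H I a haI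
      exact hya (by rw [mul_comm]; exact hI y (Submodule.mem_annihilator.2 fun n hn => hy n hn))
    refine hab ?_
    rw [mul_comm]
    exact hb a ⟨mem_of I fun y hy => ha y (Submodule.mem_sup_left hy),
      mem_of J fun y hy => ha y (Submodule.mem_sup_right hy)⟩
  have key : ∀ I : Ideal B, ∀ f : I →ₗ[B] B, ∃ b, ∀ x : I, f x = b * x := by
    intro I
    have hI : I.FG := IsNoetherian.noetherian I
    induction I, hI using Submodule.fg_induction with
    | singleton x =>
      intro f
      let x' : Submodule.span B {x} := ⟨x, Submodule.mem_span_singleton_self x⟩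
      have hfx : f x' ∈ Submodule.span B {x} := by
        by_contra hcon
        obtain ⟨b, hb, hbx⟩ := H (Submodule.span B {x}) (f x') hcon
        refine hbx ?_
        rw [← smul_eq_mul, ← map_smul]
        have : b • x' = 0 := Subtype.ext (hb x (Submodule.mem_span_singleton_self x))
        rw [this, map_zero]
      obtain ⟨b, hb⟩ := Submodule.mem_span_singleton.1 hfx
      refine ⟨b, ?_⟩
      rintro ⟨y, hy⟩
      obtain ⟨r, rfl⟩ := Submodule.mem_span_singleton.1 hy
      have : (⟨r • x, hy⟩ : Submodule.span B {x}) = r • x' := rfl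
      rw [this, map_smul, ← hb]
      simp only [smul_eq_mul, x', SetLike.mk_smul_mk]
      ring
    | sup I J _ _ hI hJ =>
      intro f
      obtain ⟨b, hb⟩ := hI (f ∘ₗ Submodule.inclusion le_sup_left)
      obtain ⟨c, hc⟩ := hJ (f ∘ₗ Submodule.inclusion le_sup_right)
      obtain ⟨u, v, huv, hu, hv⟩ := hann I J (b - c) (by
        intro x hx
        have h1 := hb ⟨x, hx.1⟩
        have h2 := hc ⟨x, hx.2⟩
        rw [sub_mul, sub_eq_zero]
        exact h1.symm.trans h2)
      refine ⟨b - u, ?_⟩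
      rintro ⟨z, hz⟩
      obtain ⟨x, hx, y, hy, rfl⟩ := Submodule.mem_sup.1 hz
      have h1 : f ⟨x, Submodule.mem_sup_left hx⟩ = b * x := hb ⟨x, hx⟩
      have h2 : f ⟨y, Submodule.mem_sup_right hy⟩ = c * y := hc ⟨y, hy⟩
      have h3 : (⟨x + y, hz⟩ : (I ⊔ J : Ideal B)) =
        ⟨x, Submodule.mem_sup_left hx⟩ + ⟨y, Submodule.mem_sup_right hy⟩ := rfl
      rw [h3, map_add, h1, h2]
      have h4 : b - u = c + v := by linear_combination huv
      have h5 := hu x hx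
      have h6 := hv y hy
      change b * x + c * y = (b - u) * (x + y)
      rw [mul_add]
      nth_rewrite 2 [h4]
      linear_combination h5 - h6
  intro I g
  obtain ⟨b, hb⟩ := key I g
  exact ⟨LinearMap.mulLeft B b, fun x hx => (hb ⟨x, hx⟩).symm⟩

/-- If every ideal containing `t` is an annihilator modulo `t`, then `A / t` is self-injective. -/
lemma quotInjective_of_exists_annihilator [IsNoetherianRing A] {t : A}
    (H : ∀ (I : Ideal A) (x : A), t ∈ I → x ∉ I → ∃ b : A, (∀ y ∈ I, t ∣ b * y) ∧ ¬ t ∣ b * x) :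
    QuotInjective A t A := by
  intro N _ _ hN htN X f
  let B := A ⧸ Ideal.span {t}
  have hB : Module.Baer B B := by
    refine baer_of_exists_annihilator fun I x hx => ?_
    obtain ⟨x, rfl⟩ := Ideal.Quotient.mk_surjective x
    obtain ⟨b, hb, hbx⟩ := H (I.comap (Ideal.Quotient.mk _)) x (by
      rw [Ideal.mem_comap, Ideal.Quotient.eq_zero_iff_mem.2 (Ideal.mem_span_singleton_self t)]
      exact I.zero_mem) hx
    refine ⟨Ideal.Quotient.mk _ b, fun y hy => ?_, ?_⟩
    · obtain ⟨y, rfl⟩ := Ideal.Quotient.mk_surjective y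
      rw [← map_mul, Ideal.Quotient.eq_zero_iff_dvd]
      exact hb y hy
    · rwa [← map_mul, Ne, Ideal.Quotient.eq_zero_iff_dvd]
  have hNt : Module.IsTorsionBySet A N (Ideal.span {t} : Ideal A) :=
    (Module.isTorsionBySet_span_singleton_iff t).2 fun x => htN x
  have hXt : Module.IsTorsionBySet A X (Ideal.span {t} : Ideal A) :=
    (Module.isTorsionBySet_span_singleton_iff t).2 fun x => Subtype.ext (htN x)
  let _ : Module B N := hNt.module
  let _ : Module B X := hXt.module
  have : IsScalarTower A B N := hNt.isScalarTower
  have : IsScalarTower A B X := hXt.isScalarTower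
  have hsurj : Function.Surjective (algebraMap A B) := Ideal.Quotient.mk_surjective
  let e : QuotSMulTop t A ≃ₗ[A] B := Submodule.quotEquivOfEq _ _ (by
    rw [← Submodule.ideal_span_singleton_smul]
    simp)
  obtain ⟨g, hg⟩ := hB.extension_property (LinearMap.extendScalarsOfSurjective hsurj X.subtype)
    X.injective_subtype (LinearMap.extendScalarsOfSurjective hsurj (e.toLinearMap ∘ₗ f))
  refine ⟨e.symm.toLinearMap ∘ₗ g.restrictScalars A, fun x => ?_⟩
  have h1 : g x = e (f x) := LinearMap.congr_fun hg x
  simp [h1]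

end Lift

/-! ### Parameters of one-dimensional rings -/

lemma exists_smul_eq_zero_of_isSMulRegular {A : Type u} [CommRing A] (p : Ideal A) [p.IsPrime]
    {M : Type u} [AddCommGroup M] [Module A M] {a : A} {s : p.primeCompl}
    (h : IsSMulRegular (LocalizedModule p.primeCompl M)
      (IsLocalization.mk' (Localization.AtPrime p) a s)) {x : M} (hx : a • x = 0) :
    ∃ c : p.primeCompl, c • x = 0 := by
  refine (IsLocalizedModule.eq_zero_iff p.primeCompl (LocalizedModule.mkLinearMap _ M)).1 (h ?_)
  have h1 : a • LocalizedModule.mkLinearMap p.primeCompl M x = 0 := by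
    rw [← map_smul, hx, map_zero]
  have h2 : IsLocalization.mk' (Localization.AtPrime p) a s =
      IsLocalization.mk' (Localization.AtPrime p) 1 s * algebraMap A _ a := by
    rw [mul_comm, IsLocalization.mul_mk'_eq_mk'_of_mul, mul_one]
  change _ • _ = _ • _
  rw [h2, mul_smul, algebraMap_smul, h1, smul_zero, smul_zero]

/-- A regular element `t` of the Jacobson radical of a one-dimensional ring `A` such that the primes
containing `t` are the maximal ideals, and all other primes are minimal. -/
structure IsParameter (A : Type u) [CommRing A] (t : A) : Prop where
  mem_nonZeroDivisors : t ∈ A⁰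
  isMaximal_of_mem : ∀ p : Ideal A, p.IsPrime → t ∈ p → p.IsMaximal
  mem_minimalPrimes_of_notMem : ∀ p : Ideal A, p.IsPrime → t ∉ p → p ∈ minimalPrimes A
  mem_jacobson : t ∈ (⊥ : Ideal A).jacobson

namespace IsParameter

variable {A : Type u} [CommRing A] {t : A}

lemma isSMulRegular (ht : IsParameter A t) : IsSMulRegular A t :=
  fun _ _ h => (mul_cancel_left_mem_nonZeroDivisors ht.mem_nonZeroDivisors).1 h

lemma mem_of_isMaximal (ht : IsParameter A t) (p : Ideal A) [hp : p.IsMaximal] : t ∈ p :=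
  (Ideal.mem_sInf.1 ht.mem_jacobson) ⟨bot_le, hp⟩

lemma eq_maximalIdeal [IsLocalRing A] (ht : IsParameter A t) (p : Ideal A) (hp : p.IsPrime)
    (h : t ∈ p) : p = IsLocalRing.maximalIdeal A :=
  IsLocalRing.eq_maximalIdeal (ht.isMaximal_of_mem p hp h)

lemma ringKrullDim_localization_of_mem [IsNoetherianRing A] (ht : IsParameter A t) (p : Ideal A)
    [hp : p.IsPrime] (h : t ∈ p) : ringKrullDim (Localization.AtPrime p) = 1 := by
  rw [IsLocalization.AtPrime.ringKrullDim_eq_height p (Localization.AtPrime p)]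
  norm_cast
  have hle : Ideal.span {t} ≤ p := (Ideal.span_singleton_le_iff_mem p).2 h
  refine le_antisymm ?_ ((Ideal.one_le_height_span_singleton_of_mem_nonZeroDivisors
    ht.mem_nonZeroDivisors).trans (Ideal.height_mono hle))
  refine Ideal.height_le_one_of_isPrincipal_of_mem_minimalPrimes (Ideal.span {t}) p
    ⟨⟨hp, hle⟩, fun q hq hqp => ?_⟩
  have := ht.isMaximal_of_mem q hq.1 (hq.2 (Ideal.mem_span_singleton_self t))
  exact (this.eq_of_le hp.ne_top hqp).ge

lemma ringKrullDim_localization_of_notMem (ht : IsParameter A t) (p : Ideal A)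
    [hp : p.IsPrime] (h : t ∉ p) : ringKrullDim (Localization.AtPrime p) = 0 := by
  rw [IsLocalization.AtPrime.ringKrullDim_eq_height p (Localization.AtPrime p),
    Ideal.height_eq_zero_iff.2 (ht.mem_minimalPrimes_of_notMem p hp h)]
  rfl

/-- Over a one-dimensional Cohen-Macaulay ring, the maximal Cohen-Macaulay modules are the finitely
generated modules on which a parameter is regular. -/
lemma isMCM_iff [IsNoetherianRing A] (ht : IsParameter A t) (M : Type u) [AddCommGroup M]
    [Module A M] : IsMCM A M ↔ Module.Finite A M ∧ IsSMulRegular M t := by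
  refine and_congr_right fun hfin => ⟨fun H => ?_, fun H p hp => ?_⟩
  · rw [isSMulRegular_iff_right_eq_zero_of_smul]
    intro x hx
    by_contra hx0
    have : Nontrivial (Submodule.span A {x}) :=
      Submodule.nontrivial_span_singleton hx0
    obtain ⟨p, hp⟩ := associatedPrimes.nonempty A (Submodule.span A {x})
    obtain ⟨hprime, ⟨y, hy⟩, hpy⟩ := isAssociatedPrime_iff.1 (AssociatedPrimes.mem_iff.1 hp)
    have hmem : ∀ r : A, r ∈ p ↔ r • y = 0 := fun r => by
      rw [hpy, Submodule.mem_colon_singleton, Submodule.mem_bot, ← Submodule.coe_eq_zero]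
      rfl
    -- `x` is killed by `t`, so an associated prime `p` of `A x` contains `t`; it contradicts the
    -- existence of a regular element on `M_p`.
    have htp : t ∈ p := by
      rw [hmem]
      obtain ⟨r, rfl⟩ := Submodule.mem_span_singleton.1 hy
      rw [smul_comm, hx, smul_zero]
    obtain ⟨rs, hrs, hlen, hreg⟩ := H p
    rw [ht.ringKrullDim_localization_of_mem p htp] at hlen
    obtain ⟨r, rfl⟩ := List.length_eq_one_iff.1 (by exact_mod_cast hlen)
    have hr := hrs r (by simp)
    have hr' : IsSMulRegular (LocalizedModule p.primeCompl M) r :=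
      ((RingTheory.Sequence.isWeaklyRegular_cons_iff _ _ _).1 hreg).1
    obtain ⟨a, s, rfl⟩ := IsLocalization.exists_mk'_eq p.primeCompl r
    rw [IsLocalization.AtPrime.mk'_mem_maximal_iff _ p] at hr
    obtain ⟨c, hc⟩ := exists_smul_eq_zero_of_isSMulRegular p hr' ((hmem a).1 hr)
    exact c.2 ((hmem c).2 hc)
  · by_cases htp : t ∈ p
    · refine ⟨[algebraMap A _ t], ?_, ?_, ?_⟩
      · intro r hr
        rw [List.mem_singleton] at hr
        subst hr
        exact (IsLocalization.AtPrime.to_map_mem_maximal_iff (Localization.AtPrime p) p t).2 htp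
      · rw [ht.ringKrullDim_localization_of_mem p htp]
        rfl
      · rw [RingTheory.Sequence.isWeaklyRegular_cons_iff]
        refine ⟨?_, RingTheory.Sequence.IsWeaklyRegular.nil _ _⟩
        have := H.of_isLocalizedModule (Localization.AtPrime p) p.primeCompl
          (LocalizedModule.mkLinearMap p.primeCompl M)
        exact this
    · refine ⟨[], by simp, ?_, RingTheory.Sequence.IsWeaklyRegular.nil _ _⟩
      rw [ht.ringKrullDim_localization_of_notMem p htp]
      rfl

/-- A regular nonunit of a one-dimensional local ring is a parameter. -/
lemma of_isLocalRing [IsLocalRing A] (hdim : ringKrullDim A = 1) (ht : t ∈ A⁰)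
    (htm : t ∈ IsLocalRing.maximalIdeal A) : IsParameter A t := by
  have h1 : Ring.KrullDimLE 1 A := (Order.krullDimLE_iff 1 _).2 hdim.le
  rw [Ring.krullDimLE_one_iff] at h1
  refine ⟨ht, fun p hp h => (h1 p hp).resolve_left fun hmin => ?_, fun p hp h =>
    (h1 p hp).resolve_right fun hmax => ?_, ?_⟩
  · exact notMem_nonZeroDivisors_of_mem_mem_minimalPrimes h hmin ht
  · exact h (IsLocalRing.eq_maximalIdeal hmax ▸ htm)
  · rwa [IsLocalRing.jacobson_eq_maximalIdeal _ bot_ne_top]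

/-- A parameter stays a parameter in an integral extension in which it is regular. -/
lemma of_isIntegral {B : Type u} [CommRing B] [Algebra A B] [Algebra.IsIntegral A B]
    (ht : IsParameter A t) (h : algebraMap A B t ∈ B⁰) : IsParameter B (algebraMap A B t) := by
  refine ⟨h, fun p hp htp => ?_, fun p hp htp => ⟨⟨hp, bot_le⟩, fun q hq hqp => ?_⟩, ?_⟩
  · have := ht.isMaximal_of_mem (p.comap (algebraMap A B)) inferInstance htp
    exact Ideal.isMaximal_of_isIntegral_of_isMaximal_comap p this
  · by_contra hpq
    have hq1 : q.IsPrime := hq.1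
    have hlt := Ideal.IsIntegral.comap_lt_comap (R := A) (lt_of_le_not_ge hqp hpq)
    have hmin := ht.mem_minimalPrimes_of_notMem (p.comap (algebraMap A B)) inferInstance htp
    exact hlt.not_ge (hmin.2 ⟨inferInstance, bot_le⟩ hlt.le)
  · refine Ideal.mem_sInf.2 fun {p} hp => ?_
    have hp' : p.IsMaximal := hp.2
    have := Ideal.isMaximal_comap_of_isIntegral_of_isMaximal (R := A) p
    exact ht.mem_of_isMaximal (p.comap (algebraMap A B))

end IsParameter

/-- A one-dimensional Cohen-Macaulay local ring has a parameter. -/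
lemma exists_isParameter {R : Type u} [CommRing R] [IsLocalRing R] (hCM : IsCohenMacaulay R)
    (hdim : ringKrullDim R = 1) : ∃ t : R, IsParameter R t := by
  obtain ⟨rs, hrs, hlen, hreg⟩ := hCM.2.2 (IsLocalRing.maximalIdeal R)
  have hp := IsLocalization.AtPrime.ringKrullDim_eq_height (IsLocalRing.maximalIdeal R)
    (Localization.AtPrime (IsLocalRing.maximalIdeal R))
  rw [IsLocalRing.maximalIdeal_height_eq_ringKrullDim, hdim] at hp
  rw [hp] at hlen
  obtain ⟨r, rfl⟩ := List.length_eq_one_iff.1 (by exact_mod_cast hlen)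
  have hr := hrs r (by simp)
  have hr' := ((RingTheory.Sequence.isWeaklyRegular_cons_iff _ _ _).1 hreg).1
  obtain ⟨a, s, rfl⟩ := IsLocalization.exists_mk'_eq (IsLocalRing.maximalIdeal R).primeCompl r
  rw [IsLocalization.AtPrime.mk'_mem_maximal_iff _ (IsLocalRing.maximalIdeal R)] at hr
  refine ⟨a, IsParameter.of_isLocalRing hdim ?_ hr⟩
  rw [mem_nonZeroDivisors_iff_right]
  intro x hx
  obtain ⟨c, hc⟩ := exists_smul_eq_zero_of_isSMulRegular _ hr' (show a • x = 0 by
    rw [smul_eq_mul, mul_comm, hx])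
  have hu : IsUnit (c : R) := by
    by_contra hcon
    exact c.2 ((IsLocalRing.mem_maximalIdeal _).2 hcon)
  exact hu.smul_eq_zero.1 hc

/-! ### Lattices in the total ring of fractions and duality -/

section Lattice

variable {R : Type u} [CommRing R] {Q : Type u} [CommRing Q] [Algebra R Q]

/-- A lattice in the total ring of fractions `Q` of `R`: a finitely generated `R`-submodule that
contains a unit of `Q`. -/
structure IsLattice (X : Submodule R Q) : Prop where
  fg : X.FG
  exists_isUnit : ∃ u ∈ X, IsUnit u

lemma div_div_eq (W X Y : Submodule R Q) : W / X / Y = W / (X * Y) := by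
  refine le_antisymm ?_ ?_
  · rw [Submodule.le_div_iff_mul_le, mul_comm X Y, ← mul_assoc, ← Submodule.le_div_iff_mul_le,
      ← Submodule.le_div_iff_mul_le]
  · rw [Submodule.le_div_iff_mul_le, Submodule.le_div_iff_mul_le, mul_assoc, mul_comm Y X,
      ← Submodule.le_div_iff_mul_le]

lemma div_one_eq (W : Submodule R Q) : W / 1 = W := by
  refine le_antisymm ?_ ?_
  · intro x hx
    simpa using Submodule.mem_div_iff_forall_mul_mem.1 hx 1 (Submodule.mem_one.2 ⟨1, map_one _⟩)
  · rw [Submodule.le_div_iff_mul_le, mul_one]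

lemma le_div_div (W X : Submodule R Q) : X ≤ W / (W / X) := by
  rw [Submodule.le_div_iff_mul_le, mul_comm, ← Submodule.le_div_iff_mul_le]

lemma div_mul_le (W X : Submodule R Q) : W / X * X ≤ W := Submodule.le_div_iff_mul_le.1 le_rfl

lemma div_le_div_left {X Y : Submodule R Q} (W : Submodule R Q) (h : X ≤ Y) : W / Y ≤ W / X := by
  rw [Submodule.le_div_iff_mul_le]
  exact (mul_le_mul_right h _).trans (div_mul_le W Y)

lemma div_le_div_right {W W' : Submodule R Q} (h : W ≤ W') (X : Submodule R Q) :
    W / X ≤ W' / X := by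
  rw [Submodule.le_div_iff_mul_le]
  exact (div_mul_le W X).trans h

lemma IsLattice.mul {X Y : Submodule R Q} (hX : IsLattice X) (hY : IsLattice Y) :
    IsLattice (X * Y) := by
  obtain ⟨u, hu, hu'⟩ := hX.exists_isUnit
  obtain ⟨v, hv, hv'⟩ := hY.exists_isUnit
  exact ⟨hX.fg.mul hY.fg, u * v, Submodule.mul_mem_mul hu hv, hu'.mul hv'⟩

lemma isLattice_one : IsLattice (1 : Submodule R Q) :=
  ⟨by rw [Submodule.one_eq_span]; exact Submodule.fg_span_singleton _, 1,
    Submodule.mem_one.2 ⟨1, map_one _⟩, isUnit_one⟩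

lemma IsLattice.of_le [IsNoetherianRing R] {X Y : Submodule R Q} (hY : IsLattice Y) (h : X ≤ Y)
    {u : Q} (hu : u ∈ X) (hu' : IsUnit u) : IsLattice X := by
  have : Module.Finite R Y := Module.Finite.iff_fg.2 hY.fg
  refine ⟨?_, u, hu, hu'⟩
  have hfg : (X.comap Y.subtype).FG := IsNoetherian.noetherian _
  have := hfg.map Y.subtype
  rwa [Submodule.map_comap_subtype, inf_eq_right.2 h] at this

lemma isLattice_span_singleton {u : Q} (hu : IsUnit u) : IsLattice (Submodule.span R {u}) :=
  ⟨Submodule.fg_span_singleton u, u, Submodule.mem_span_singleton_self u, hu⟩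

/-- `W` is dualizing if `W : (W : X) = X` for all lattices `X`. -/
def IsDualizing (W : Submodule R Q) : Prop := ∀ X : Submodule R Q, IsLattice X → W / (W / X) = X

lemma IsDualizing.div_self {W : Submodule R Q} (hW : IsDualizing W) : W / W = 1 := by
  have := hW 1 isLattice_one
  rwa [div_one_eq] at this

lemma mul_le_ideal_smul (I : Ideal R) (X : Submodule R Q) :
    IsLocalization.coeSubmodule Q I * X ≤ I • X := by
  rw [Submodule.mul_le]
  rintro _ ⟨r, hr, rfl⟩ x hx
  change algebraMap R Q r * x ∈ _
  rw [← Algebra.smul_def]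
  exact Submodule.smul_mem_smul hr hx

variable [IsFractionRing R Q]

lemma isUnit_algebraMap {c : R} (hc : c ∈ R⁰) : IsUnit (algebraMap R Q c) :=
  IsLocalization.map_units Q (⟨c, hc⟩ : R⁰)

/-- Finitely many fractions have a common denominator. -/
lemma exists_smul_le_one {X : Submodule R Q} (hX : X.FG) :
    ∃ c ∈ R⁰, ∀ x ∈ X, c • x ∈ (1 : Submodule R Q) := by
  obtain ⟨s, rfl⟩ := hX
  obtain ⟨b, hb⟩ := IsLocalization.exist_integer_multiples_of_finset R⁰ s
  refine ⟨b, b.2, fun x hx => ?_⟩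
  induction hx using Submodule.span_induction with
  | mem x hx =>
    obtain ⟨y, hy⟩ := hb x hx
    exact Submodule.mem_one.2 ⟨y, hy⟩
  | zero => simp
  | add x y _ _ hx hy => rw [smul_add]; exact add_mem hx hy
  | smul a x _ hx => rw [smul_comm]; exact Submodule.smul_mem _ a hx

lemma exists_smul_mem_one (x : Q) : ∃ c ∈ R⁰, c • x ∈ (1 : Submodule R Q) := by
  obtain ⟨c, hc, h⟩ := exists_smul_le_one (Submodule.fg_span_singleton (R := R) x)
  exact ⟨c, hc, h x (Submodule.mem_span_singleton_self x)⟩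

lemma IsLattice.exists_smul_mem {X : Submodule R Q} (hX : IsLattice X) (q : Q) :
    ∃ c ∈ R⁰, c • q ∈ X := by
  obtain ⟨u, hu, hu'⟩ := hX.exists_isUnit
  obtain ⟨v, hv⟩ := hu'.exists_right_inv
  obtain ⟨c, hc, h⟩ := exists_smul_mem_one (R := R) (q * v)
  obtain ⟨r, hr⟩ := Submodule.mem_one.1 h
  refine ⟨c, hc, ?_⟩
  have : c • q = r • u := by
    rw [Algebra.smul_def] at h ⊢
    rw [Algebra.smul_def r, hr, Algebra.smul_def]
    linear_combination -(algebraMap R Q c * q) * hv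
  rw [this]
  exact Submodule.smul_mem _ _ hu

lemma IsLattice.div [IsNoetherianRing R] {X Y : Submodule R Q} (hX : IsLattice X)
    (hY : IsLattice Y) : IsLattice (X / Y) := by
  obtain ⟨u, hu, hu'⟩ := hY.exists_isUnit
  obtain ⟨v, hv⟩ := hu'.exists_right_inv
  obtain ⟨w, hw, hw'⟩ := hX.exists_isUnit
  obtain ⟨c, hc, hcY⟩ := exists_smul_le_one hY.fg
  have hvu : IsUnit v := IsUnit.of_mul_eq_one u (by rw [mul_comm, hv])
  refine (hX.mul (isLattice_span_singleton hvu)).of_le (u := c • w) ?_ ?_ ?_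
  · intro x hx
    have h1 := Submodule.mem_div_iff_forall_mul_mem.1 hx u hu
    rw [Submodule.mem_mul_span_singleton]
    exact ⟨x * u, h1, by linear_combination x * hv⟩
  · rw [Submodule.mem_div_iff_forall_mul_mem]
    intro y hy
    obtain ⟨r, hr⟩ := Submodule.mem_one.1 (hcY y hy)
    have : c • w * y = r • w := by
      rw [Algebra.smul_def r, hr]
      simp only [Algebra.smul_def]
      ring
    rw [this]
    exact Submodule.smul_mem _ _ hw
  · rw [Algebra.smul_def]
    exact (isUnit_algebraMap hc).mul hw'

/-- Homomorphisms from a lattice to a submodule of `Q` are multiplications. -/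
lemma IsLattice.exists_mul_eq {X : Submodule R Q} (hX : IsLattice X) (g : X →ₗ[R] Q) :
    ∃ y : Q, ∀ x : X, g x = y * x := by
  obtain ⟨u, hu, hu'⟩ := hX.exists_isUnit
  obtain ⟨v, hv⟩ := hu'.exists_right_inv
  refine ⟨g ⟨u, hu⟩ * v, fun x => ?_⟩
  obtain ⟨c, hc, h⟩ := exists_smul_mem_one (R := R) ((x : Q) * v)
  obtain ⟨r, hr⟩ := Submodule.mem_one.1 h
  have h1 : c • x = r • (⟨u, hu⟩ : X) := by
    ext
    change c • (x : Q) = r • u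
    rw [Algebra.smul_def r, hr]
    simp only [Algebra.smul_def]
    linear_combination -(algebraMap R Q c * x) * hv
  have h2 := congrArg g h1
  rw [map_smul, map_smul, Algebra.smul_def, Algebra.smul_def, hr, Algebra.smul_def] at h2
  apply (isUnit_algebraMap (Q := Q) hc).mul_left_cancel
  rw [h2]
  ring

lemma isSMulRegular_submodule {c : R} (hc : c ∈ R⁰) (X : Submodule R Q) : IsSMulRegular X c := by
  intro x y h
  have h1 : c • (x : Q) = c • (y : Q) := congrArg Subtype.val h
  rw [Algebra.smul_def, Algebra.smul_def] at h1
  exact Subtype.ext ((isUnit_algebraMap hc).mul_left_cancel h1)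

lemma IsParameter.exists_dvd_pow {t : R} (ht : IsParameter R t) {c : R} (hc : c ∈ R⁰) :
    ∃ n, c ∣ t ^ n := by
  have : t ∈ (Ideal.span {c}).radical := by
    rw [Ideal.radical_eq_sInf, Ideal.mem_sInf]
    rintro p ⟨hp, hprime⟩
    by_contra htp
    have h1 := ht.mem_minimalPrimes_of_notMem p hprime htp
    exact notMem_nonZeroDivisors_of_mem_mem_minimalPrimes
      (hp (Ideal.mem_span_singleton_self c)) h1 hc
  obtain ⟨n, hn⟩ := this
  exact ⟨n, Ideal.mem_span_singleton.1 hn⟩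

/-- Every element of `Q` is a fraction with a power of the parameter as denominator. -/
lemma IsParameter.exists_pow_smul_mem {t : R} (ht : IsParameter R t) {X : Submodule R Q}
    (hX : IsLattice X) (q : Q) : ∃ n, t ^ n • q ∈ X := by
  obtain ⟨c, hc, h⟩ := hX.exists_smul_mem q
  obtain ⟨n, d, hd⟩ := ht.exists_dvd_pow hc
  refine ⟨n, ?_⟩
  rw [hd, mul_comm, mul_smul]
  exact Submodule.smul_mem _ _ h

lemma isParameter_mul [IsLocalRing R] {t c : R} (ht : IsParameter R t) (hc : c ∈ R⁰) :
    IsParameter R (t * c) := by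
  refine ⟨mul_mem ht.mem_nonZeroDivisors hc, fun p hp h => ?_, fun p hp h =>
    ht.mem_minimalPrimes_of_notMem p hp fun h' => h (Ideal.mul_mem_right _ _ h'),
    Ideal.mul_mem_right _ _ ht.mem_jacobson⟩
  by_cases htp : t ∈ p
  · exact ht.isMaximal_of_mem p hp htp
  · exact absurd hc (notMem_nonZeroDivisors_of_mem_mem_minimalPrimes
      ((hp.mem_or_mem h).resolve_left htp) (ht.mem_minimalPrimes_of_notMem p hp htp))

/-- Herzog-Kunz duality: a fractional ideal of finite injective dimension is dualizing. An element
`q ∉ X` with `d q ∈ X` gives `d q ∉ d X`, which is detected by a homomorphism `X → W` modulo `d`. -/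
lemma isDualizing_of_hasFiniteInjDim [IsLocalRing R] [IsNoetherianRing R] {t : R}
    (ht : IsParameter R t) {W : Submodule R Q} (hW : IsLattice W) (hinj : HasFiniteInjDim R W) :
    IsDualizing W := by
  intro X hX
  refine le_antisymm (fun q hq => ?_) (le_div_div W X)
  by_contra hqX
  obtain ⟨c, hc, hcq⟩ := hX.exists_smul_mem q
  have hd := isParameter_mul ht hc
  have hdq : (t * c) • q ∈ X := by
    rw [mul_smul]
    exact Submodule.smul_mem _ _ hcq
  have hdm : t * c ∈ IsLocalRing.maximalIdeal R := hd.mem_of_isMaximal _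
  have hWd : IsSMulRegular W (t * c) := isSMulRegular_submodule hd.mem_nonZeroDivisors W
  have : Module.Finite R X := Module.Finite.iff_fg.2 hX.fg
  have : Module.Finite R W := Module.Finite.iff_fg.2 hW.fg
  obtain ⟨w, hw, hw'⟩ := hW.exists_isUnit
  have hQ : Nontrivial Q := (IsFractionRing.injective R Q).nontrivial
  have : Nontrivial W := ⟨⟨w, hw⟩, 0, fun h => hw'.ne_zero (congrArg Subtype.val h)⟩
  obtain ⟨g, hg⟩ := (quotInjective_of_hasFiniteInjDim hd.isSMulRegular hdm hd.eq_maximalIdeal W hinj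
    hWd).exists_hom_notMem hdm hd.eq_maximalIdeal hWd
    (isSMulRegular_submodule hd.mem_nonZeroDivisors X)
    (x := (⟨(t * c) • q, hdq⟩ : X)) (by
      rintro y hy
      have h1 : (t * c) • (y : Q) = (t * c) • q := congrArg Subtype.val hy
      rw [Algebra.smul_def, Algebra.smul_def] at h1
      exact hqX ((isUnit_algebraMap hd.mem_nonZeroDivisors).mul_left_cancel h1 ▸ y.2))
  obtain ⟨y, hy⟩ := hX.exists_mul_eq (W.subtype ∘ₗ g)
  have hyX : y ∈ W / X := by
    rw [Submodule.mem_div_iff_forall_mul_mem]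
    intro x hx
    rw [← hy ⟨x, hx⟩]
    exact (g ⟨x, hx⟩).2
  refine hg ⟨q * y, Submodule.mem_div_iff_forall_mul_mem.1 hq y hyX⟩ (Subtype.ext ?_)
  have h2 := hy ⟨(t * c) • q, hdq⟩
  refine Eq.trans ?_ h2.symm
  change (t * c) • (q * y) = y * ((t * c) • q)
  simp only [Algebra.smul_def]
  ring

/-- The dualizing fractional ideals of a local ring are unique up to multiplication by a unit
of `Q`. -/
lemma IsDualizing.exists_eq_span_mul [IsLocalRing R] [IsNoetherianRing R] {K I : Submodule R Q}
    (hK : IsDualizing K) (hI : IsDualizing I) (hKl : IsLattice K) (hIl : IsLattice I) :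
    ∃ v : Q, IsUnit v ∧ I = Submodule.span R {v} * K := by
  have key : ∀ {K I : Submodule R Q}, IsDualizing K → IsDualizing I → IsLattice K → IsLattice I →
      K / I * I = K := by
    intro K I hK hI hKl hIl
    have h1 : K / (K / I * I) = 1 := by
      rw [mul_comm, ← div_div_eq, div_div_eq, mul_comm, ← div_div_eq, hK I hIl, hI.div_self]
    have h2 := hK _ ((hKl.div hIl).mul hIl)
    rw [h1, div_one_eq] at h2
    exact h2.symm
  have h1 := key hK hI hKl hIl
  have h2 := key hI hK hIl hKl
  have h3 : K / I * (I / K) * K = K := by rw [mul_assoc, h2, h1]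
  have hle : K / I * (I / K) ≤ 1 := by
    rw [← hK.div_self, Submodule.le_div_iff_mul_le, h3]
  -- By Nakayama's lemma some product from `(K : I) (I : K)` is a unit of `R`.
  obtain ⟨l, hl, l', hl', hu⟩ : ∃ l ∈ K / I, ∃ l' ∈ I / K,
      l * l' ∉ IsLocalization.coeSubmodule Q (IsLocalRing.maximalIdeal R) := by
    by_contra! hcon
    have h4 : K / I * (I / K) ≤ IsLocalization.coeSubmodule Q (IsLocalRing.maximalIdeal R) :=
      Submodule.mul_le.2 hcon
    have h5 : K ≤ IsLocalRing.maximalIdeal R • K :=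
      h3.ge.trans ((mul_le_mul_left h4 _).trans (mul_le_ideal_smul _ _))
    have h6 := Submodule.eq_bot_of_le_smul_of_le_jacobson_bot _ _ hKl.fg h5
      (IsLocalRing.maximalIdeal_le_jacobson _)
    obtain ⟨w, hw, hw'⟩ := hKl.exists_isUnit
    have hQ : Nontrivial Q := (IsFractionRing.injective R Q).nontrivial
    rw [h6] at hw
    exact hw'.ne_zero ((Submodule.mem_bot R).1 hw)
  obtain ⟨r, hr⟩ := Submodule.mem_one.1 (hle (Submodule.mul_mem_mul hl hl'))
  have hru : IsUnit r := by
    by_contra hcon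
    exact hu ⟨r, (IsLocalRing.mem_maximalIdeal r).2 hcon, hr⟩
  obtain ⟨s, hs⟩ := hru.exists_right_inv
  have hs' : algebraMap R Q s * (l * l') = 1 := by
    rw [← hr, ← map_mul, mul_comm, hs, map_one]
  refine ⟨l', IsUnit.of_mul_eq_one (algebraMap R Q s * l) (by rw [← hs']; ring),
    le_antisymm (fun x hx => ?_) ?_⟩
  · rw [Submodule.mem_span_singleton_mul]
    refine ⟨s • (l * x),
      Submodule.smul_mem _ _ (Submodule.mem_div_iff_forall_mul_mem.1 hl x hx), ?_⟩
    rw [Algebra.smul_def]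
    linear_combination x * hs'
  · rw [Submodule.mul_le]
    intro a ha b hb
    obtain ⟨r, rfl⟩ := Submodule.mem_span_singleton.1 ha
    rw [smul_mul_assoc]
    exact Submodule.smul_mem _ _ (Submodule.mem_div_iff_forall_mul_mem.1 hl' b hb)

/-- A nonzero ideal of finite injective dimension is faithful, hence contains a regular element. -/
lemma exists_mem_nonZeroDivisors_of_hasFiniteInjDim [IsLocalRing R] [IsNoetherianRing R] {t : R}
    (ht : IsParameter R t) {I : Ideal R} (hI : I ≠ ⊥) (hinj : HasFiniteInjDim R I) :
    ∃ c ∈ I, c ∈ R⁰ := by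
  -- By Krull's intersection theorem `x ∉ t ^ (n + 1) R` for some `n`, so that a homomorphism
  -- `R → I` does not vanish at `x`.
  have hfaith : ∀ x : R, x ≠ 0 → ∃ b ∈ I, b * x ≠ 0 := by
    intro x hx
    obtain ⟨n, hn⟩ : ∃ n, x ∉ IsLocalRing.maximalIdeal R ^ n := by
      by_contra! hcon
      have h1 : x ∈ (⨅ n, IsLocalRing.maximalIdeal R ^ n) := (Submodule.mem_iInf _).2 hcon
      rw [Ideal.iInf_pow_eq_bot_of_isLocalRing _ (Ideal.IsPrime.ne_top')] at h1
      exact hx h1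
    have hc := isParameter_mul ht (pow_mem ht.mem_nonZeroDivisors n)
    rw [← pow_succ'] at hc
    have hcm : t ^ (n + 1) ∈ IsLocalRing.maximalIdeal R := hc.mem_of_isMaximal _
    have hreg : IsSMulRegular I (t ^ (n + 1)) := hc.isSMulRegular.submodule I
    have : Nontrivial I := Submodule.nontrivial_iff_ne_bot.2 hI
    obtain ⟨g, hg⟩ := (quotInjective_of_hasFiniteInjDim hc.isSMulRegular hcm hc.eq_maximalIdeal I
      hinj hreg).exists_hom_notMem hcm hc.eq_maximalIdeal hreg (N := R) hc.isSMulRegular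
      (x := x) (by
        rintro y rfl
        refine hn (Ideal.mul_mem_right _ _ (Ideal.pow_le_pow_right (Nat.le_succ n) ?_))
        exact Ideal.pow_mem_pow (ht.mem_of_isMaximal _) _)
    refine ⟨g 1, (g 1).2, fun h0 => hg 0 ?_⟩
    have h1 : g x = x • g 1 := by rw [← map_smul, smul_eq_mul, mul_one]
    rw [h1, smul_zero]
    exact Subtype.ext (by rw [mul_comm] at h0; exact h0.symm)
  by_contra! hcon
  have hsub : (I : Set R) ⊆ ⋃ p ∈ associatedPrimes R R, (p : Set R) := by
    rw [biUnion_associatedPrimes_eq_compl_nonZeroDivisors]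
    exact hcon
  obtain ⟨p, hp, hIp⟩ := (I.subset_union_prime_finite (associatedPrimes.finite R R) (f := id) 0 0
    fun _ h _ _ => h.isPrime).1 hsub
  obtain ⟨hprime, x, hx⟩ := isAssociatedPrime_iff.1 (AssociatedPrimes.mem_iff.1 hp)
  have hx0 : x ≠ 0 := by
    rintro rfl
    apply hprime.ne_top
    rw [hx]
    ext r
    simp [Submodule.mem_colon_singleton]
  obtain ⟨b, hb, hbx⟩ := hfaith x hx0
  have h1 : b ∈ p := hIp hb
  rw [hx, Submodule.mem_colon_singleton] at h1
  exact hbx h1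

end Lattice

/-! ### Colon lattices and overrings -/

section Colon

variable {R : Type u} [CommRing R] {Q : Type u} [CommRing Q] [Algebra R Q]

lemma one_le_div_self (X : Submodule R Q) : 1 ≤ X / X := by
  rw [Submodule.le_div_iff_mul_le, one_mul]

lemma div_self_mul (X : Submodule R Q) : X / X * X = X :=
  le_antisymm (div_mul_le X X) (by
    conv_lhs => rw [← one_mul X]
    exact mul_le_mul_left (one_le_div_self X) X)

lemma div_self_mul_div_self (X : Submodule R Q) : X / X * (X / X) = X / X := by
  refine le_antisymm ?_ ?_
  · rw [Submodule.le_div_iff_mul_le, mul_assoc, div_self_mul, div_self_mul]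
  · conv_lhs => rw [← one_mul (X / X)]
    exact mul_le_mul_left (one_le_div_self X) _

lemma mul_div_of_mul_eq {e X : Submodule R Q} (h1 : 1 ≤ e) (hX : e * X = X) (W : Submodule R Q) :
    e * (W / X) = W / X := by
  refine le_antisymm ?_ ?_
  · rw [Submodule.le_div_iff_mul_le, mul_right_comm, mul_comm (e * X), hX]
    exact div_mul_le W X
  · conv_lhs => rw [← one_mul (W / X)]
    exact mul_le_mul_left h1 _

lemma div_eq_self_of_mul_eq {e X : Submodule R Q} (h1 : 1 ≤ e) (hX : e * X = X) : X / e = X := by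
  refine le_antisymm ?_ ?_
  · exact (div_le_div_left X h1).trans (div_one_eq X).le
  · rw [Submodule.le_div_iff_mul_le, mul_comm, hX]

/-- If `K` is dualizing, then `K : e` is dualizing among the lattices over the overring `e`. -/
lemma IsDualizing.div_div_of_mul_eq {K e X : Submodule R Q} (hK : IsDualizing K)
    (h1 : 1 ≤ e) (hX : IsLattice X) (heX : e * X = X) : K / e / (K / e / X) = X := by
  rw [div_div_eq K e X, heX, div_div_eq, mul_div_of_mul_eq h1 heX, hK X hX]

/-- If `m K D = m` and the powers of `K` stabilize, then iteration gives `m = m K ^ n D ^ n` with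
`K ^ n` absorbing `K`, so that `m D = m` and `m K = m`. -/
lemma mul_eq_of_mul_mul_eq {m K D : Submodule R Q} {n : ℕ} (hK : K ^ (n + 1) = K ^ n)
    (h : m * K * D = m) : m * K = m := by
  have hpow : ∀ j, m * K ^ j * D ^ j = m := by
    intro j
    induction j with
    | zero => simp
    | succ j ih =>
      calc m * K ^ (j + 1) * D ^ (j + 1) = (m * K * D) * K ^ j * D ^ j := by ring
        _ = m := by rw [h, ih]
  have h2 : m * D = m := by
    calc m * D = m * K ^ n * D ^ n * D := by rw [hpow]
      _ = m * K ^ (n + 1) * D ^ (n + 1) := by rw [hK]; ring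
      _ = m := hpow _
  calc m * K = (m * D) * K := by rw [h2]
    _ = m * K * D := by ring
    _ = m := h

variable [IsFractionRing R Q] [IsLocalRing R] [IsNoetherianRing R]

lemma isLattice_maximalIdeal {t : R} (ht : IsParameter R t) :
    IsLattice (IsLocalization.coeSubmodule Q (IsLocalRing.maximalIdeal R)) :=
  ⟨Submodule.FG.map _ (IsNoetherian.noetherian (IsLocalRing.maximalIdeal R)), algebraMap R Q t,
    ⟨t, ht.mem_of_isMaximal _, rfl⟩, isUnit_algebraMap ht.mem_nonZeroDivisors⟩

/-- Unless the maximal ideal is principal, `R : 𝔪 = 𝔪 : 𝔪`. -/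
lemma one_div_maximalIdeal {t : R} (ht : IsParameter R t)
    (hDVR : ¬ ∃ _ : IsDomain R, IsDiscreteValuationRing R) :
    (1 : Submodule R Q) / IsLocalization.coeSubmodule Q (IsLocalRing.maximalIdeal R) =
      IsLocalization.coeSubmodule Q (IsLocalRing.maximalIdeal R) /
        IsLocalization.coeSubmodule Q (IsLocalRing.maximalIdeal R) := by
  set m := IsLocalRing.maximalIdeal R
  refine le_antisymm ?_ (div_le_div_right ?_ _)
  · intro x hx
    rw [Submodule.mem_div_iff_forall_mul_mem] at hx ⊢
    intro y hy
    obtain ⟨r, hr⟩ := Submodule.mem_one.1 (hx y hy)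
    refine ⟨r, ?_, hr⟩
    by_contra hrm
    apply hDVR
    have hru : IsUnit r := by
      by_contra hcon
      exact hrm ((IsLocalRing.mem_maximalIdeal r).2 hcon)
    obtain ⟨s, hs⟩ := hru.exists_right_inv
    obtain ⟨y, hym, rfl⟩ := hy
    have hs' : algebraMap R Q s * (x * algebraMap R Q y) = 1 := by
      change algebraMap R Q r = x * algebraMap R Q y at hr
      rw [← hr, ← map_mul, mul_comm, hs, map_one]
    -- `𝔪` is generated by `y`, a regular element.
    have hspan : ∀ z ∈ m, y ∣ z := by
      intro z hz
      obtain ⟨a, ha⟩ := Submodule.mem_one.1 (hx _ ⟨z, hz, rfl⟩)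
      refine ⟨s * a, IsFractionRing.injective R Q ?_⟩
      change algebraMap R Q a = x * algebraMap R Q z at ha
      rw [map_mul, map_mul, ha]
      linear_combination -(algebraMap R Q z) * hs'
    have hyreg : y ∈ R⁰ := by
      obtain ⟨b, hb⟩ := hspan t (ht.mem_of_isMaximal _)
      exact (mul_mem_nonZeroDivisors.1 (hb ▸ ht.mem_nonZeroDivisors)).1
    have hform : ∀ z : R, z ≠ 0 → ∃ n : ℕ, ∃ v : R, IsUnit v ∧ z = y ^ n * v := by
      intro z hz
      by_contra! hcon
      have hdvd : ∀ n : ℕ, y ^ n ∣ z := by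
        intro n
        induction n with
        | zero => simp
        | succ n ih =>
          obtain ⟨v, hv⟩ := ih
          have hvm : v ∈ m := by
            rw [IsLocalRing.mem_maximalIdeal]
            intro hvu
            exact hcon n v hvu hv
          obtain ⟨w, rfl⟩ := hspan v hvm
          exact ⟨w, by rw [hv]; ring⟩
      have hz' : z ∈ (⨅ n, m ^ n) := by
        refine (Submodule.mem_iInf _).2 fun n => ?_
        obtain ⟨w, hw⟩ := hdvd n
        rw [hw]
        exact Ideal.mul_mem_right _ _ (Ideal.pow_mem_pow hym n)
      rw [Ideal.iInf_pow_eq_bot_of_isLocalRing _ (Ideal.IsPrime.ne_top')] at hz'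
      exact hz hz'
    have hdom : IsDomain R := by
      have : NoZeroDivisors R := by
        refine ⟨fun {a b} hab => ?_⟩
        by_contra! hcon
        obtain ⟨n, v, hv, rfl⟩ := hform a hcon.1
        have hreg : y ^ n * v ∈ R⁰ := mul_mem (pow_mem hyreg n) hv.mem_nonZeroDivisors
        exact hcon.2 ((mul_left_mem_nonZeroDivisors_eq_zero_iff hreg).1 hab)
      exact NoZeroDivisors.to_isDomain R
    refine ⟨hdom, ?_⟩
    have hy0 : y ≠ 0 := nonZeroDivisors.ne_zero hyreg
    have hirr : Irreducible y := by
      refine ⟨(IsLocalRing.mem_maximalIdeal y).1 hym, fun a b hab => ?_⟩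
      by_contra! hcon
      obtain ⟨c, rfl⟩ := hspan a ((IsLocalRing.mem_maximalIdeal a).2 hcon.1)
      refine hcon.2 (IsUnit.of_mul_eq_one c ?_)
      apply mul_left_cancel₀ hy0
      rw [mul_one]
      nth_rewrite 2 [hab]
      ring
    refine IsDiscreteValuationRing.ofHasUnitMulPowIrreducibleFactorization
      ⟨y, hirr, fun {z} hz => ?_⟩
    obtain ⟨n, v, hv, rfl⟩ := hform z hz
    exact ⟨n, hv.unit, rfl⟩
  · rintro _ ⟨r, -, rfl⟩
    exact Submodule.mem_one.2 ⟨r, rfl⟩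

/-- As `R` has depth one, `R : 𝔪` is strictly larger than `R`. -/
lemma not_one_div_maximalIdeal_le {t : R} (ht : IsParameter R t) :
    ¬ (1 : Submodule R Q) / IsLocalization.coeSubmodule Q (IsLocalRing.maximalIdeal R) ≤ 1 := by
  intro hle
  have hnt : Nontrivial (QuotSMulTop t R) := by
    refine Submodule.Quotient.nontrivial_iff.2 fun h => ?_
    have h1 : (1 : R) ∈ t • (⊤ : Submodule R R) := by rw [h]; exact Submodule.mem_top
    obtain ⟨y, hy⟩ := mem_smul_top_iff.1 h1
    exact (IsLocalRing.mem_maximalIdeal t).1 (ht.mem_of_isMaximal _)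
      (IsUnit.of_mul_eq_one y (by simpa using hy))
  obtain ⟨x, hx0, hx⟩ := exists_socle_element ht.eq_maximalIdeal (QuotSMulTop t R)
    (smul_quotSMulTop_eq_zero t R)
  obtain ⟨x, rfl⟩ := Submodule.mkQ_surjective _ x
  obtain ⟨s, hs⟩ := (isUnit_algebraMap (Q := Q) ht.mem_nonZeroDivisors).exists_right_inv
  have hmem : algebraMap R Q x * s ∈
      (1 : Submodule R Q) / IsLocalization.coeSubmodule Q (IsLocalRing.maximalIdeal R) := by
    rw [Submodule.mem_div_iff_forall_mul_mem]
    rintro _ ⟨r, hr, rfl⟩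
    have h1 := (hx r).2 hr
    rw [← map_smul] at h1
    obtain ⟨y, hy⟩ := mem_smul_top_iff.1 ((Submodule.Quotient.mk_eq_zero _).1 h1)
    refine Submodule.mem_one.2 ⟨y, ?_⟩
    have h2 := congrArg (algebraMap R Q) hy
    rw [smul_eq_mul, smul_eq_mul, map_mul, map_mul] at h2
    change _ = algebraMap R Q x * s * algebraMap R Q r
    linear_combination s * h2 - (algebraMap R Q y) * hs
  obtain ⟨y, hy⟩ := Submodule.mem_one.1 (hle hmem)
  refine hx0 ((Submodule.Quotient.mk_eq_zero _).2 (mem_smul_top_iff.2 ⟨y, ?_⟩))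
  apply IsFractionRing.injective R Q
  rw [smul_eq_mul, map_mul, hy]
  linear_combination algebraMap R Q x * hs

end Colon

section Overring

variable {R : Type u} [CommRing R] {Q : Type u} [CommRing Q] [Algebra R Q]

lemma isNoetherianRing_of_isLattice [IsNoetherianRing R] (E : Subalgebra R Q)
    (hE : IsLattice (Subalgebra.toSubmodule E)) : IsNoetherianRing E :=
  have : Module.Finite R E := Module.Finite.iff_fg.2 hE.fg
  IsNoetherianRing.of_finite R E

lemma algebraMap_mem_nonZeroDivisors [IsFractionRing R Q] (E : Subalgebra R Q) {c : R}
    (hc : c ∈ R⁰) :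
    algebraMap R E c ∈ E⁰ := by
  rw [mem_nonZeroDivisors_iff_right]
  intro x hx
  apply Subtype.val_injective
  have h1 : (x : Q) * algebraMap R Q c = 0 := congrArg Subtype.val hx
  exact ((isUnit_algebraMap hc).mul_left_eq_zero).1 h1

lemma IsParameter.subalgebra [IsFractionRing R Q] {t : R} (ht : IsParameter R t)
    (E : Subalgebra R Q)
    (hE : IsLattice (Subalgebra.toSubmodule E)) : IsParameter E (algebraMap R E t) :=
  have : Module.Finite R E := Module.Finite.iff_fg.2 hE.fg
  ht.of_isIntegral (algebraMap_mem_nonZeroDivisors E ht.mem_nonZeroDivisors)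

/-- An `R`-submodule of `Q` that is stable under an overring `E`, as an `E`-submodule. -/
def extendScalars (E : Subalgebra R Q) (X : Submodule R Q)
    (hX : Subalgebra.toSubmodule E * X = X) : Submodule E Q where
  carrier := X
  add_mem' := X.add_mem
  zero_mem' := X.zero_mem
  smul_mem' e x hx := by
    have := Submodule.mul_mem_mul (show (e : Q) ∈ Subalgebra.toSubmodule E from e.2) hx
    rw [hX] at this
    exact this

lemma fg_extendScalars (E : Subalgebra R Q) {X : Submodule R Q}
    (hX : Subalgebra.toSubmodule E * X = X) (hfg : X.FG) : (extendScalars E X hX).FG := by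
  obtain ⟨s, hs⟩ := hfg
  refine ⟨s, le_antisymm ?_ ?_⟩
  · rw [Submodule.span_le]
    intro x hx
    have : x ∈ X := hs ▸ Submodule.subset_span hx
    exact this
  · intro x hx
    have hx' : x ∈ Submodule.span R (s : Set Q) := by rw [hs]; exact hx
    exact Submodule.span_le_restrictScalars R E (s : Set Q) hx'

/-- Nakayama's lemma for a lattice over an overring: a proper ideal `J` of `E` satisfies
`W J ≠ W`. -/
lemma one_mem_of_le_mul (E : Subalgebra R Q) {J W : Submodule R Q}
    (hJ : J ≤ Subalgebra.toSubmodule E) (hEJ : Subalgebra.toSubmodule E * J = J)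
    (hW : IsLattice W) (hEW : Subalgebra.toSubmodule E * W = W) (h : W ≤ W * J) : (1 : Q) ∈ J := by
  let J' : Ideal E := (extendScalars E J hEJ).comap (Algebra.linearMap E Q)
  have hle : extendScalars E W hEW ≤ J' • extendScalars E W hEW := by
    intro x hx
    have hx' : x ∈ W * J := h hx
    induction hx' using Submodule.mul_induction_on' with
    | mem_mul_mem w hw j hj =>
      have : w * j = (⟨j, hJ hj⟩ : E) • w := by
        rw [Algebra.smul_def, mul_comm]
        rfl
      rw [this]
      exact Submodule.smul_mem_smul (show (⟨j, hJ hj⟩ : E) ∈ J' from hj) hw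
    | add x hx' y hy' ihx ihy =>
      have hmem : ∀ z ∈ W * J, z ∈ W := by
        intro z hz
        have h2 : W * J ≤ W := by
          conv_rhs => rw [← hEW, mul_comm]
          exact mul_le_mul_right hJ W
        exact h2 hz
      exact add_mem (ihx (hmem x ‹_›)) (ihy (hmem y ‹_›))
  obtain ⟨r, hr, hr0⟩ := Submodule.exists_sub_one_mem_and_smul_eq_zero_of_fg_of_le_smul J' _
    (fg_extendScalars E hEW hW.fg) hle
  obtain ⟨u, hu, hu'⟩ := hW.exists_isUnit
  have h1 : (r : Q) * u = 0 := hr0 u hu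
  have h2 : (r : Q) = 0 := (hu'.mul_left_eq_zero).1 h1
  have h3 : ((r - 1 : E) : Q) ∈ J := hr
  have h4 : ((r - 1 : E) : Q) = -1 := by
    rw [AddSubgroupClass.coe_sub, h2]
    simp
  rw [h4] at h3
  simpa using J.neg_mem h3

/-- If the overring `E` has a canonical lattice `w` and `M` is an ideal of `E` with endomorphism
ring `E` that is reflexive over `E`, then `M` is invertible: `J = M (E : M)` has `E : J = E`, so
that `w J = w` by duality, and `J = E` by Nakayama's lemma. -/
lemma mul_div_eq_of_reflexive [IsFractionRing R Q] [IsNoetherianRing R] (E : Subalgebra R Q)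
    {w M : Submodule R Q} (hw : IsLattice w) (hEw : Subalgebra.toSubmodule E * w = w)
    (hww : w / w = Subalgebra.toSubmodule E) (hM : IsLattice M)
    (hdual : ∀ X, IsLattice X → Subalgebra.toSubmodule E * X = X → w / (w / X) = X)
    (hMM : M / M = Subalgebra.toSubmodule E) (hE : IsLattice (Subalgebra.toSubmodule E))
    (hrefl : Subalgebra.toSubmodule E / (Subalgebra.toSubmodule E / M) = M) :
    M * (Subalgebra.toSubmodule E / M) = Subalgebra.toSubmodule E := by
  set e := Subalgebra.toSubmodule E with he
  have h1 : (1 : Submodule R Q) ≤ e := hMM ▸ one_le_div_self M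
  have heM : e * M = M := by rw [← hMM, div_self_mul]
  set J := M * (e / M) with hJ
  have hJl : IsLattice J := hM.mul (hE.div hM)
  have heJ : e * J = J := by rw [hJ, ← mul_assoc, heM]
  have hJe : J ≤ e := by rw [hJ, mul_comm]; exact div_mul_le e M
  have heJ' : e / J = e := by rw [hJ, mul_comm, ← div_div_eq, hrefl, hMM]
  have hwJ : w * J = w := by
    have h2 : w / (w * J) = e := by rw [← div_div_eq, hww, heJ']
    have h3 := hdual (w * J) (hw.mul hJl) (by rw [← mul_assoc, hEw])
    rw [h2, div_eq_self_of_mul_eq h1 hEw] at h3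
    exact h3.symm
  have h1J := one_mem_of_le_mul E hJe heJ hw hEw hwJ.ge
  refine le_antisymm hJe fun x hx => ?_
  rw [← heJ]
  simpa using Submodule.mul_mem_mul hx h1J

/-- An invertible module over a finite overring of a one-dimensional local ring is principal. -/
lemma exists_eq_span_mul_of_mul_eq [IsFractionRing R Q] [IsLocalRing R] [IsNoetherianRing R] {t : R}
    (ht : IsParameter R t) (E : Subalgebra R Q) (hE : IsLattice (Subalgebra.toSubmodule E))
    {M L : Submodule R Q} (hM : IsLattice M) (hL : IsLattice L)
    (hEM : Subalgebra.toSubmodule E * M = M) (hEL : Subalgebra.toSubmodule E * L = L)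
    (hML : M * L = Subalgebra.toSubmodule E) :
    ∃ a ∈ M, M = Submodule.span R {a} * Subalgebra.toSubmodule E := by
  have : IsNoetherianRing E := isNoetherianRing_of_isLattice E hE
  have hinj : Function.Injective (algebraMap E Q) := Subtype.val_injective
  have htE := ht.subalgebra E hE
  -- The maximal ideals of `E` are the minimal primes of `t E`.
  have hfin : {I : Ideal E | I.IsMaximal}.Finite := by
    refine (Ideal.finite_minimalPrimes_of_isNoetherianRing E
      (Ideal.span {algebraMap R E t})).subset fun I hI => ?_
    have hI' : I.IsMaximal := hI
    refine ⟨⟨hI'.isPrime, (Ideal.span_singleton_le_iff_mem I).2 (htE.mem_of_isMaximal I)⟩,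
      fun J hJ hJI => ?_⟩
    exact ((htE.isMaximal_of_mem J hJ.1
      (hJ.2 (Ideal.mem_span_singleton_self _))).eq_of_le hI'.ne_top hJI).ge
  let S : Submonoid E := Algebra.algebraMapSubmonoid E R⁰
  have hloc : IsLocalization S Q := by
    refine ⟨?_, ?_, ?_⟩
    · rintro ⟨_, c, hc, rfl⟩
      exact isUnit_algebraMap (R := R) (Q := Q) hc
    · intro q
      obtain ⟨c, hc, h⟩ := exists_smul_mem_one (R := R) q
      obtain ⟨r, hr⟩ := Submodule.mem_one.1 h
      refine ⟨⟨algebraMap R E r, ⟨algebraMap R E c, c, hc, rfl⟩⟩, ?_⟩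
      rw [Algebra.smul_def] at hr
      exact (mul_comm _ _).trans hr.symm
    · intro x y hxy
      exact ⟨1, by rw [hinj hxy]⟩
  have hfrac : ∀ X : Submodule R Q, (hX : Subalgebra.toSubmodule E * X = X) → IsLattice X →
      IsFractional S (extendScalars E X hX) := by
    intro X hX hXl
    obtain ⟨c, hc, h⟩ := exists_smul_le_one hXl.fg
    refine ⟨algebraMap R E c, ⟨c, hc, rfl⟩, fun x hx => ?_⟩
    obtain ⟨r, hr⟩ := Submodule.mem_one.1 (h x hx)
    refine ⟨algebraMap R E r, ?_⟩
    rw [algebraMap_smul, ← hr]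
    rfl
  let M' : FractionalIdeal S Q := ⟨extendScalars E M hEM, hfrac M hEM hM⟩
  let L' : FractionalIdeal S Q := ⟨extendScalars E L hEL, hfrac L hEL hL⟩
  have hmul : M' * L' = 1 := by
    rw [FractionalIdeal.ext_iff]
    intro x
    rw [FractionalIdeal.mem_one_iff]
    constructor
    · intro hx
      have hx' : x ∈ (extendScalars E M hEM) * (extendScalars E L hEL) := by
        rw [← FractionalIdeal.mem_coe, FractionalIdeal.coe_mul] at hx
        exact hx
      have : x ∈ Subalgebra.toSubmodule E := by
        induction hx' using Submodule.mul_induction_on' with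
        | mem_mul_mem a ha b hb => rw [← hML]; exact Submodule.mul_mem_mul ha hb
        | add a ha b hb iha ihb =>
          refine add_mem (iha ?_) (ihb ?_)
          · rw [← FractionalIdeal.mem_coe, FractionalIdeal.coe_mul]; exact ha
          · rw [← FractionalIdeal.mem_coe, FractionalIdeal.coe_mul]; exact hb
      exact ⟨⟨x, this⟩, rfl⟩
    · rintro ⟨y, rfl⟩
      obtain ⟨y, hy⟩ := y
      replace hy : y ∈ M * L := by rw [hML]; exact hy
      rw [← FractionalIdeal.mem_coe, FractionalIdeal.coe_mul]
      change y ∈ (extendScalars E M hEM) * (extendScalars E L hEL)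
      induction hy using Submodule.mul_induction_on' with
      | mem_mul_mem a ha b hb => exact Submodule.mul_mem_mul (M := extendScalars E M hEM) ha hb
      | add a ha b hb iha ihb => exact add_mem (iha (hML.le ha)) (ihb (hML.le hb))
  have hS : S ≤ E⁰ := by
    rintro _ ⟨c, hc, rfl⟩
    exact algebraMap_mem_nonZeroDivisors E hc
  obtain ⟨a, ha⟩ :=
    (FractionalIdeal.isPrincipal.of_finite_maximals_of_inv hS hfin M' L' hmul).principal
  have ha' : extendScalars E M hEM = Submodule.span E {a} := ha
  have haM : a ∈ M := by
    have : a ∈ extendScalars E M hEM := ha' ▸ Submodule.mem_span_singleton_self a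
    exact this
  refine ⟨a, haM, le_antisymm (fun x hx => ?_) ?_⟩
  · have hx' : x ∈ Submodule.span E {a} := ha' ▸ (show x ∈ extendScalars E M hEM from hx)
    obtain ⟨r, rfl⟩ := Submodule.mem_span_singleton.1 hx'
    rw [Submodule.mem_span_singleton_mul]
    exact ⟨r, r.2, mul_comm _ _⟩
  · conv_rhs => rw [← hEM, mul_comm]
    exact mul_le_mul_left ((Submodule.span_singleton_le_iff_mem a M).2 haM) _

end Overring

/-! ### Classes of modules as saturated submodules -/

section Classes

lemma restrictTo_iff {A : Type u} [CommRing A] (P : ObjectProperty (ModuleCat.{u} A)) (R : Type u)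
    [CommRing R] [Algebra R A] (M : ModuleCat.{u} R) :
    P.restrictTo R M ↔ ∃ X : ModuleCat.{u} A, P X ∧
      ∃ φ : X ≃+ M, ∀ (r : R) (x : X), φ (algebraMap R A r • x) = r • φ x := by
  constructor
  · rintro ⟨X, hX, ⟨i⟩⟩
    exact ⟨X, hX, i.toLinearEquiv.toAddEquiv, fun r x => i.toLinearEquiv.map_smul r x⟩
  · rintro ⟨X, hX, φ, hφ⟩
    let e : ((ModuleCat.restrictScalars.{u} (algebraMap R A)).obj X : ModuleCat.{u} R) ≃ₗ[R] M :=
      { φ with map_smul' := fun r x => hφ r x }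
    exact ⟨X, hX, ⟨e.toModuleIso⟩⟩

/-- Syzygies of maximal Cohen-Macaulay modules are the modules with an embedding into a free module
whose image is saturated with respect to a parameter. -/
lemma IsParameter.isSyzygyOfMCM_iff {A : Type u} [CommRing A] [IsNoetherianRing A] {t : A}
    (ht : IsParameter A t) (M : Type u) [AddCommGroup M] [Module A M] :
    IsSyzygyOfMCM A M ↔ ∃ (ι : Type) (_ : Finite ι) (f : M →ₗ[A] (ι → A)), Function.Injective f ∧
      ∀ z, t • z ∈ LinearMap.range f → z ∈ LinearMap.range f := by
  have hreg : ∀ (n : ℕ) (f : M →ₗ[A] (Fin n → A)), IsMCM A ((Fin n → A) ⧸ LinearMap.range f) ↔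
      ∀ z, t • z ∈ LinearMap.range f → z ∈ LinearMap.range f := by
    intro n f
    rw [ht.isMCM_iff,
      and_iff_right (inferInstance : Module.Finite A ((Fin n → A) ⧸ LinearMap.range f)),
      isSMulRegular_iff_right_eq_zero_of_smul]
    constructor
    · intro h z hz
      rw [← Submodule.Quotient.mk_eq_zero] at hz ⊢
      exact h _ hz
    · intro h z hz
      obtain ⟨z, rfl⟩ := Submodule.mkQ_surjective _ z
      exact (Submodule.Quotient.mk_eq_zero _).2 (h z ((Submodule.Quotient.mk_eq_zero _).1 hz))
  constructor
  · rintro ⟨n, f, hf, h⟩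
    exact ⟨Fin n, inferInstance, f, hf, (hreg n f).1 h⟩
  · rintro ⟨ι, _, f, hf, h⟩
    obtain ⟨n, ⟨e⟩⟩ := Finite.exists_equiv_fin ι
    let σ : (ι → A) ≃ₗ[A] (Fin n → A) := LinearEquiv.funCongrLeft A A e.symm
    refine ⟨n, σ.toLinearMap ∘ₗ f, σ.injective.comp hf, (hreg n _).2 ?_⟩
    rintro z ⟨x, hx⟩
    obtain ⟨y, hy⟩ := h (σ.symm z) ⟨x, by rw [← map_smul, ← hx]; simp⟩
    exact ⟨y, by simp [hy]⟩

variable {R : Type u} [CommRing R] {Q : Type u} [CommRing Q] [Algebra R Q]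

/-- `M` is isomorphic to a module over the overring `E` that embeds into a power of `W` with
torsion-free cokernel. The embedding is encoded by an `E`-submodule `N` of a power of `Q` with
coordinates in `W` that is saturated in the power of `W` with respect to `t`. -/
def IsSaturatedIn (E : Subalgebra R Q) (t : R) (W : Submodule R Q) (M : Type u) [AddCommGroup M]
    [Module R M] : Prop :=
  ∃ (ι : Type) (_ : Finite ι) (N : Submodule E (ι → Q)), (∀ z ∈ N, ∀ i, z i ∈ W) ∧
    (∀ z : ι → Q, (∀ i, z i ∈ W) → t • z ∈ N → z ∈ N) ∧ Nonempty (M ≃ₗ[R] N)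

lemma isSaturatedIn_self (E : Subalgebra R Q) (t : R) {W : Submodule R Q}
    (hEW : Subalgebra.toSubmodule E * W = W) : IsSaturatedIn E t W W := by
  refine ⟨Unit, inferInstance, (extendScalars E W hEW).comap (LinearMap.proj ()), fun z hz i => hz,
    fun z hz _ => hz (), ⟨LinearEquiv.ofBijective (M := W) (σ₁₂ := RingHom.id R)
      { toFun := fun x => ⟨fun _ => x, x.2⟩
        map_add' := fun _ _ => rfl
        map_smul' := fun _ _ => rfl } ⟨fun x y h => ?_, fun z => ⟨⟨z.1 (), z.2⟩, rfl⟩⟩⟩⟩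
  exact Subtype.ext (congrFun (congrArg Subtype.val h) ())

lemma IsSaturatedIn.span_mul {E : Subalgebra R Q} {t : R} {W : Submodule R Q} {M : Type u}
    [AddCommGroup M] [Module R M] (h : IsSaturatedIn E t W M) {a : Q} (ha : IsUnit a) :
    IsSaturatedIn E t (Submodule.span R {a} * W) M := by
  obtain ⟨ι, hι, N, hN, hsat, ⟨φ⟩⟩ := h
  obtain ⟨b, hb⟩ := ha.exists_right_inv
  let f : (ι → Q) →ₗ[E] (ι → Q) := LinearMap.lsmul Q (ι → Q) a |>.restrictScalars E
  have hf : Function.Injective f := by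
    intro x y hxy
    ext i
    exact ha.mul_left_cancel (congrFun hxy i)
  refine ⟨ι, hι, N.map f, ?_, ?_,
    ⟨φ.trans ((Submodule.equivMapOfInjective f hf N).restrictScalars R)⟩⟩
  · rintro _ ⟨z, hz, rfl⟩ i
    exact Submodule.mem_span_singleton_mul.2 ⟨z i, hN z hz i, rfl⟩
  · rintro z hz ⟨y, hy, hyz⟩
    have hz' : ∀ i, b * z i ∈ W := by
      intro i
      obtain ⟨w, hw, hwz⟩ := Submodule.mem_span_singleton_mul.1 (hz i)
      rw [← hwz, ← mul_assoc, mul_comm b, hb, one_mul]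
      exact hw
    refine ⟨fun i => b * z i, hsat _ hz' ?_, ?_⟩
    · have : (t • fun i => b * z i) = y := by
        ext i
        have h1 : a * y i = t • z i := congrFun hyz i
        change t • (b * z i) = y i
        rw [mul_comm b, ← smul_mul_assoc, ← h1]
        linear_combination y i * hb
      rw [this]
      exact hy
    · ext i
      change a * (b * z i) = z i
      rw [← mul_assoc, hb, one_mul]

lemma mem_of_pow_smul_mem {E : Subalgebra R Q} {t : R} {W : Submodule R Q} {ι : Type}
    {N : Submodule E (ι → Q)} (hsat : ∀ z : ι → Q, (∀ i, z i ∈ W) → t • z ∈ N → z ∈ N) (n : ℕ)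
    {z : ι → Q} (hz : ∀ i, z i ∈ W) (h : t ^ n • z ∈ N) : z ∈ N := by
  induction n with
  | zero => simpa using h
  | succ n ih =>
    refine ih (hsat _ (fun i => W.smul_mem _ (hz i)) ?_)
    rwa [← mul_smul, ← pow_succ']

variable [IsFractionRing R Q]

/-- A lattice that embeds into a power of `W` with torsion-free cokernel is `W`-reflexive. -/
lemma IsSaturatedIn.div_div_eq {E : Subalgebra R Q} {t : R} (ht : IsParameter R t)
    {W X : Submodule R Q} (hX : IsLattice X) (h : IsSaturatedIn E t W X) : W / (W / X) = X := by
  obtain ⟨ι, hι, N, hN, hsat, ⟨φ⟩⟩ := h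
  refine le_antisymm (fun q hq => ?_) (le_div_div W X)
  have hmul : ∀ i, ∃ y : Q, ∀ x : X, (φ x : ι → Q) i = y * x := fun i =>
    hX.exists_mul_eq ((LinearMap.proj i : (ι → Q) →ₗ[R] Q) ∘ₗ
      (N.subtype.restrictScalars R) ∘ₗ φ.toLinearMap)
  choose y hy using hmul
  have hyW : ∀ i, y i ∈ W / X := by
    intro i
    rw [Submodule.mem_div_iff_forall_mul_mem]
    intro x hx
    rw [← hy i ⟨x, hx⟩]
    exact hN _ (φ ⟨x, hx⟩).2 i
  obtain ⟨n, hn⟩ := ht.exists_pow_smul_mem hX q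
  have hz : (fun i => q * y i) ∈ N := by
    refine mem_of_pow_smul_mem hsat n
      (fun i => Submodule.mem_div_iff_forall_mul_mem.1 hq _ (hyW i)) ?_
    have : (t ^ n • fun i => q * y i) = (φ ⟨_, hn⟩ : ι → Q) := by
      ext i
      rw [hy i]
      simp only [Pi.smul_apply, Algebra.smul_def]
      ring
    rw [this]
    exact (φ ⟨_, hn⟩).2
  obtain ⟨x, hx⟩ := φ.surjective ⟨_, hz⟩
  have h0 : φ (⟨t ^ n • q, hn⟩ - t ^ n • x) = 0 := by
    rw [map_sub, map_smul, hx, sub_eq_zero]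
    ext i
    rw [hy i]
    change y i * (t ^ n • q) = t ^ n • (q * y i)
    simp only [Algebra.smul_def]
    ring
  have h1 := congrArg Subtype.val (sub_eq_zero.1 ((map_eq_zero_iff φ φ.injective).1 h0))
  have h2 : t ^ n • q = t ^ n • (x : Q) := h1
  rw [Algebra.smul_def, Algebra.smul_def] at h2
  rw [(isUnit_algebraMap (pow_mem ht.mem_nonZeroDivisors n)).mul_left_cancel h2]
  exact x.2

section

variable [IsNoetherianRing R]

/-- The syzygies of maximal Cohen-Macaulay `E`-modules are the modules saturated in powers
of `E`. -/
lemma restrictTo_catOmegaCM_iff {t : R} (ht : IsParameter R t) (E : Subalgebra R Q)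
    (hE : IsLattice (Subalgebra.toSubmodule E)) (M : ModuleCat.{u} R) :
    (catOmegaCM E).restrictTo R M ↔ IsSaturatedIn E t (Subalgebra.toSubmodule E) M := by
  have := isNoetherianRing_of_isLattice E hE
  have htE := ht.subalgebra E hE
  rw [restrictTo_iff]
  constructor
  · rintro ⟨X, hX, φ, hφ⟩
    obtain ⟨ι, hι, f, hf, hsat⟩ := (htE.isSyzygyOfMCM_iff X).1 hX
    let j : (ι → E) →ₗ[E] (ι → Q) := LinearMap.compLeft (Algebra.linearMap E Q) ι
    have hj : Function.Injective j := fun x y h => by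
      ext i
      exact congrFun h i
    let ψ := LinearEquiv.ofInjective (j ∘ₗ f) (hj.comp hf)
    refine ⟨ι, hι, LinearMap.range (j ∘ₗ f), ?_, ?_, ⟨?_⟩⟩
    · rintro _ ⟨x, rfl⟩ i
      exact (f x i).2
    · rintro z hz ⟨x, hx⟩
      obtain ⟨y, hy⟩ := hsat (fun i => ⟨z i, hz i⟩) ⟨x, by
        ext i
        have := congrFun hx i
        rw [Pi.smul_apply, Algebra.smul_def] at this
        exact this⟩
      exact ⟨y, by rw [LinearMap.comp_apply, hy]; rfl⟩
    · exact
        { φ.symm.trans ψ.toAddEquiv with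
          map_smul' := fun r x => by
            obtain ⟨x, rfl⟩ := φ.surjective x
            change ψ (φ.symm (r • φ x)) = r • ψ (φ.symm (φ x))
            rw [← hφ, φ.symm_apply_apply, φ.symm_apply_apply, map_smul, algebraMap_smul] }
  · rintro ⟨ι, hι, N, hN, hsat, ⟨φ⟩⟩
    refine ⟨ModuleCat.of E N, ?_, φ.symm.toAddEquiv, fun r x => ?_⟩
    · refine (htE.isSyzygyOfMCM_iff N).2 ⟨ι, hι,
        { toFun := fun z i => ⟨z.1 i, hN z.1 z.2 i⟩
          map_add' := fun _ _ => rfl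
          map_smul' := fun _ _ => rfl }, fun x y h => ?_, ?_⟩
      · ext i
        exact congrArg Subtype.val (congrFun h i)
      · rintro z ⟨x, hx⟩
        refine ⟨⟨fun i => z i, hsat _ (fun i => (z i).2) ?_⟩, rfl⟩
        have : (t • fun i => (z i : Q)) = x.1 := by
          ext i
          have := congrArg Subtype.val (congrFun hx i)
          rw [Pi.smul_apply, Algebra.smul_def]
          exact this.symm
        rw [this]
        exact x.2
    · change φ.symm (algebraMap R E r • x) = r • φ.symm x
      rw [algebraMap_smul, map_smul]

/-- Modules saturated in powers of a lattice are maximal Cohen-Macaulay over `E`. -/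
lemma IsSaturatedIn.restrictTo_catCM {t : R} (ht : IsParameter R t) {E : Subalgebra R Q}
    (hE : IsLattice (Subalgebra.toSubmodule E)) {W : Submodule R Q} (hW : IsLattice W)
    {M : ModuleCat.{u} R} (h : IsSaturatedIn E t W M) : (catCM E).restrictTo R M := by
  have := isNoetherianRing_of_isLattice E hE
  have htE := ht.subalgebra E hE
  obtain ⟨ι, hι, N, hN, hsat, ⟨φ⟩⟩ := h
  refine (restrictTo_iff _ _ _).2 ⟨ModuleCat.of E N, (htE.isMCM_iff N).2 ⟨?_, ?_⟩,
    φ.symm.toAddEquiv, fun r x => ?_⟩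
  · have : Module.Finite R W := Module.Finite.iff_fg.2 hW.fg
    let f : N →ₗ[R] (ι → W) :=
      { toFun := fun z i => ⟨z.1 i, hN z.1 z.2 i⟩
        map_add' := fun _ _ => rfl
        map_smul' := fun _ _ => rfl }
    have : Module.Finite R N := Module.Finite.of_injective f fun x y h => by
      ext i
      exact congrArg Subtype.val (congrFun h i)
    exact Module.Finite.of_restrictScalars_finite R E N
  · intro x y h
    ext i
    have h1 : algebraMap R Q t * x.1 i = algebraMap R Q t * y.1 i :=
      congrFun (congrArg Subtype.val h) i
    exact (isUnit_algebraMap ht.mem_nonZeroDivisors).mul_left_cancel h1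
  · change φ.symm (algebraMap R E r • x) = r • φ.symm x
    rw [algebraMap_smul, map_smul]

variable [IsLocalRing R]

/-- Over a one-dimensional ring with dualizing lattice `K`, every maximal Cohen-Macaulay
`E`-module embeds into a power of `K : E` with torsion-free cokernel: take generators of its
`K`-dual. -/
lemma isSaturatedIn_of_restrictTo_catCM {t : R} (ht : IsParameter R t) {E : Subalgebra R Q}
    (hE : IsLattice (Subalgebra.toSubmodule E)) {K : Submodule R Q} (hK : IsLattice K)
    (hinj : HasFiniteInjDim R K) {M : ModuleCat.{u} R} (h : (catCM E).restrictTo R M) :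
    IsSaturatedIn E t (K / Subalgebra.toSubmodule E) M := by
  have := isNoetherianRing_of_isLattice E hE
  have htE := ht.subalgebra E hE
  obtain ⟨X, hX, φ, hφ⟩ := (restrictTo_iff _ _ _).1 h
  obtain ⟨hXfin, hXreg⟩ := (htE.isMCM_iff X).1 hX
  let _ : Module R X := Module.compHom X (algebraMap R E)
  have : IsScalarTower R E X := ⟨fun r e x => by
    rw [Algebra.smul_def, mul_smul]
    rfl⟩
  have : Module.Finite R E := Module.Finite.iff_fg.2 hE.fg
  have : Module.Finite R X := Module.Finite.trans E X
  have : Module.Finite R K := Module.Finite.iff_fg.2 hK.fg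
  obtain ⟨w, hw, hw'⟩ := hK.exists_isUnit
  have hQ : Nontrivial Q := (IsFractionRing.injective R Q).nontrivial
  have : Nontrivial K := ⟨⟨w, hw⟩, 0, fun h => hw'.ne_zero (congrArg Subtype.val h)⟩
  have hXreg' : IsSMulRegular X t := hXreg
  -- Elements outside `t ^ (n + 1) X` are detected by `Hom(X, K)`.
  have hdet : ∀ n, ∀ x : X, (∀ y, t ^ (n + 1) • y ≠ x) →
      ∃ g : X →ₗ[R] K, ∀ y, t ^ (n + 1) • y ≠ g x := by
    intro n x hx
    have hc := isParameter_mul ht (pow_mem ht.mem_nonZeroDivisors n)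
    rw [← pow_succ'] at hc
    have hreg : IsSMulRegular K (t ^ (n + 1)) := isSMulRegular_submodule hc.mem_nonZeroDivisors K
    exact (quotInjective_of_hasFiniteInjDim hc.isSMulRegular (hc.mem_of_isMaximal _)
      hc.eq_maximalIdeal K hinj hreg).exists_hom_notMem (hc.mem_of_isMaximal _) hc.eq_maximalIdeal
      hreg (hXreg'.pow _) hx
  -- Since `X` is torsion-free, `R`-homomorphisms to `K ⊆ Q` are `E`-linear.
  have hElin : ∀ (g : X →ₗ[R] K) (e : E) (x : X), (g (e • x) : Q) = e * g x := by
    intro g e x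
    obtain ⟨c, hc, h⟩ := exists_smul_mem_one (R := R) (e : Q)
    obtain ⟨r, hr⟩ := Submodule.mem_one.1 h
    have h1 : c • e = algebraMap R E r := Subtype.ext hr.symm
    have h2 : c • (e • x) = r • x := by
      rw [← smul_assoc, h1, algebraMap_smul]
    have h3 := congrArg (fun y : X => (g y : Q)) h2
    simp only [map_smul, Submodule.coe_smul] at h3
    rw [Algebra.smul_def, Algebra.smul_def, hr, Algebra.smul_def, mul_assoc] at h3
    exact (isUnit_algebraMap hc).mul_left_cancel h3
  obtain ⟨n, s, hs⟩ := Module.Finite.exists_fin (R := R) (M := X →ₗ[R] K)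
  let f : X →ₗ[E] (Fin n → Q) :=
    { toFun := fun x i => (s i x : Q)
      map_add' := fun x y => by
        ext i
        simp
      map_smul' := fun e x => by
        ext i
        exact hElin (s i) e x }
  have hf : Function.Injective f := by
    rw [injective_iff_map_eq_zero]
    intro x hx
    have h0 : ∀ g : X →ₗ[R] K, g x = 0 := by
      intro g
      have hg : g ∈ Submodule.span R (Set.range s) := hs ▸ Submodule.mem_top
      induction hg using Submodule.span_induction with
      | mem g hg =>
        obtain ⟨i, rfl⟩ := hg
        exact Subtype.ext (congrFun hx i)
      | zero => rfl
      | add g h _ _ hg hh => rw [LinearMap.add_apply, hg, hh, add_zero]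
      | smul r g _ hg => rw [LinearMap.smul_apply, hg, smul_zero]
    by_contra hx0
    obtain ⟨n, hn⟩ : ∃ n, x ∉ (IsLocalRing.maximalIdeal R ^ n • ⊤ : Submodule R X) := by
      by_contra! hcon
      have h1 : x ∈ (⨅ n, IsLocalRing.maximalIdeal R ^ n • ⊤ : Submodule R X) :=
        (Submodule.mem_iInf _).2 hcon
      rw [Ideal.iInf_pow_smul_eq_bot_of_isLocalRing _ (Ideal.IsPrime.ne_top')] at h1
      exact hx0 h1
    obtain ⟨g, hg⟩ := hdet n x (by
      rintro y rfl
      refine hn (Submodule.smul_mem_smul ?_ Submodule.mem_top)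
      exact Ideal.pow_le_pow_right (Nat.le_succ n) (Ideal.pow_mem_pow (ht.mem_of_isMaximal _) _))
    exact hg 0 (by rw [h0 g, smul_zero])
  let ψ := LinearEquiv.ofInjective f hf
  refine ⟨Fin n, inferInstance, LinearMap.range f, ?_, ?_, ⟨?_⟩⟩
  · rintro _ ⟨x, rfl⟩ i
    rw [Submodule.mem_div_iff_forall_mul_mem]
    intro e he
    rw [mul_comm]
    have h1 : (s i ((⟨e, he⟩ : E) • x) : Q) = e * s i x := hElin (s i) ⟨e, he⟩ x
    change e * (s i x : Q) ∈ K
    rw [← h1]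
    exact (s i _).2
  · rintro z hz ⟨x, hx⟩
    have hzK : ∀ i, z i ∈ K := fun i => by
      have := Submodule.mem_div_iff_forall_mul_mem.1 (hz i) 1 E.one_mem
      rwa [mul_one] at this
    have h0 : ∀ g : X →ₗ[R] K, ∃ y, t • y = g x := by
      intro g
      have hg : g ∈ Submodule.span R (Set.range s) := hs ▸ Submodule.mem_top
      induction hg using Submodule.span_induction with
      | mem g hg =>
        obtain ⟨i, rfl⟩ := hg
        exact ⟨⟨z i, hzK i⟩, Subtype.ext (congrFun hx i).symm⟩
      | zero => exact ⟨0, smul_zero t⟩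
      | add g h _ _ hg hh =>
        obtain ⟨y, hy⟩ := hg
        obtain ⟨y', hy'⟩ := hh
        exact ⟨y + y', by rw [smul_add, hy, hy', LinearMap.add_apply]⟩
      | smul r g _ hg =>
        obtain ⟨y, hy⟩ := hg
        exact ⟨r • y, by rw [smul_comm, hy, LinearMap.smul_apply]⟩
    obtain ⟨y, rfl⟩ : ∃ y, t • y = x := by
      by_contra! hcon
      obtain ⟨g, hg⟩ := hdet 0 x (by simpa using hcon)
      obtain ⟨y, hy⟩ := h0 g
      exact hg y (by rw [zero_add, pow_one]; exact hy)
    refine ⟨y, ?_⟩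
    ext i
    have h1 : (f (t • y)) i = t • z i := congrFun hx i
    have h2 : (f (t • y)) i = t • f y i := by
      change (s i (t • y) : Q) = t • (s i y : Q)
      rw [map_smul]
      rfl
    rw [h2, Algebra.smul_def, Algebra.smul_def] at h1
    exact (isUnit_algebraMap ht.mem_nonZeroDivisors).mul_left_cancel h1
  · exact
      { φ.symm.trans ψ.toAddEquiv with
        map_smul' := fun r x => by
          obtain ⟨x, rfl⟩ := φ.surjective x
          change ψ (φ.symm (r • φ x)) = r • ψ (φ.symm (φ x))
          rw [← hφ, φ.symm_apply_apply, φ.symm_apply_apply, map_smul, algebraMap_smul] }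

/-- The syzygies without free summands of maximal Cohen-Macaulay `R`-modules are the modules
saturated in powers of `𝔪`. A module without free summands embeds into `𝔪 F ⊆ F`, and saturation
makes it stable under `E = 𝔪 : 𝔪`. Conversely `𝔪 ⊆ Q` embeds with torsion-free cokernel into a power
of `R` by a system of generators of `E = R : 𝔪`, and a free summand would give `E ⊆ R`. -/
lemma catOmegaCMP_iff {t : R} (ht : IsParameter R t) (E : Subalgebra R Q)
    (hE : IsLattice (Subalgebra.toSubmodule E))
    (hEm : Subalgebra.toSubmodule E * IsLocalization.coeSubmodule Q (IsLocalRing.maximalIdeal R) =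
      IsLocalization.coeSubmodule Q (IsLocalRing.maximalIdeal R))
    (hE1 : ¬ Subalgebra.toSubmodule E ≤ 1) (M : ModuleCat.{u} R) :
    catOmegaCMP R M ↔
      IsSaturatedIn E t (IsLocalization.coeSubmodule Q (IsLocalRing.maximalIdeal R)) M := by
  set m := IsLocalRing.maximalIdeal R
  have htE : ∀ e : E, ∃ r : R, algebraMap R E r = t • e := by
    intro e
    have h1 : (e : Q) * algebraMap R Q t ∈ IsLocalization.coeSubmodule Q m := by
      rw [← hEm]
      exact Submodule.mul_mem_mul e.2 ⟨t, ht.mem_of_isMaximal _, rfl⟩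
    obtain ⟨r, -, hr⟩ := h1
    refine ⟨r, Subtype.ext ?_⟩
    change algebraMap R Q r = t • (e : Q)
    rw [Algebra.smul_def, mul_comm]
    exact hr
  have hinj : Function.Injective (algebraMap R Q) := IsFractionRing.injective R Q
  constructor
  · rintro ⟨hsyz, hfree⟩
    obtain ⟨ι, hι, f, hf, hsat⟩ := (ht.isSyzygyOfMCM_iff M).1 hsyz
    -- A coordinate that takes a unit as value splits off a free summand.
    have hfm : ∀ x i, f x i ∈ m := by
      intro x i
      by_contra hcon
      have hu : IsUnit (f x i) := by
        by_contra hcon'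
        exact hcon ((IsLocalRing.mem_maximalIdeal _).2 hcon')
      obtain ⟨s, hs⟩ := hu.exists_right_inv
      let g : M →ₗ[R] R := LinearMap.proj i ∘ₗ f
      let j : R →ₗ[R] M := LinearMap.toSpanSingleton R M (s • x)
      have hgj : ∀ r, g (j r) = r := by
        intro r
        rw [LinearMap.toSpanSingleton_apply, map_smul, map_smul]
        change r * (s * f x i) = r
        rw [mul_comm s, hs, mul_one]
      have hj : Function.Injective j := fun a b h => by rw [← hgj a, h, hgj]
      have hcompl : IsCompl (LinearMap.range j) (LinearMap.ker g) := by
        refine IsCompl.of_eq ?_ ?_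
        · rw [Submodule.eq_bot_iff]
          rintro _ ⟨⟨r, rfl⟩, hr⟩
          have h1 : g (j r) = 0 := hr
          rw [hgj] at h1
          rw [h1, map_zero]
        · rw [Submodule.eq_top_iff']
          intro y
          refine Submodule.mem_sup.2 ⟨j (g y), ⟨_, rfl⟩, y - j (g y), ?_, by abel⟩
          rw [LinearMap.mem_ker, map_sub, hgj, sub_self]
      have hbot := hfree _ _ hcompl (Module.Free.of_equiv (LinearEquiv.ofInjective j hj))
      have h1 : j 1 = 0 := by
        have : j 1 ∈ LinearMap.range j := ⟨1, rfl⟩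
        rw [hbot] at this
        exact (Submodule.mem_bot R).1 this
      have h2 := hgj 1
      rw [h1, map_zero] at h2
      exact zero_ne_one h2
    let j : (ι → R) →ₗ[R] (ι → Q) := LinearMap.compLeft (Algebra.linearMap R Q) ι
    have hj : Function.Injective j := fun x y h => by
      ext i
      exact hinj (congrFun h i)
    have hsat' : ∀ z : ι → Q, (∀ i, z i ∈ IsLocalization.coeSubmodule Q m) →
        t • z ∈ LinearMap.range (j ∘ₗ f) → z ∈ LinearMap.range (j ∘ₗ f) := by
      rintro z hz ⟨x, hx⟩
      choose y hy hyz using hz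
      have hjy : j y = z := by
        ext i
        exact hyz i
      obtain ⟨x', hx'⟩ := hsat y ⟨x, hj (by
        rw [map_smul, hjy]
        exact hx)⟩
      exact ⟨x', by rw [LinearMap.comp_apply, hx', hjy]⟩
    let N : Submodule E (ι → Q) :=
      { LinearMap.range (j ∘ₗ f) with
        smul_mem' := by
          rintro e _ ⟨x, rfl⟩
          refine hsat' _ (fun i => ?_) ?_
          · rw [← hEm]
            exact Submodule.mul_mem_mul e.2 ⟨f x i, hfm x i, rfl⟩
          · obtain ⟨r, hr⟩ := htE e
            rw [← smul_assoc, ← hr, algebraMap_smul]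
            exact Submodule.smul_mem _ r ⟨x, rfl⟩ }
    refine ⟨ι, hι, N, ?_, hsat', ⟨?_⟩⟩
    · rintro _ ⟨x, rfl⟩ i
      exact ⟨f x i, hfm x i, rfl⟩
    · exact
        { LinearEquiv.ofInjective (j ∘ₗ f) (hj.comp hf) with
          toFun := fun x => ⟨(j ∘ₗ f) x, ⟨x, rfl⟩⟩
          invFun := fun y => (LinearEquiv.ofInjective (j ∘ₗ f) (hj.comp hf)).symm ⟨y.1, y.2⟩
          map_smul' := fun r x => Subtype.ext ((j ∘ₗ f).map_smul r x) }
  · rintro ⟨ι, hι, N, hN, hsat, ⟨φ⟩⟩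
    obtain ⟨v, hv⟩ := (isUnit_algebraMap (Q := Q) ht.mem_nonZeroDivisors).exists_right_inv
    refine ⟨(ht.isSyzygyOfMCM_iff M).2 ?_, ?_⟩
    · obtain ⟨k, s, hs⟩ := Submodule.fg_iff_exists_fin_generating_family.1 hE.fg
      have hcoord : ∀ (x : M) (p : ι × Fin k), ∃ r : R, algebraMap R Q r = s p.2 * (φ x).1 p.1 := by
        intro x p
        have h1 : s p.2 * (φ x).1 p.1 ∈ IsLocalization.coeSubmodule Q m := by
          rw [← hEm]
          exact Submodule.mul_mem_mul (hs ▸ Submodule.subset_span ⟨p.2, rfl⟩) (hN _ (φ x).2 p.1)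
        obtain ⟨r, -, hr⟩ := h1
        exact ⟨r, hr⟩
      choose c hc using hcoord
      let f : M →ₗ[R] (ι × Fin k → R) :=
        { toFun := c
          map_add' := fun x y => by
            ext p
            apply hinj
            rw [Pi.add_apply, map_add, hc, hc, hc, map_add, ← mul_add]
            rfl
          map_smul' := fun r x => by
            ext p
            apply hinj
            rw [RingHom.id_apply, Pi.smul_apply, smul_eq_mul, map_mul, hc, hc, map_smul]
            change s p.2 * (r • (φ x).1 p.1) = _
            rw [Algebra.smul_def]
            ring }
      have hspan : ∀ (q : Q), (∀ j, s j * q ∈ (1 : Submodule R Q)) →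
          ∀ e ∈ Subalgebra.toSubmodule E, e * q ∈ (1 : Submodule R Q) := by
        intro q hq e he
        rw [← hs] at he
        induction he using Submodule.span_induction with
        | mem e he =>
          obtain ⟨j, rfl⟩ := he
          exact hq j
        | zero => rw [zero_mul]; exact zero_mem _
        | add a b _ _ ha hb => rw [add_mul]; exact add_mem ha hb
        | smul r a _ ha => rw [smul_mul_assoc]; exact Submodule.smul_mem _ r ha
      refine ⟨ι × Fin k, inferInstance, f, ?_, ?_⟩
      · intro x y hxy
        apply φ.injective
        ext i
        have h1 : ∀ e ∈ Subalgebra.toSubmodule E, e * ((φ x).1 i - (φ y).1 i) = 0 := by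
          intro e he
          rw [← hs] at he
          induction he using Submodule.span_induction with
          | mem e he =>
            obtain ⟨j, rfl⟩ := he
            rw [mul_sub, ← hc x (i, j), ← hc y (i, j), sub_eq_zero]
            exact congrArg _ (congrFun hxy (i, j))
          | zero => rw [zero_mul]
          | add a b _ _ ha hb => rw [add_mul, ha, hb, add_zero]
          | smul r a _ ha => rw [smul_mul_assoc, ha, smul_zero]
        have h2 := h1 1 E.one_mem
        rw [one_mul, sub_eq_zero] at h2
        exact h2
      · rintro w ⟨x, hx⟩
        let y : ι → Q := fun i => v * (φ x).1 i
        have hsy : ∀ i j, s j * y i = algebraMap R Q (w (i, j)) := by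
          intro i j
          have h1 : algebraMap R Q (c x (i, j)) = algebraMap R Q (t * w (i, j)) :=
            congrArg _ (congrFun hx (i, j))
          rw [hc, map_mul] at h1
          change s j * (v * (φ x).1 i) = _
          linear_combination v * h1 + algebraMap R Q (w (i, j)) * hv
        -- `E y i ⊆ R`, so that `y i ∈ R` is not a unit, as `E` is not contained in `R`.
        have hym : ∀ i, y i ∈ IsLocalization.coeSubmodule Q m := by
          intro i
          have h1 := hspan (y i) fun j => Submodule.mem_one.2 ⟨_, (hsy i j).symm⟩
          have h2 := h1 1 E.one_mem
          rw [one_mul] at h2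
          obtain ⟨r, hr⟩ := Submodule.mem_one.1 h2
          refine ⟨r, ?_, hr⟩
          by_contra hcon
          have hu : IsUnit r := by
            by_contra hcon'
            exact hcon ((IsLocalRing.mem_maximalIdeal _).2 hcon')
          obtain ⟨r', hr'⟩ := hu.exists_right_inv
          refine hE1 fun e he => ?_
          have h3 : e = r' • (e * y i) := by
            rw [← hr, Algebra.smul_def]
            have := congrArg (algebraMap R Q) hr'
            rw [map_mul, map_one] at this
            linear_combination -e * this
          rw [h3]
          exact Submodule.smul_mem _ _ (h1 e he)
        have hyN : y ∈ N := by
          refine hsat y hym ?_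
          have : t • y = (φ x).1 := by
            ext i
            change t • (v * (φ x).1 i) = _
            rw [Algebra.smul_def, ← mul_assoc, hv, one_mul]
          rw [this]
          exact (φ x).2
        refine ⟨φ.symm ⟨y, hyN⟩, ?_⟩
        ext p
        apply hinj
        change algebraMap R Q (c _ p) = _
        rw [hc, φ.apply_symm_apply]
        exact hsy p.1 p.2
    · intro p q hpq hp
      by_contra hne
      let b := Module.Free.chooseBasis R p
      have hnt : Nontrivial p := Submodule.nontrivial_iff_ne_bot.2 hne
      obtain ⟨i⟩ : Nonempty (Module.Free.ChooseBasisIndex R p) := b.index_nonempty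
      let g : M →ₗ[R] R := b.coord i ∘ₗ Submodule.projectionOnto p q hpq
      have hg : g (b i) = 1 := by
        simp [g]
      refine hE1 fun e he => ?_
      obtain ⟨r, hr⟩ := htE ⟨e, he⟩
      let x : N := φ (b i)
      refine Submodule.mem_one.2 ⟨g (φ.symm ((⟨e, he⟩ : E) • x)), ?_⟩
      have h1 : t • ((⟨e, he⟩ : E) • x) = r • x := by
        rw [← smul_assoc, ← hr, algebraMap_smul]
      have h2 := congrArg (fun y => algebraMap R Q (g (φ.symm y))) h1
      simp only [map_smul, smul_eq_mul, map_mul] at h2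
      have h3 : g (φ.symm x) = 1 := by rw [φ.symm_apply_apply, hg]
      have h4 : algebraMap R Q r = algebraMap R Q t * e := by
        have : algebraMap R Q r = t • e := congrArg Subtype.val hr
        rwa [Algebra.smul_def] at this
      rw [h3, map_one, mul_one, h4] at h2
      exact (isUnit_algebraMap ht.mem_nonZeroDivisors).mul_left_cancel h2

end

end Classes

/-! ### Gorenstein rings and duality -/

section Gorenstein

variable {A : Type u} [CommRing A] {t : A}

/-- The double annihilator condition in `A / t` makes `A / t` self-injective, so that `A` has
injective dimension at most one. -/
lemma IsParameter.isGorenstein_of_exists_annihilator [IsNoetherianRing A] (ht : IsParameter A t)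
    (H : ∀ (I : Ideal A) (x : A), t ∈ I → x ∉ I → ∃ b : A, (∀ y ∈ I, t ∣ b * y) ∧ ¬ t ∣ b * x) :
    IsGorenstein A := by
  have hdim : HasInjectiveDimensionLE (ModuleCat.of A A) 1 :=
    hasInjectiveDimensionLE_one fun n f g =>
      (quotInjective_of_exists_annihilator H).exists_extension ht.mem_jacobson ht.isSMulRegular
        (fun x hx => ht.isSMulRegular (by
          rw [LinearMap.mem_ker, map_smul] at hx
          exact hx.trans (smul_zero t).symm)) g
  refine ⟨inferInstance, fun p hp => ⟨1, ?_⟩⟩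
  have h := (ModuleCat.of A A).localizedModule_hasInjectiveDimensionLE 1 p.primeCompl
  have := (ModuleCat.of A A).localizedModule_isLocalizedModule p.primeCompl
  let e : (ModuleCat.of A A).localizedModule p.primeCompl ≃ₗ[A] Localization.AtPrime p :=
    IsLocalizedModule.linearEquiv p.primeCompl
      ((ModuleCat.of A A).localizedModuleMkLinearMap p.primeCompl)
      (Algebra.linearMap A (Localization.AtPrime p))
  exact (ModuleCat.hasInjectiveDimensionLE_iff_of_linearEquiv
    (N := ModuleCat.of (Localization.AtPrime p) (Localization.AtPrime p))
    (e.extendScalarsOfIsLocalization p.primeCompl (Localization.AtPrime p)) 1).1 h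

/-- The double annihilator condition holds in `A / t` for a Gorenstein ring `A`: localize at a
maximal ideal containing `I : x` and use that the residue field embeds into the injective
module `A / t`. -/
lemma IsParameter.exists_annihilator (ht : IsParameter A t) (hA : IsGorenstein A) (I : Ideal A)
    (x : A) (htI : t ∈ I) (hx : x ∉ I) : ∃ b : A, (∀ y ∈ I, t ∣ b * y) ∧ ¬ t ∣ b * x := by
  have hnoeth : IsNoetherianRing A := hA.1
  let J : Ideal A := Submodule.comap (LinearMap.lsmul A A x) I
  have hJ : ∀ b, b ∈ J ↔ x * b ∈ I := fun b => Iff.rfl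
  have hJtop : J ≠ ⊤ := fun h => hx (by simpa using (hJ 1).1 (h ▸ Submodule.mem_top))
  obtain ⟨n, hn, hJn⟩ := Ideal.exists_le_maximal J hJtop
  have hnp : n.IsPrime := hn.isPrime
  let B := Localization.AtPrime n
  have htn : t ∈ n := ht.mem_of_isMaximal n
  have htreg : IsSMulRegular B (algebraMap A B t) := by
    have h1 : algebraMap A B t ∈ B⁰ :=
      IsLocalization.map_nonZeroDivisors_le n.primeCompl B ⟨t, ht.mem_nonZeroDivisors, rfl⟩
    exact fun _ _ h => (mul_cancel_left_mem_nonZeroDivisors h1).1 h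
  have htm : algebraMap A B t ∈ IsLocalRing.maximalIdeal B :=
    (IsLocalization.AtPrime.to_map_mem_maximal_iff B n t).2 htn
  have htp : ∀ p : Ideal B, p.IsPrime → algebraMap A B t ∈ p → p = IsLocalRing.maximalIdeal B := by
    intro p hp h
    have h1 : (p.comap (algebraMap A B)).IsMaximal :=
      ht.isMaximal_of_mem _ (hp.comap _) h
    have h2 : p.comap (algebraMap A B) ≤ n := by
      intro y hy
      exact (IsLocalization.AtPrime.to_map_mem_maximal_iff B n y).1
        (IsLocalRing.le_maximalIdeal hp.ne_top hy)
    have h3 : p.comap (algebraMap A B) = n := h1.eq_of_le hn.ne_top h2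
    refine le_antisymm (IsLocalRing.le_maximalIdeal hp.ne_top) ?_
    rw [← IsLocalization.AtPrime.map_eq_maximalIdeal n B, Ideal.map_le_iff_le_comap, h3]
  have hinj : QuotInjective B (algebraMap A B t) B :=
    quotInjective_of_hasFiniteInjDim htreg htm htp B (hA.2 n) htreg
  have hx' : (Ideal.Quotient.mk (I.map (algebraMap A B)) (algebraMap A B x)) ≠ 0 := by
    rw [Ne, Ideal.Quotient.eq_zero_iff_mem,
      IsLocalization.algebraMap_mem_map_algebraMap_iff n.primeCompl]
    rintro ⟨s, hs, hsx⟩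
    exact hs (hJn ((hJ s).2 (by rwa [mul_comm])))
  obtain ⟨g, hg⟩ := exists_hom_quot_ne_zero htm htp B hinj (B ⧸ I.map (algebraMap A B))
    (fun z => by
      obtain ⟨z, rfl⟩ := Ideal.Quotient.mk_surjective z
      rw [← Ideal.Quotient.mk_eq_mk, ← Submodule.Quotient.mk_smul, Submodule.Quotient.mk_eq_zero,
        smul_eq_mul]
      exact Ideal.mul_mem_right _ _ (Ideal.mem_map_of_mem _ htI)) hx'
  obtain ⟨b', hb'⟩ := Submodule.mkQ_surjective _ (g (Ideal.Quotient.mk _ 1))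
  have hgb : ∀ y : A, g (Ideal.Quotient.mk _ (algebraMap A B y)) =
      Submodule.Quotient.mk (algebraMap A B y * b') := by
    intro y
    have h1 : (Ideal.Quotient.mk (I.map (algebraMap A B)) (algebraMap A B y)) =
        algebraMap A B y • Ideal.Quotient.mk (I.map (algebraMap A B)) 1 := by
      rw [← Ideal.Quotient.mk_eq_mk, ← Ideal.Quotient.mk_eq_mk, ← Submodule.Quotient.mk_smul,
        smul_eq_mul, mul_one]
    rw [h1, map_smul, ← hb']
    rfl
  have hdvd : ∀ z : B, (Submodule.Quotient.mk z : QuotSMulTop (algebraMap A B t) B) = 0 ↔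
      algebraMap A B t ∣ z := by
    intro z
    rw [Submodule.Quotient.mk_eq_zero, mem_smul_top_iff]
    exact ⟨fun ⟨y, hy⟩ => ⟨y, hy.symm⟩, fun ⟨y, hy⟩ => ⟨y, hy.symm⟩⟩
  have hdvdA : ∀ z : A, algebraMap A B t ∣ algebraMap A B z ↔ ∃ s ∉ n, t ∣ s * z := by
    intro z
    rw [← Ideal.mem_span_singleton, ← Set.image_singleton, ← Ideal.map_span,
      IsLocalization.algebraMap_mem_map_algebraMap_iff n.primeCompl]
    simp only [Ideal.mem_span_singleton]
    rfl
  -- Clear the denominator of `b'`.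
  obtain ⟨⟨b, s⟩, hbs⟩ := IsLocalization.surj n.primeCompl b'
  have hs : IsUnit (algebraMap A B s) := IsLocalization.map_units B s
  have hbI : ∀ y ∈ I, ∃ s ∉ n, t ∣ s * (b * y) := by
    intro y hy
    rw [← hdvdA, map_mul, ← hbs]
    have h1 := hgb y
    rw [Ideal.Quotient.eq_zero_iff_mem.2 (Ideal.mem_map_of_mem _ hy), map_zero] at h1
    obtain ⟨c, hc⟩ := (hdvd _).1 h1.symm
    exact ⟨c * algebraMap A B s, by rw [← mul_assoc, ← hc]; ring⟩
  have hbx : ¬ ∃ s ∉ n, t ∣ s * (b * x) := by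
    rw [← hdvdA, map_mul, ← hbs]
    intro h
    refine hg ?_
    rw [hgb, hdvd]
    refine (hs.dvd_mul_right).1 ?_
    convert h using 1
    ring
  -- Finitely many generators of `I` have a common multiplier.
  have hfg : I.FG := IsNoetherian.noetherian I
  obtain ⟨S, hS⟩ := hfg
  choose! σ hσ hσt using hbI
  refine ⟨(∏ y ∈ S, σ y) * b, fun y hy => ?_, fun h => hbx ⟨∏ y ∈ S, σ y, fun hmem => ?_, by
    rwa [← mul_assoc]⟩⟩
  · have hle : I ≤ Submodule.comap (LinearMap.lsmul A A ((∏ y ∈ S, σ y) * b)) (Ideal.span {t}) := by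
      rw [← hS, Submodule.span_le]
      intro z hz
      refine Ideal.mem_span_singleton.2 ?_
      obtain ⟨c, hc⟩ := hσt z (hS ▸ Submodule.subset_span hz)
      obtain ⟨d, hd⟩ := Finset.dvd_prod_of_mem σ (show z ∈ S from hz)
      refine ⟨c * d, ?_⟩
      change (∏ y ∈ S, σ y) * b * z = _
      rw [hd, ← mul_assoc t, ← hc]
      ring
    exact Ideal.mem_span_singleton.1 (hle hy)
  · obtain ⟨y, hy, hyn⟩ := (hnp.prod_mem_iff).1 hmem
    exact hσ y (hS ▸ Submodule.subset_span hy) hyn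

end Gorenstein

section Overring

variable {R : Type u} [CommRing R] {Q : Type u} [CommRing Q]
  [Algebra R Q] [IsFractionRing R Q] {t : R}

/-- A finite overring `E` is Gorenstein if it is dualizing among the lattices over `E`. -/
lemma isGorenstein_of_div_div_eq [IsNoetherianRing R] (ht : IsParameter R t) (E : Subalgebra R Q)
    (hE : IsLattice (Subalgebra.toSubmodule E))
    (H : ∀ X, IsLattice X → Subalgebra.toSubmodule E * X = X →
      Subalgebra.toSubmodule E / (Subalgebra.toSubmodule E / X) = X) : IsGorenstein E := by
  have := isNoetherianRing_of_isLattice E hE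
  refine (ht.subalgebra E hE).isGorenstein_of_exists_annihilator fun I x htI hx => ?_
  have htu : IsUnit (algebraMap R Q t) := isUnit_algebraMap ht.mem_nonZeroDivisors
  let X : Submodule R Q := (I.restrictScalars R).map E.val.toLinearMap
  have hmem : ∀ y : E, (y : Q) ∈ X ↔ y ∈ I := by
    intro y
    constructor
    · rintro ⟨z, hz, h⟩
      rwa [← (Subtype.ext h : z = y)]
    · exact fun h => ⟨y, h, rfl⟩
  have hXe : X ≤ Subalgebra.toSubmodule E := by
    rintro _ ⟨z, -, rfl⟩
    exact z.2
  have htX : algebraMap R Q t ∈ X := (hmem (algebraMap R E t)).2 htI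
  have hXl : IsLattice X := hE.of_le hXe htX htu
  have hEX : Subalgebra.toSubmodule E * X = X := by
    refine le_antisymm ?_ ?_
    · rw [Submodule.mul_le]
      rintro e he _ ⟨z, hz, rfl⟩
      exact (hmem (⟨e, he⟩ * z)).2 (I.mul_mem_left _ hz)
    · conv_lhs => rw [← one_mul X]
      refine mul_le_mul_left ?_ X
      rw [Submodule.one_le]
      exact E.one_mem
  have hxX : (x : Q) ∉ Subalgebra.toSubmodule E / (Subalgebra.toSubmodule E / X) := by
    rw [H X hXl hEX, hmem]
    exact hx
  rw [Submodule.mem_div_iff_forall_mul_mem] at hxX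
  push Not at hxX
  obtain ⟨u, hu, hxu⟩ := hxX
  rw [Submodule.mem_div_iff_forall_mul_mem] at hu
  refine ⟨⟨u * algebraMap R Q t, hu _ htX⟩, fun y hy => ⟨⟨u * y, hu _ ((hmem y).2 hy)⟩,
    Subtype.ext ?_⟩, ?_⟩
  · change u * algebraMap R Q t * y = algebraMap R Q t * (u * y)
    ring
  · rintro ⟨c, hc⟩
    have h1 : u * algebraMap R Q t * x = algebraMap R Q t * c := congrArg Subtype.val hc
    apply hxu
    have h2 : (x : Q) * u = c := htu.mul_left_cancel (by rw [← h1]; ring)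
    rw [h2]
    exact c.2

/-- A finite Gorenstein overring `E` is dualizing among the lattices over `E`. -/
lemma div_div_eq_of_isGorenstein [IsLocalRing R] (ht : IsParameter R t) (E : Subalgebra R Q)
    (hE : IsLattice (Subalgebra.toSubmodule E)) (hG : IsGorenstein E) {X : Submodule R Q}
    (hX : IsLattice X) (hEX : Subalgebra.toSubmodule E * X = X) :
    Subalgebra.toSubmodule E / (Subalgebra.toSubmodule E / X) = X := by
  refine le_antisymm (fun q hq => ?_) (le_div_div _ X)
  by_contra hqX
  have h1e : (1 : Submodule R Q) ≤ Subalgebra.toSubmodule E := by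
    rw [Submodule.one_le]
    exact E.one_mem
  -- Scale `X` and `q` into `E` by a regular element `c`.
  obtain ⟨c, hc, hcX⟩ := exists_smul_le_one
    (hX.fg.sup (Submodule.fg_span_singleton (R := R) q))
  have hcu : IsUnit (algebraMap R Q c) := isUnit_algebraMap hc
  obtain ⟨v, hv⟩ := hcu.exists_right_inv
  obtain ⟨n, hn⟩ := ht.exists_pow_smul_mem hX v
  have hd0 : t * t ^ n ∈ R⁰ := mul_mem ht.mem_nonZeroDivisors (pow_mem ht.mem_nonZeroDivisors n)
  have hd : IsParameter E (algebraMap R E (t * t ^ n)) :=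
    (isParameter_mul ht (pow_mem ht.mem_nonZeroDivisors n)).subalgebra E hE
  have hvmem : ∀ y : Q, v * (c • y) = y := by
    intro y
    rw [Algebra.smul_def, ← mul_assoc, mul_comm v, hv, one_mul]
  let I : Ideal E :=
    { carrier := {y | v * (y : Q) ∈ X}
      add_mem' := fun {a b} ha hb => by
        change v * ((a : Q) + b) ∈ X
        rw [mul_add]
        exact X.add_mem ha hb
      zero_mem' := by
        change v * ((0 : E) : Q) ∈ X
        simp
      smul_mem' := fun e y hy => by
        change v * ((e : Q) * y) ∈ X
        rw [mul_left_comm, ← hEX]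
        exact Submodule.mul_mem_mul e.2 hy }
  have hxE : c • q ∈ Subalgebra.toSubmodule E :=
    h1e (hcX q ((le_sup_right : _ ≤ X ⊔ _) (Submodule.mem_span_singleton_self q)))
  obtain ⟨b, hbI, hbx⟩ := hd.exists_annihilator hG I ⟨c • q, hxE⟩ (by
    change v * algebraMap R Q (t * t ^ n) ∈ X
    rw [mul_comm, ← Algebra.smul_def, mul_smul]
    exact X.smul_mem _ hn) (by
    change ¬ v * (c • q) ∈ X
    rwa [hvmem])
  obtain ⟨w, hw⟩ := (isUnit_algebraMap (Q := Q) hd0).exists_right_inv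
  have hu : (b : Q) * w * algebraMap R Q c ∈ Subalgebra.toSubmodule E / X := by
    rw [Submodule.mem_div_iff_forall_mul_mem]
    intro y hy
    have hyE : c • y ∈ Subalgebra.toSubmodule E := h1e (hcX y ((le_sup_left : X ≤ _) hy))
    obtain ⟨z, hz⟩ := hbI ⟨c • y, hyE⟩ (by
      change v * (c • y) ∈ X
      rwa [hvmem])
    have h2 : (b : Q) * (c • y) = algebraMap R Q (t * t ^ n) * z := congrArg Subtype.val hz
    rw [Algebra.smul_def] at h2
    have h3 : (b : Q) * w * algebraMap R Q c * y = z := by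
      linear_combination w * h2 + z * hw
    rw [h3]
    exact z.2
  have h4 := Submodule.mem_div_iff_forall_mul_mem.1 hq _ hu
  refine hbx ⟨⟨_, h4⟩, Subtype.ext ?_⟩
  change (b : Q) * (c • q) = algebraMap R Q (t * t ^ n) * (q * (b * w * algebraMap R Q c))
  rw [Algebra.smul_def]
  linear_combination -(b * algebraMap R Q c * q) * hw

end Overring

/-! ### Stability, syzygies and the Gorenstein property of `𝔪 : 𝔪` -/

section Scaling

variable {R : Type u} [CommRing R] {Q : Type u} [CommRing Q] [Algebra R Q]

lemma mul_div_of_mul_eq_one {U V : Submodule R Q} (h : U * V = 1) (W X : Submodule R Q) :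
    U * W / X = U * (W / X) := by
  refine le_antisymm ?_ ?_
  · have h1 : V * (U * W / X) ≤ W / X := by
      rw [Submodule.le_div_iff_mul_le, mul_assoc]
      calc V * (U * W / X * X) ≤ V * (U * W) := mul_le_mul_right (div_mul_le _ _) V
        _ = W := by rw [← mul_assoc, mul_comm V U, h, one_mul]
    calc U * W / X = U * (V * (U * W / X)) := by rw [← mul_assoc, h, one_mul]
      _ ≤ U * (W / X) := mul_le_mul_right h1 U
  · rw [Submodule.le_div_iff_mul_le, mul_assoc]
    exact mul_le_mul_right (div_mul_le _ _) U

lemma mul_div_div_of_mul_eq_one {U V : Submodule R Q} (h : U * V = 1) (W X : Submodule R Q) :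
    U * W / (U * W / X) = W / (W / X) := by
  have h1 : U * W / U = W := by
    refine le_antisymm ?_ (by rw [Submodule.le_div_iff_mul_le, mul_comm])
    calc U * W / U = U * W / U * U * V := by rw [mul_assoc, h, mul_one]
      _ ≤ U * W * V := mul_le_mul_left (div_mul_le _ _) V
      _ = W := by rw [mul_right_comm, h, one_mul]
  rw [mul_div_of_mul_eq_one h W X, ← div_div_eq (U * W), h1]

lemma span_singleton_mul_span_singleton_eq_one {a b : Q} (h : a * b = 1) :
    Submodule.span R {a} * Submodule.span R {b} = 1 := by
  rw [Submodule.span_mul_span, Set.singleton_mul_singleton, h, Submodule.one_eq_span]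

/-- The powers of a finitely generated module of integral elements lie in a finite algebra, so that
they stabilize. -/
lemma exists_pow_succ_eq [IsNoetherianRing R] {K : Submodule R Q} (h1 : 1 ≤ K) (hfg : K.FG)
    (hint : K ≤ Subalgebra.toSubmodule (integralClosure R Q)) : ∃ n, K ^ (n + 1) = K ^ n := by
  obtain ⟨s, hs⟩ := hfg
  let S := Algebra.adjoin R (s : Set Q)
  have hSfg : (Subalgebra.toSubmodule S).FG :=
    fg_adjoin_of_finite s.finite_toSet fun x hx => hint (hs ▸ Submodule.subset_span hx)
  have hKS : K ≤ Subalgebra.toSubmodule S := by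
    rw [← hs, Submodule.span_le]
    exact Algebra.subset_adjoin
  have hpow : ∀ n, K ^ n ≤ Subalgebra.toSubmodule S := by
    intro n
    induction n with
    | zero =>
      rw [pow_zero, Submodule.one_le]
      exact S.one_mem
    | succ n ih =>
      rw [pow_succ, Submodule.mul_le]
      exact fun x hx y hy => S.mul_mem (ih hx) (hKS hy)
  have : Module.Finite R S := Module.Finite.iff_fg.2 hSfg
  have hmono : Monotone fun n => K ^ n := monotone_nat_of_le_succ fun n => by
    rw [pow_succ]
    conv_lhs => rw [← mul_one (K ^ n)]
    exact mul_le_mul_right h1 _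
  obtain ⟨n, hn⟩ := monotone_stabilizes_iff_noetherian.2 (inferInstance : IsNoetherian R S)
    ⟨fun n => (K ^ n).comap S.val.toLinearMap, fun i j hij => Submodule.comap_mono (hmono hij)⟩
  refine ⟨n, le_antisymm (fun x hx => ?_) (hmono n.le_succ)⟩
  have h2 : (⟨x, hpow _ hx⟩ : S) ∈ (K ^ (n + 1)).comap S.val.toLinearMap := hx
  have h3 := hn (n + 1) n.le_succ
  change (K ^ n).comap S.val.toLinearMap = (K ^ (n + 1)).comap S.val.toLinearMap at h3
  rw [← h3] at h2
  exact h2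

end Scaling

section Duality

variable {R : Type u} [CommRing R] {Q : Type u} [CommRing Q] [Algebra R Q] {K m e : Submodule R Q}

/-- If `K` is dualizing, the canonical lattice `K : e` of the overring `e = 1 : m` is `K m`. -/
lemma IsDualizing.div_eq_mul (hK : IsDualizing K) (hKl : IsLattice K) (hm : IsLattice m)
    (h1m : 1 / m = e) : K / e = K * m := by
  rw [← h1m, ← hK.div_self, div_div_eq, hK _ (hKl.mul hm)]

lemma IsDualizing.div_div_self (hK : IsDualizing K) (he : IsLattice e) (h1 : 1 ≤ e)
    (hee : e * e = e) : K / e / (K / e) = e := by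
  have := hK.div_div_of_mul_eq h1 he hee
  rwa [div_div_eq K e e, hee] at this

/-- If `K m` is reflexive with respect to `m`, then `m = m K D` for `D = m : K m`. -/
lemma IsDualizing.mul_eq_of_reflexive [IsFractionRing R Q] [IsNoetherianRing R] (hK : IsDualizing K)
    (hKl : IsLattice K) (hm : IsLattice m) (h1m : 1 / m = e) (hmm : m / m = e) {n : ℕ}
    (hn : K ^ (n + 1) = K ^ n) (hrefl : m / (m / (K * m)) = K * m) : m * K = m := by
  have hw := hK.div_eq_mul hKl hm h1m
  have hem : e * m = m := by rw [← hmm, div_self_mul]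
  have h1 : (1 : Submodule R Q) ≤ e := hmm ▸ one_le_div_self m
  have hee : e * e = e := by rw [← hmm, div_self_mul_div_self]
  set w := K * m with hwdef
  have hwl : IsLattice w := hKl.mul hm
  have hew : e * w = w := by rw [hwdef, mul_left_comm, hem]
  set D := m / w with hD
  have hDl : IsLattice D := hm.div hwl
  set U := w / m with hU
  have hUl : IsLattice U := hwl.div hm
  have heU : e * U = U := mul_div_of_mul_eq h1 hem w
  -- `w = m : D = (w : U) : D = w : (U D)`, and `w`-duality gives `U D = e`.
  have hmU : w / U = m := by
    have := hK.div_div_of_mul_eq h1 hm hem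
    rwa [hw] at this
  have hUD : U * D = e := by
    have h2 : w / (U * D) = w := by rw [← div_div_eq, hmU, hrefl]
    have h3 := hK.div_div_of_mul_eq h1 (hUl.mul hDl) (by rw [← mul_assoc, heU])
    rw [hw, h2] at h3
    rw [← h3, ← hw]
    exact hK.div_div_self (hmm ▸ hm.div hm) h1 hee
  refine mul_eq_of_mul_mul_eq hn (D := D) ?_
  rw [mul_comm m K]
  refine le_antisymm (by rw [mul_comm]; exact div_mul_le m w) ?_
  calc m = m * (U * D) := by rw [hUD, mul_comm, hem]
    _ = U * m * D := by rw [mul_comm U m, mul_assoc]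
    _ ≤ w * D := mul_le_mul_left (div_mul_le w m) D

/-- If the overring `e = m : m = 1 : m` is dualizing among its lattices, then its canonical lattice
`K m` is invertible, and so is `e K`; as the powers of `K` stabilize, `K ⊆ e`. -/
lemma IsDualizing.mul_eq_of_forall_div_div_eq [IsFractionRing R Q] [IsNoetherianRing R]
    (hK : IsDualizing K) (hKl : IsLattice K) (hm : IsLattice m) (h1m : 1 / m = e)
    (hmm : m / m = e) {n : ℕ} (hn : K ^ (n + 1) = K ^ n)
    (H : ∀ X, IsLattice X → e * X = X → e / (e / X) = X) : m * (e / m) = e ∧ m * K = m := by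
  have hem : e * m = m := by rw [← hmm, div_self_mul]
  have h1 : (1 : Submodule R Q) ≤ e := hmm ▸ one_le_div_self m
  have hee : e * e = e := by rw [← hmm, div_self_mul_div_self]
  have hel : IsLattice e := hmm ▸ hm.div hm
  have key : ∀ X, IsLattice X → e * X = X → X / X = e → X * (e / X) = e := by
    intro X hX heX hXX
    have h2 : e / (e / X * X) = e := by rw [← div_div_eq, H X hX heX, hXX]
    have h3 := H (e / X * X) ((hel.div hX).mul hX) (by rw [mul_left_comm, heX])
    rw [h2, div_eq_self_of_mul_eq h1 hee] at h3
    rw [mul_comm, ← h3]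
  have hmi := key m hm hem hmm
  have hwi := key (K * m) (hKl.mul hm) (by rw [mul_left_comm, hem]) (by
    rw [← hK.div_eq_mul hKl hm h1m]
    exact hK.div_div_self hel h1 hee)
  refine ⟨hmi, ?_⟩
  set X := m * (e / (K * m))
  have hX : K * X = e := by rw [← hwi, mul_assoc]
  have hpow : ∀ j, K ^ j * X ^ j * e = e := by
    intro j
    induction j with
    | zero => simp
    | succ j ih =>
      calc K ^ (j + 1) * X ^ (j + 1) * e = K * X * (K ^ j * X ^ j * e) := by ring
        _ = e := by rw [ih, hX, hee]
  have hKe : K * e = e := by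
    calc K * e = K * (K ^ n * X ^ n * e) := by rw [hpow]
      _ = K ^ (n + 1) * X ^ n * e := by ring
      _ = e := by rw [hn, hpow]
  calc m * K = e * m * K := by rw [hem]
    _ = K * e * m := by ring
    _ = m := by rw [hKe, hem]

/-- If `m` is principal over `e` and `K m = m`, then `e` is dualizing among its lattices, being
isomorphic to its canonical lattice. -/
lemma IsDualizing.div_div_eq_of_eq_span_mul (hK : IsDualizing K) (hKl : IsLattice K)
    (hm : IsLattice m) (h1m : 1 / m = e) (h1 : 1 ≤ e) (hmK : m * K = m) {a : Q} (ha : IsUnit a)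
    (hma : m = Submodule.span R {a} * e) {X : Submodule R Q} (hX : IsLattice X) (heX : e * X = X) :
    e / (e / X) = X := by
  obtain ⟨b, hb⟩ := ha.exists_right_inv
  have h := hK.div_div_of_mul_eq h1 hX heX
  rwa [hK.div_eq_mul hKl hm h1m, mul_comm K m, hmK, hma,
    mul_div_div_of_mul_eq_one (span_singleton_mul_span_singleton_eq_one hb)] at h

end Duality

section Local

variable {R : Type u} [CommRing R] [IsLocalRing R] {Q : Type u} [CommRing Q]
  [Algebra R Q] [IsFractionRing R Q] {t : R}

/-- The maximal ideal is stable if and only if it is a principal module over `𝔪 : 𝔪`. -/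
lemma isStable_maximalIdeal_iff (ht : IsParameter R t) {m : Submodule R Q}
    (hm : m = IsLocalization.coeSubmodule Q (IsLocalRing.maximalIdeal R)) :
    (IsLocalRing.maximalIdeal R).IsStable ↔
      ∃ a : Q, IsUnit a ∧ m = Submodule.span R {a} * (m / m) := by
  have htm : t ∈ IsLocalRing.maximalIdeal R := ht.mem_of_isMaximal _
  constructor
  · rintro ⟨a, ha, hsq⟩
    have hmm : m * m = Submodule.span R {algebraMap R Q a} * m := by
      have := congrArg (IsLocalization.coeSubmodule Q) hsq
      rwa [pow_two, IsLocalization.coeSubmodule_mul, IsLocalization.coeSubmodule_mul,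
        IsLocalization.coeSubmodule_span_singleton, ← hm] at this
    have ham : algebraMap R Q a ∈ m := hm ▸ ⟨a, ha, rfl⟩
    have hau : IsUnit (algebraMap R Q a) := by
      have h1 : algebraMap R Q t * algebraMap R Q t ∈ m * m := by
        have : algebraMap R Q t ∈ m := hm ▸ ⟨t, htm, rfl⟩
        exact Submodule.mul_mem_mul this this
      rw [hmm, Submodule.mem_span_singleton_mul] at h1
      obtain ⟨y, -, hy⟩ := h1
      have htu := isUnit_algebraMap (Q := Q) ht.mem_nonZeroDivisors
      exact isUnit_of_mul_isUnit_left (hy ▸ htu.mul htu)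
    refine ⟨_, hau, le_antisymm (fun x hx => ?_) ?_⟩
    · obtain ⟨b, hb⟩ := hau.exists_right_inv
      rw [Submodule.mem_span_singleton_mul]
      refine ⟨b * x, Submodule.mem_div_iff_forall_mul_mem.2 fun y hy => ?_, by
        rw [← mul_assoc, hb, one_mul]⟩
      have h1 := Submodule.mul_mem_mul hx hy
      rw [hmm, Submodule.mem_span_singleton_mul] at h1
      obtain ⟨z, hz, h1⟩ := h1
      have h2 : b * x * y = z := by
        linear_combination -b * h1 + z * hb
      rwa [h2]
    · calc _ ≤ m * (m / m) :=
            mul_le_mul_left ((Submodule.span_singleton_le_iff_mem _ _).2 ham) _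
        _ = m := by rw [mul_comm, div_self_mul]
  · rintro ⟨a, -, ha⟩
    have ham : a ∈ m := by
      rw [ha, Submodule.mem_span_singleton_mul]
      exact ⟨1, Submodule.one_le.1 (one_le_div_self m), mul_one a⟩
    obtain ⟨a, ha', rfl⟩ : a ∈ IsLocalization.coeSubmodule Q (IsLocalRing.maximalIdeal R) :=
      hm ▸ ham
    refine ⟨a, ha', IsFractionRing.coeSubmodule_injective R Q ?_⟩
    rw [pow_two, IsLocalization.coeSubmodule_mul, IsLocalization.coeSubmodule_mul,
      IsLocalization.coeSubmodule_span_singleton, ← hm]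
    change m = Submodule.span R {algebraMap R Q a} * _ at ha
    conv_lhs => enter [1]; rw [ha]
    rw [mul_assoc, div_self_mul]

variable [IsNoetherianRing R] {E : Subalgebra R Q} {K m : Submodule R Q}

lemma restrictTo_catOmegaCM_iff_catOmegaCMP (ht : IsParameter R t)
    (hm : m = IsLocalization.coeSubmodule Q (IsLocalRing.maximalIdeal R))
    (hmm : m / m = Subalgebra.toSubmodule E) (h1m : 1 / m = Subalgebra.toSubmodule E)
    (hK : IsDualizing K) (hKl : IsLattice K) :
    (∀ M : ModuleCat.{u} R, (catOmegaCM E).restrictTo R M ↔ catOmegaCMP R M) ↔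
      ∃ a : Q, IsUnit a ∧ m = Submodule.span R {a} * (m / m) := by
  have hml : IsLattice m := hm ▸ isLattice_maximalIdeal ht
  have hE : IsLattice (Subalgebra.toSubmodule E) := hmm ▸ hml.div hml
  have hEm : Subalgebra.toSubmodule E * m = m := by rw [← hmm, div_self_mul]
  have hE1 : ¬ Subalgebra.toSubmodule E ≤ 1 := by
    rw [← h1m, hm]
    exact not_one_div_maximalIdeal_le ht
  have h1 : 1 ≤ Subalgebra.toSubmodule E := hmm ▸ one_le_div_self m
  have hee : Subalgebra.toSubmodule E * Subalgebra.toSubmodule E = Subalgebra.toSubmodule E := by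
    rw [← hmm, div_self_mul_div_self]
  have hP := catOmegaCMP_iff (Q := Q) ht E hE (hm ▸ hEm) hE1
  rw [← hm] at hP
  simp_rw [hP, restrictTo_catOmegaCM_iff ht E hE, hmm]
  constructor
  · intro H
    have hrefl := ((H (ModuleCat.of R m)).2 (isSaturatedIn_self E t hEm)).div_div_eq ht hml
    have hinv := mul_div_eq_of_reflexive E (w := K / Subalgebra.toSubmodule E)
      (hKl.div hE) (mul_div_of_mul_eq h1 hee K) (hK.div_div_self hE h1 hee) hml
      (fun X hX hEX => hK.div_div_of_mul_eq h1 hX hEX) hmm hE hrefl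
    obtain ⟨a, -, ha⟩ := exists_eq_span_mul_of_mul_eq ht E hE hml (hE.div hml) hEm
      (mul_div_of_mul_eq h1 hEm _) hinv
    refine ⟨a, ?_, ha⟩
    obtain ⟨u, hu, hu'⟩ := hml.exists_isUnit
    rw [ha, Submodule.mem_span_singleton_mul] at hu
    obtain ⟨z, -, rfl⟩ := hu
    exact isUnit_of_mul_isUnit_left hu'
  · rintro ⟨a, hau, ha⟩ M
    obtain ⟨b, hb⟩ := hau.exists_right_inv
    constructor
    · intro h
      rw [ha]
      exact h.span_mul hau
    · intro h
      have h2 := h.span_mul (IsUnit.of_mul_eq_one a (by rwa [mul_comm]) : IsUnit b)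
      rwa [ha, ← mul_assoc, span_singleton_mul_span_singleton_eq_one (by rwa [mul_comm]),
        one_mul] at h2

lemma catOmegaCMP_iff_restrictTo_catCM (ht : IsParameter R t)
    (hm : m = IsLocalization.coeSubmodule Q (IsLocalRing.maximalIdeal R))
    (hmm : m / m = Subalgebra.toSubmodule E) (h1m : 1 / m = Subalgebra.toSubmodule E)
    (hinj : HasFiniteInjDim R K) (hKl : IsLattice K) {n : ℕ} (hn : K ^ (n + 1) = K ^ n) :
    (∀ M : ModuleCat.{u} R, catOmegaCMP R M ↔ (catCM E).restrictTo R M) ↔ m * K = m := by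
  have hK := isDualizing_of_hasFiniteInjDim ht hKl hinj
  have hml : IsLattice m := hm ▸ isLattice_maximalIdeal ht
  have hE : IsLattice (Subalgebra.toSubmodule E) := hmm ▸ hml.div hml
  have hEm : Subalgebra.toSubmodule E * m = m := by rw [← hmm, div_self_mul]
  have hE1 : ¬ Subalgebra.toSubmodule E ≤ 1 := by
    rw [← h1m, hm]
    exact not_one_div_maximalIdeal_le ht
  have hP := catOmegaCMP_iff (Q := Q) ht E hE (hm ▸ hEm) hE1
  rw [← hm] at hP
  simp_rw [hP]
  constructor
  · intro H
    have hsat : IsSaturatedIn E t (K * m) (K * m : Submodule R Q) :=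
      isSaturatedIn_self E t (by rw [mul_left_comm, hEm])
    have hrefl := ((H (ModuleCat.of R (K * m : Submodule R Q))).2
      (hsat.restrictTo_catCM ht hE (hKl.mul hml))).div_div_eq ht (hKl.mul hml)
    exact hK.mul_eq_of_reflexive hKl hml h1m hmm hn hrefl
  · intro hmK M
    refine ⟨fun h => h.restrictTo_catCM ht hE hml, fun h => ?_⟩
    have h2 := isSaturatedIn_of_restrictTo_catCM ht hE hKl hinj h
    rwa [hK.div_eq_mul hKl hml h1m, mul_comm, hmK] at h2

lemma isGorenstein_iff (ht : IsParameter R t)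
    (hm : m = IsLocalization.coeSubmodule Q (IsLocalRing.maximalIdeal R))
    (hmm : m / m = Subalgebra.toSubmodule E) (h1m : 1 / m = Subalgebra.toSubmodule E)
    (hK : IsDualizing K) (hKl : IsLattice K) {n : ℕ} (hn : K ^ (n + 1) = K ^ n) :
    IsGorenstein E ↔ m * K = m ∧ ∃ a : Q, IsUnit a ∧ m = Submodule.span R {a} * (m / m) := by
  have hml : IsLattice m := hm ▸ isLattice_maximalIdeal ht
  have hE : IsLattice (Subalgebra.toSubmodule E) := hmm ▸ hml.div hml
  have hEm : Subalgebra.toSubmodule E * m = m := by rw [← hmm, div_self_mul]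
  have h1 : 1 ≤ Subalgebra.toSubmodule E := hmm ▸ one_le_div_self m
  rw [hmm]
  constructor
  · intro hG
    obtain ⟨hinv, hmK⟩ := hK.mul_eq_of_forall_div_div_eq hKl hml h1m hmm hn
      fun X hX hEX => div_div_eq_of_isGorenstein ht E hE hG hX hEX
    refine ⟨hmK, ?_⟩
    obtain ⟨a, -, ha⟩ := exists_eq_span_mul_of_mul_eq ht E hE hml (hE.div hml) hEm
      (mul_div_of_mul_eq h1 hEm _) hinv
    refine ⟨a, ?_, ha⟩
    obtain ⟨u, hu, hu'⟩ := hml.exists_isUnit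
    rw [ha, Submodule.mem_span_singleton_mul] at hu
    obtain ⟨z, -, rfl⟩ := hu
    exact isUnit_of_mul_isUnit_left hu'
  · rintro ⟨hmK, a, hau, ha⟩
    exact isGorenstein_of_div_div_eq ht E hE fun X hX hEX =>
      hK.div_div_eq_of_eq_span_mul hKl hml h1m h1 hmK hau ha hX hEX

end Local

/-! ### Lengths of quotients of lattices and the Cohen-Macaulay type -/

section Length

variable {R : Type u} [CommRing R] {Q : Type u} [CommRing Q] [Algebra R Q]

/-- The length of `Y / X` for submodules `X ⊆ Y` of `Q`. -/
noncomputable def quotLength (X Y : Submodule R Q) : ℕ∞ :=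
  Module.length R (Y ⧸ X.submoduleOf Y)

lemma length_quotient_comap {M : Type*} [AddCommGroup M] [Module R M] (f : M →ₗ[R] Q)
    (X : Submodule R Q) : Module.length R (M ⧸ X.comap f) = quotLength X (LinearMap.range f) := by
  let g : M →ₗ[R] LinearMap.range f ⧸ X.submoduleOf (LinearMap.range f) :=
    (Submodule.mkQ _) ∘ₗ f.rangeRestrict
  have hg : Function.Surjective g :=
    (Submodule.mkQ_surjective _).comp f.surjective_rangeRestrict
  have hker : LinearMap.ker g = X.comap f := by
    rw [LinearMap.ker_comp, Submodule.ker_mkQ]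
    rfl
  rw [← hker]
  exact (g.quotKerEquivOfSurjective hg).length_eq

lemma quotLength_eq_zero_iff {X Y : Submodule R Q} : quotLength X Y = 0 ↔ Y ≤ X := by
  rw [quotLength, Module.length_eq_zero_iff, Submodule.Quotient.subsingleton_iff,
    Submodule.submoduleOf_eq_top]

lemma quotLength_self (X : Submodule R Q) : quotLength X X = 0 := quotLength_eq_zero_iff.2 le_rfl

lemma quotLength_add {X Y Z : Submodule R Q} (hXY : X ≤ Y) (hYZ : Y ≤ Z) :
    quotLength X Z = quotLength X Y + quotLength Y Z := by
  refine Module.length_eq_add_of_exact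
    (Submodule.mapQ (X.submoduleOf Y) (X.submoduleOf Z) (Submodule.inclusion hYZ) le_rfl)
    (Submodule.factor (p := X.submoduleOf Z) (p' := Y.submoduleOf Z) fun z hz => hXY hz)
    ?_ (Submodule.factor_surjective _) ?_
  · rw [← LinearMap.ker_eq_bot, LinearMap.ker_eq_bot']
    intro y hy
    obtain ⟨y, rfl⟩ := Submodule.mkQ_surjective _ y
    exact (Submodule.Quotient.mk_eq_zero (X.submoduleOf Y)).2
      ((Submodule.Quotient.mk_eq_zero (X.submoduleOf Z) (x := Submodule.inclusion hYZ y)).1 hy)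
  · intro z
    obtain ⟨z, rfl⟩ := Submodule.mkQ_surjective _ z
    constructor
    · intro hz
      have hz' : (z : Q) ∈ Y := (Submodule.Quotient.mk_eq_zero (Y.submoduleOf Z) (x := z)).1 hz
      exact ⟨Submodule.Quotient.mk ⟨z, hz'⟩, rfl⟩
    · rintro ⟨y, hy⟩
      obtain ⟨y, rfl⟩ := Submodule.mkQ_surjective _ y
      rw [← hy]
      exact (Submodule.Quotient.mk_eq_zero (Y.submoduleOf Z)
        (x := Submodule.inclusion hYZ y)).2 y.2

lemma quotLength_span_mul {v : Q} (hv : IsUnit v) (X Y : Submodule R Q) :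
    quotLength (Submodule.span R {v} * X) (Submodule.span R {v} * Y) = quotLength X Y := by
  let f : Y →ₗ[R] Q := LinearMap.mulLeft R v ∘ₗ Y.subtype
  have hrange : LinearMap.range f = Submodule.span R {v} * Y := by
    ext x
    rw [Submodule.mem_span_singleton_mul]
    constructor
    · rintro ⟨y, rfl⟩
      exact ⟨y, y.2, rfl⟩
    · rintro ⟨y, hy, rfl⟩
      exact ⟨⟨y, hy⟩, rfl⟩
  have hcomap : (Submodule.span R {v} * X).comap f = X.submoduleOf Y := by
    ext y
    rw [Submodule.mem_comap, Submodule.mem_span_singleton_mul]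
    constructor
    · rintro ⟨x, hx, h⟩
      have : (y : Q) = x := (hv.mul_left_cancel h).symm
      change (y : Q) ∈ X
      rwa [this]
    · exact fun hy => ⟨y, hy, rfl⟩
  rw [← hrange, ← length_quotient_comap, hcomap, quotLength]

lemma length_quotient_eq_quotLength (I : Ideal R) (hinj : Function.Injective (algebraMap R Q)) :
    Module.length R (R ⧸ I) = quotLength (IsLocalization.coeSubmodule Q I) 1 := by
  rw [Submodule.one_eq_range, ← length_quotient_comap]
  congr
  all_goals exact (Submodule.comap_map_eq_of_injective (f := Algebra.linearMap R Q) hinj I).symm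

/-- `X ↦ K : X` reverses the inclusions strictly, so that it does not decrease lengths. -/
lemma IsDualizing.quotLength_le [IsFractionRing R Q] [IsNoetherianRing R] {K X Y : Submodule R Q}
    (hK : IsDualizing K) (hX : IsLattice X) (hY : IsLattice Y) (hXY : X ≤ Y) :
    quotLength X Y ≤ quotLength (K / Y) (K / X) := by
  -- `Z P` is the preimage of `P` in `Y`, and `T P` the image of `K : Z P` in `(K : X) / (K : Y)`.
  let Z : Submodule R (Y ⧸ X.submoduleOf Y) → Submodule R Q := fun P =>
    (P.comap (Submodule.mkQ _)).map Y.subtype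
  have hXZ : ∀ P, X ≤ Z P := fun P x hx =>
    ⟨⟨x, hXY hx⟩, by
      change Submodule.Quotient.mk (⟨x, hXY hx⟩ : Y) ∈ P
      rw [(Submodule.Quotient.mk_eq_zero (X.submoduleOf Y)).2
        (show (⟨x, hXY hx⟩ : Y) ∈ X.submoduleOf Y from hx)]
      exact P.zero_mem, rfl⟩
  have hZY : ∀ P, Z P ≤ Y := fun P => Submodule.map_subtype_le Y _
  have hZmono : ∀ P P', P ≤ P' → Z P ≤ Z P' := fun P P' h =>
    Submodule.map_mono (Submodule.comap_mono h)
  have hZinj : ∀ P P', Z P = Z P' → P = P' := fun P P' h =>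
    Submodule.comap_injective_of_surjective (Submodule.mkQ_surjective _)
      (Submodule.map_injective_of_injective Y.subtype_injective h)
  have hZlat : ∀ P, IsLattice (Z P) := fun P => by
    obtain ⟨u, hu, hu'⟩ := hX.exists_isUnit
    exact hY.of_le (hZY P) (hXZ P hu) hu'
  let T : Submodule R (Y ⧸ X.submoduleOf Y) →
      (Submodule R ((K / X : Submodule R Q) ⧸ (K / Y).submoduleOf (K / X)))ᵒᵈ :=
    fun P => OrderDual.toDual (((K / Z P).submoduleOf (K / X)).map (Submodule.mkQ _))
  have hT : ∀ P P', P ≤ P' → T P ≤ T P' := fun P P' h =>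
    OrderDual.toDual_le_toDual.2
      (Submodule.map_mono (Submodule.comap_mono (div_le_div_left K (hZmono P P' h))))
  have hTinj : ∀ P P', T P = T P' → P = P' := by
    intro P P' h
    have h1 := congrArg (Submodule.comap (Submodule.mkQ _)) (OrderDual.toDual.injective h)
    have h2 : ∀ P, (K / Y).submoduleOf (K / X) ≤ (K / Z P).submoduleOf (K / X) := fun P =>
      Submodule.comap_mono (div_le_div_left K (hZY P))
    rw [Submodule.comap_map_mkQ, Submodule.comap_map_mkQ, sup_eq_right.2 (h2 P),
      sup_eq_right.2 (h2 P')] at h1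
    have h3 : K / Z P = K / Z P' := by
      have := congrArg (Submodule.map (K / X).subtype) h1
      rwa [Submodule.submoduleOf, Submodule.submoduleOf, Submodule.map_comap_subtype,
        Submodule.map_comap_subtype, inf_eq_right.2 (div_le_div_left K (hXZ P)),
        inf_eq_right.2 (div_le_div_left K (hXZ P'))] at this
    apply hZinj
    rw [← hK _ (hZlat P), h3, hK _ (hZlat P')]
  have hmono : StrictMono T :=
    (show Monotone T from fun P P' h => hT P P' h).strictMono_of_injective
      fun P P' h => hTinj P P' h
  have := Order.krullDim_le_of_strictMono T hmono
  rw [Order.krullDim_orderDual, ← Module.coe_length, ← Module.coe_length] at this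
  exact WithBot.coe_le_coe.1 this

/-- Duality preserves lengths. -/
lemma IsDualizing.quotLength_eq [IsFractionRing R Q] [IsNoetherianRing R] {K X Y : Submodule R Q}
    (hK : IsDualizing K) (hKl : IsLattice K) (hX : IsLattice X) (hY : IsLattice Y) (hXY : X ≤ Y) :
    quotLength (K / Y) (K / X) = quotLength X Y := by
  refine le_antisymm ?_ (hK.quotLength_le hX hY hXY)
  have := hK.quotLength_le (hKl.div hY) (hKl.div hX) (div_le_div_left K hXY)
  rwa [hK X hX, hK Y hY] at this

lemma quotLength_ne_top [IsFractionRing R Q] [IsNoetherianRing R] [IsLocalRing R] {t : R}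
    (ht : IsParameter R t) {X Y : Submodule R Q} (hX : IsLattice X) (hY : IsLattice Y) :
    quotLength X Y ≠ ⊤ := by
  obtain ⟨n, hn⟩ : ∃ n, ∀ y ∈ Y, t ^ n • y ∈ X := by
    obtain ⟨S, hS⟩ := hY.fg
    choose n hn using fun y => ht.exists_pow_smul_mem hX y
    refine ⟨∑ y ∈ S, n y, fun y hy => ?_⟩
    have hle : Y ≤ X.comap (LinearMap.lsmul R Q (t ^ ∑ y ∈ S, n y)) := by
      rw [← hS, Submodule.span_le]
      intro y hy
      obtain ⟨d, hd⟩ := pow_dvd_pow t (Finset.single_le_sum (fun _ _ => Nat.zero_le _)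
        (show y ∈ S from hy) : n y ≤ ∑ y ∈ S, n y)
      change (t ^ ∑ y ∈ S, n y) • y ∈ X
      rw [hd, mul_comm, mul_smul]
      exact X.smul_mem _ (hn y)
    exact hle hy
  -- `Y / X` is finite over the Artinian ring `R / t ^ n`.
  let I := Ideal.span {t ^ n}
  have hI : Ring.KrullDimLE 0 (R ⧸ I) := by
    rw [Ring.krullDimLE_zero_iff]
    intro p hp
    have hp' : (p.comap (Ideal.Quotient.mk I)).IsPrime := hp.comap _
    have htp : t ∈ p.comap (Ideal.Quotient.mk I) := by
      refine hp'.mem_of_pow_mem n ?_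
      rw [Ideal.mem_comap, Ideal.Quotient.eq_zero_iff_mem.2 (Ideal.mem_span_singleton_self _)]
      exact p.zero_mem
    have hmax := ht.isMaximal_of_mem _ hp' htp
    have h1 := Ideal.map_eq_top_or_isMaximal_of_surjective (Ideal.Quotient.mk I)
      Ideal.Quotient.mk_surjective hmax
    rw [Ideal.map_comap_of_surjective _ Ideal.Quotient.mk_surjective] at h1
    exact h1.resolve_left hp.ne_top
  have hart : IsArtinianRing (R ⧸ I) := IsNoetherianRing.isArtinianRing_of_krullDimLE_zero
  have hart' : IsArtinian R (R ⧸ I) :=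
    isArtinian_of_surjective_algebraMap (S := R) (R := R ⧸ I) Ideal.Quotient.mk_surjective
  have : Module.Finite R Y := Module.Finite.iff_fg.2 hY.fg
  obtain ⟨k, f, hf⟩ := Module.Finite.exists_fin' R (Y ⧸ X.submoduleOf Y)
  have htors : ∀ y : Y ⧸ X.submoduleOf Y, ∀ r ∈ I, r • y = 0 := by
    intro y r hr
    obtain ⟨y, rfl⟩ := Submodule.mkQ_surjective _ y
    obtain ⟨c, rfl⟩ := Ideal.mem_span_singleton.1 hr
    rw [← map_smul]
    refine (Submodule.Quotient.mk_eq_zero _).2 ?_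
    change (t ^ n * c) • (y : Q) ∈ X
    rw [mul_comm, mul_smul]
    exact X.smul_mem _ (hn y y.2)
  let g : (Fin k → R ⧸ I) →ₗ[R] Y ⧸ X.submoduleOf Y :=
    LinearMap.lsum R (fun _ => R ⧸ I) R fun i => Submodule.liftQ I
      (LinearMap.toSpanSingleton R _ (f (Pi.single i 1))) fun r hr => htors _ r hr
  have hg : Function.Surjective g := by
    intro y
    obtain ⟨z, rfl⟩ := hf y
    refine ⟨fun i => Ideal.Quotient.mk I (z i), ?_⟩
    conv_rhs => rw [← Finset.univ_sum_single z, map_sum]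
    rw [show g = _ from LinearMap.lsum_apply R _ R _, LinearMap.sum_apply]
    refine Finset.sum_congr rfl fun i _ => ?_
    have : (Pi.single i (z i) : Fin k → R) = z i • Pi.single i 1 := by
      rw [← Pi.single_smul, smul_eq_mul, mul_one]
    rw [this, map_smul]
    rfl
  have hartY : IsArtinian R (Y ⧸ X.submoduleOf Y) := isArtinian_of_surjective _ g hg
  exact Module.length_ne_top

end Length

section Ext

variable {R : Type u} [CommRing R] [IsLocalRing R]

lemma bassNumber_le_of_linearEquiv {M N : Type u} [AddCommGroup M] [Module R M] [AddCommGroup N]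
    [Module R N] (e : M ≃ₗ[R] N) (i : ℕ) : bassNumber R M i ≤ bassNumber R N i := by
  let f : ModuleCat.of R M ≅ ModuleCat.of R N := e.toModuleIso
  refine Module.length_le_of_injective
    ((Ext.mk₀ f.hom).postcompOfLinear R
      (ModuleCat.of R (IsLocalRing.ResidueField R)) (add_zero i)) fun x y h => ?_
  have h' : x.comp (Ext.mk₀ f.hom) (add_zero i) = y.comp (Ext.mk₀ f.hom) (add_zero i) := h
  have h2 := congrArg (fun z => z.comp (Ext.mk₀ f.inv) (add_zero i)) h'
  simpa using h2

lemma bassNumber_eq_of_linearEquiv {M N : Type u} [AddCommGroup M] [Module R M] [AddCommGroup N]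
    [Module R N] (e : M ≃ₗ[R] N) (i : ℕ) : bassNumber R M i = bassNumber R N i :=
  le_antisymm (bassNumber_le_of_linearEquiv e i) (bassNumber_le_of_linearEquiv e.symm i)

variable {Q : Type u} [CommRing Q] [Algebra R Q] [IsFractionRing R Q]

/-- The Cohen-Macaulay type of `R` is the length of `(R : 𝔪) / R`: the exact sequence
`0 → 𝔪 → R → k → 0` identifies `Ext^1(k, R)` with the cokernel of `R → Hom(𝔪, R) = R : 𝔪`. -/
lemma bassNumber_self_one {t : R} (ht : IsParameter R t) :
    bassNumber R R 1 = quotLength (1 : Submodule R Q)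
      (1 / IsLocalization.coeSubmodule Q (IsLocalRing.maximalIdeal R)) := by
  set m := IsLocalRing.maximalIdeal R
  set L : Submodule R Q := 1 / IsLocalization.coeSubmodule Q m
  have hinj : Function.Injective (algebraMap R Q) := IsFractionRing.injective R Q
  have htm : t ∈ m := ht.mem_of_isMaximal _
  let S : ShortComplex (ModuleCat.{u} R) := ModuleCat.shortComplexOfCompEqZero m.subtype
    (Algebra.linearMap R (IsLocalRing.ResidueField R)) (by
      ext x
      exact (IsLocalRing.residue_eq_zero_iff _).2 x.2)
  have hS : S.ShortExact := by
    refine ModuleCat.shortComplex_shortExact _ ?_ m.subtype_injective IsLocalRing.residue_surjective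
    intro x
    exact ⟨fun hx => ⟨⟨x, (IsLocalRing.residue_eq_zero_iff _).1 hx⟩, rfl⟩, by
      rintro ⟨y, rfl⟩
      exact (IsLocalRing.residue_eq_zero_iff _).2 y.2⟩
  have hex : ∀ (q : L) (x : m), ∃ r : R, algebraMap R Q r = q * algebraMap R Q x := fun q x =>
    Submodule.mem_one.1 (Submodule.mem_div_iff_forall_mul_mem.1 q.2 _ ⟨x, x.2, rfl⟩)
  choose μ hμ using hex
  let ν : L →ₗ[R] m →ₗ[R] R := LinearMap.mk₂ R μ
    (fun q q' x => hinj (by rw [map_add, hμ, hμ, hμ, Submodule.coe_add, add_mul]))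
    (fun c q x => hinj (by
      rw [smul_eq_mul, map_mul, hμ, hμ, Submodule.coe_smul, Algebra.smul_def, mul_assoc]))
    (fun q x x' => hinj (by rw [map_add, hμ, hμ, hμ, Submodule.coe_add, map_add, mul_add]))
    (fun c q x => hinj (by
      rw [smul_eq_mul, map_mul, hμ, hμ, Submodule.coe_smul, smul_eq_mul, map_mul, mul_left_comm]))
  have hν : ∀ q x, algebraMap R Q (ν q x) = q * algebraMap R Q x := hμ
  let ψ : L →ₗ[R] Ext.{u} S.X₃ (ModuleCat.of R R) 1 :=
    { toFun := fun q => hS.extClass.comp (Ext.mk₀ (ModuleCat.ofHom (ν q))) (add_zero 1)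
      map_add' := fun q q' => by
        rw [map_add, ← Ext.comp_add, ← Ext.mk₀_add]
        rfl
      map_smul' := fun c q => by
        rw [map_smul, RingHom.id_apply, ← Ext.comp_smul, ← Ext.mk₀_smul]
        rfl }
  have hψsurj : Function.Surjective ψ := by
    intro x
    obtain ⟨η, hη⟩ := Ext.contravariant_sequence_exact₃ hS (ModuleCat.of R R) x
      (Ext.eq_zero_of_projective _) (add_zero 1)
    obtain ⟨h, rfl⟩ := (Ext.mk₀_bijective _ _).2 η
    obtain ⟨s, hs⟩ := (isUnit_algebraMap (Q := Q) ht.mem_nonZeroDivisors).exists_right_inv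
    let g : m →ₗ[R] R := h.hom
    -- `g` is the multiplication by `g t / t`.
    have hg : ∀ x : m,
        algebraMap R Q (g x) = s * algebraMap R Q (g ⟨t, htm⟩) * algebraMap R Q x := by
      intro x
      have h1 : t • x = (x : R) • (⟨t, htm⟩ : m) := Subtype.ext (mul_comm t (x : R))
      have h2 := congrArg (fun y => algebraMap R Q (g y)) h1
      simp only [map_smul, smul_eq_mul, map_mul] at h2
      linear_combination s * h2 - algebraMap R Q (g x) * hs
    let q : L := ⟨s * algebraMap R Q (g ⟨t, htm⟩), Submodule.mem_div_iff_forall_mul_mem.2 (by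
      rintro _ ⟨x, hx, rfl⟩
      exact Submodule.mem_one.2 ⟨g ⟨x, hx⟩, hg ⟨x, hx⟩⟩)⟩
    refine ⟨q, ?_⟩
    rw [← hη]
    have : ModuleCat.ofHom (ν q) = h := by
      ext x
      exact hinj ((hν q x).trans (hg x).symm)
    change hS.extClass.comp (Ext.mk₀ (ModuleCat.ofHom (ν q))) (add_zero 1) = _
    rw [this]
  have hψker : LinearMap.ker ψ = (1 : Submodule R Q).submoduleOf L := by
    ext q
    rw [LinearMap.mem_ker]
    change hS.extClass.comp (Ext.mk₀ (ModuleCat.ofHom (ν q))) (add_zero 1) = 0 ↔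
      (q : Q) ∈ (1 : Submodule R Q)
    constructor
    · intro h
      obtain ⟨η, hη⟩ := Ext.contravariant_sequence_exact₁ hS (ModuleCat.of R R) _ (add_zero 1) h
      obtain ⟨g, rfl⟩ := (Ext.mk₀_bijective _ _).2 η
      rw [Ext.mk₀_comp_mk₀] at hη
      have h1 := (Ext.mk₀_bijective _ _).1 hη
      let g' : R →ₗ[R] R := g.hom
      have h2 : g' t = ν q ⟨t, htm⟩ := congrArg (fun f => f.hom ⟨t, htm⟩) h1
      have h3 : g' t = t * g' 1 := by
        rw [← smul_eq_mul t, ← map_smul, smul_eq_mul, mul_one]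
      refine Submodule.mem_one.2 ⟨g' 1, ?_⟩
      refine (isUnit_algebraMap (Q := Q) ht.mem_nonZeroDivisors).mul_left_cancel ?_
      rw [← map_mul, ← h3, h2, hν, mul_comm]
    · intro hq
      obtain ⟨r, hr⟩ := Submodule.mem_one.1 hq
      have : ModuleCat.ofHom (ν q) = S.f ≫ ModuleCat.ofHom (LinearMap.toSpanSingleton R R r) := by
        ext x
        apply hinj
        refine (hν q x).trans ?_
        rw [← hr, ← map_mul, mul_comm]
        rfl
      rw [this, ← Ext.mk₀_comp_mk₀, hS.extClass_comp_assoc]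
  change Module.length R (Ext.{u} S.X₃ (ModuleCat.of R R) 1) = _
  rw [quotLength, ← hψker]
  exact (ψ.quotKerEquivOfSurjective hψsurj).symm.length_eq

end Ext

/-! ### Hilbert coefficients and almost Gorenstein rings -/

section Hilbert

variable {R : Type u} [CommRing R] {Q : Type u} [CommRing Q] [Algebra R Q]

lemma coeSubmodule_pow (I : Ideal R) (n : ℕ) :
    IsLocalization.coeSubmodule Q (I ^ n) = IsLocalization.coeSubmodule Q I ^ n := by
  induction n with
  | zero => rw [pow_zero, pow_zero, Ideal.one_eq_top, IsLocalization.coeSubmodule_top]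
  | succ n ih => rw [pow_succ, pow_succ, IsLocalization.coeSubmodule_mul, ih]

lemma coeSubmodule_le_one (I : Ideal R) : IsLocalization.coeSubmodule Q I ≤ 1 := by
  rw [← IsLocalization.coeSubmodule_top]
  exact IsLocalization.coeSubmodule_mono Q le_top

lemma IsLattice.pow {X : Submodule R Q} (hX : IsLattice X) (n : ℕ) : IsLattice (X ^ n) := by
  induction n with
  | zero => rw [pow_zero]; exact isLattice_one
  | succ n ih => rw [pow_succ]; exact ih.mul hX

lemma pow_eq_of_pow_succ_eq {K : Submodule R Q} {n : ℕ} (hn : K ^ (n + 1) = K ^ n) {j : ℕ}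
    (hj : n ≤ j) : K ^ j = K ^ n := by
  induction j, hj using Nat.le_induction with
  | base => rfl
  | succ j _ ih => rw [pow_succ, ih, ← pow_succ, hn]

lemma one_le_pow_of_one_le {K : Submodule R Q} (h1 : 1 ≤ K) (n : ℕ) : 1 ≤ K ^ n := by
  rw [Submodule.one_le] at h1 ⊢
  have := Submodule.pow_mem_pow K h1 n
  rwa [one_pow] at this

lemma span_singleton_pow (v : Q) (n : ℕ) :
    Submodule.span R {v} ^ n = Submodule.span R {v ^ n} := by
  rw [Submodule.span_pow, Set.singleton_pow]

lemma quotLength_span_pow {v : Q} (hv : IsUnit v) (hv1 : Submodule.span R {v} ≤ 1) (n : ℕ) :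
    Submodule.span R {v} ^ n ≤ 1 ∧
      quotLength (Submodule.span R {v} ^ n) 1 = n * quotLength (Submodule.span R {v}) 1 := by
  induction n with
  | zero => exact ⟨(pow_zero _).le, by rw [pow_zero, quotLength_self, Nat.cast_zero, zero_mul]⟩
  | succ n ih =>
    have hle : Submodule.span R {v} * Submodule.span R {v} ^ n ≤ Submodule.span R {v} * 1 :=
      mul_le_mul_right ih.1 _
    have h := quotLength_span_mul hv (Submodule.span R {v} ^ n) 1
    rw [mul_one] at h hle
    rw [pow_succ']
    refine ⟨hle.trans hv1, ?_⟩
    rw [quotLength_add hle hv1, h, ih.2, Nat.cast_succ, add_mul, one_mul]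

/-- For an ideal `I = v K` with `K ^ n = S` for large `n`, the length of `R / I ^ (n + 1)` is
`(n + 1) ℓ(R / v R) - ℓ(S / R)`. -/
lemma length_quotient_pow_add [IsFractionRing R Q] {I : Ideal R} {K : Submodule R Q} {v : Q}
    (hv : IsUnit v) (hI : IsLocalization.coeSubmodule Q I = Submodule.span R {v} * K)
    (hK1 : 1 ≤ K) {n₀ : ℕ} (hn₀ : K ^ (n₀ + 1) = K ^ n₀) {n : ℕ} (hn : n₀ ≤ n) :
    Module.length R (R ⧸ I ^ (n + 1)) + quotLength 1 (K ^ n₀) =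
      (n + 1 : ℕ) * quotLength (Submodule.span R {v}) 1 := by
  have hv1 : Submodule.span R {v} ≤ 1 := by
    refine le_trans ?_ (hI ▸ coeSubmodule_le_one I)
    conv_lhs => rw [← mul_one (Submodule.span R {v})]
    exact mul_le_mul_right hK1 _
  have hpow : IsLocalization.coeSubmodule Q (I ^ (n + 1)) =
      Submodule.span R {v ^ (n + 1)} * K ^ n₀ := by
    rw [coeSubmodule_pow, hI, mul_pow, span_singleton_pow,
      pow_eq_of_pow_succ_eq hn₀ (hn.trans n.le_succ)]
  have h1 := quotLength_span_mul (R := R) (hv.pow (n + 1)) 1 (K ^ n₀)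
  have h2 : Submodule.span R {v ^ (n + 1)} * 1 ≤ Submodule.span R {v ^ (n + 1)} * K ^ n₀ :=
    mul_le_mul_right (one_le_pow_of_one_le hK1 n₀) _
  have h3 := quotLength_add h2 (hpow ▸ coeSubmodule_le_one _)
  rw [h1, mul_one, ← span_singleton_pow, (quotLength_span_pow hv hv1 _).2, span_singleton_pow,
    ← hpow, ← length_quotient_eq_quotLength _ (IsFractionRing.injective R Q)] at h3
  rw [h3, add_comm]

end Hilbert

section AlmostGorenstein

variable {R : Type u} [CommRing R] [IsLocalRing R] [IsNoetherianRing R] {Q : Type u} [CommRing Q]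
  [Algebra R Q] [IsFractionRing R Q] {t : R} {K m : Submodule R Q}

lemma hasHilbertCoefficients_iff (ht : IsParameter R t) (hKl : IsLattice K) {I : Ideal R} {v : Q}
    (hv : IsUnit v) (hI : IsLocalization.coeSubmodule Q I = Submodule.span R {v} * K)
    (hK1 : 1 ≤ K) {n : ℕ} (hn : K ^ (n + 1) = K ^ n) (e₀ e₁ : ℤ) :
    HasHilbertCoefficients I e₀ e₁ ↔ e₀ = (quotLength (Submodule.span R {v}) 1).toNat ∧
      e₁ = (quotLength 1 (K ^ n)).toNat := by
  have hKn := hKl.pow n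
  have hd := ENat.natCast_toNat
    (quotLength_ne_top ht (isLattice_span_singleton (R := R) hv) isLattice_one)
  have hs := ENat.natCast_toNat (quotLength_ne_top ht isLattice_one hKn)
  set d := (quotLength (Submodule.span R {v}) 1).toNat
  set s := (quotLength 1 (K ^ n)).toNat
  have key : ∀ j, n ≤ j → ∃ l : ℕ, Module.length R (R ⧸ I ^ (j + 1)) = l ∧ l + s = (j + 1) * d := by
    intro j hj
    have h := length_quotient_pow_add hv hI hK1 hn hj
    rw [← hd, ← hs] at h
    have hne : Module.length R (R ⧸ I ^ (j + 1)) ≠ ⊤ := by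
      intro htop
      rw [htop, top_add] at h
      exact ENat.natCast_ne_top _ (by rw [Nat.cast_mul, ← h])
    obtain ⟨l, hl⟩ := ENat.ne_top_iff_exists.1 hne
    refine ⟨l, hl.symm, ?_⟩
    rw [← hl] at h
    exact_mod_cast h
  constructor
  · rintro ⟨N, hN⟩
    have h : ∀ j, n ≤ j → N ≤ j → e₀ * (j + 1) - e₁ = (j + 1) * d - s := by
      intro j hj hj'
      obtain ⟨l, hl, hls⟩ := key j hj
      obtain ⟨l', hl', hls'⟩ := hN j hj'
      have : l = l' := by exact_mod_cast hl.symm.trans hl'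
      rw [← hls', ← this]
      have : (l : ℤ) + s = (j + 1) * d := by exact_mod_cast hls
      linarith
    have h1 := h (n + N) (Nat.le_add_right _ _) (Nat.le_add_left _ _)
    have h2 := h (n + N + 1) (by omega) (by omega)
    push_cast at h1 h2
    have h3 : e₀ = d := by linarith
    refine ⟨h3, ?_⟩
    rw [h3] at h1
    linarith
  · rintro ⟨rfl, rfl⟩
    refine ⟨n, fun j hj => ?_⟩
    obtain ⟨l, hl, hls⟩ := key j hj
    refine ⟨l, hl, ?_⟩
    have : (l : ℤ) + s = (j + 1) * d := by exact_mod_cast hls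
    linarith

lemma quotLength_maximalIdeal (R : Type u) [CommRing R] [IsLocalRing R] (Q : Type u) [CommRing Q]
    [Algebra R Q] [IsFractionRing R Q] :
    quotLength (IsLocalization.coeSubmodule Q (IsLocalRing.maximalIdeal R)) 1 = 1 := by
  rw [← length_quotient_eq_quotLength _ (IsFractionRing.injective R Q)]
  exact Module.length_eq_one_iff.2
    (isSimpleModule_iff_isCoatom.2 (IsLocalRing.maximalIdeal.isMaximal R).out)

/-- With `S = K ^ n` and `𝔠 = K : S`, the length of `S / 𝔪` is computed along `𝔪 ⊆ R ⊆ S` and along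
`𝔪 ⊆ 𝔪 K ⊆ K ⊆ S`, where `ℓ(S / K) = ℓ(R / 𝔠)` and `ℓ(K / 𝔪 K) = ℓ((R : 𝔪) / R)` by duality. -/
lemma IsDualizing.quotLength_add_one (hK : IsDualizing K) (ht : IsParameter R t)
    (hKl : IsLattice K) (hm : m = IsLocalization.coeSubmodule Q (IsLocalRing.maximalIdeal R))
    (hK1 : 1 ≤ K) {S : Submodule R Q} (hS : IsLattice S) (hKS : K ≤ S) :
    quotLength 1 S + 1 = quotLength (K / S) 1 + quotLength 1 (1 / m) + quotLength m (m * K) := by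
  have hml : IsLattice m := hm ▸ isLattice_maximalIdeal ht
  have hm1 : m ≤ 1 := hm ▸ coeSubmodule_le_one _
  have hlen : quotLength m 1 = 1 := hm ▸ quotLength_maximalIdeal R Q
  have hmK : m ≤ m * K := by
    conv_lhs => rw [← mul_one m]
    exact mul_le_mul_right hK1 m
  have hmKK : m * K ≤ K := by
    conv_rhs => rw [← one_mul K]
    exact mul_le_mul_left hm1 K
  have h1 : quotLength (K / S) 1 = quotLength K S := by
    rw [← hK.div_self]
    exact hK.quotLength_eq hKl hKl hS hKS
  have h2 : quotLength 1 (1 / m) = quotLength (m * K) K := by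
    have := hK.quotLength_eq hKl (hml.mul hKl) hKl hmKK
    rwa [mul_comm m K, ← div_div_eq, hK.div_self, mul_comm K m] at this
  have h3 := quotLength_add hm1 (hK1.trans hKS)
  rw [quotLength_add hmK (hmKK.trans hKS), quotLength_add hmKK hKS, hlen] at h3
  rw [h1, h2, add_comm, ← h3]
  ring

lemma IsDualizing.quotLength_le_iff (hK : IsDualizing K) (ht : IsParameter R t)
    (hKl : IsLattice K) (hm : m = IsLocalization.coeSubmodule Q (IsLocalRing.maximalIdeal R))
    (hK1 : 1 ≤ K) {n : ℕ} (hn : K ^ (n + 1) = K ^ n) :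
    quotLength 1 (K ^ n) ≤ quotLength 1 (1 / m) ↔ m * K = m := by
  have hml : IsLattice m := hm ▸ isLattice_maximalIdeal ht
  have hm1 : m ≤ 1 := hm ▸ coeSubmodule_le_one _
  have hmK : m ≤ m * K := by
    conv_lhs => rw [← mul_one m]
    exact mul_le_mul_right hK1 m
  have hKS : K ≤ K ^ n := by
    rw [← hn, pow_succ]
    conv_lhs => rw [← one_mul K]
    exact mul_le_mul_left (one_le_pow_of_one_le hK1 n) K
  have hKn := hKl.pow n
  have hid := hK.quotLength_add_one ht hKl hm hK1 hKn hKS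
  have hr := quotLength_ne_top ht isLattice_one ((isLattice_one (R := R) (Q := Q)).div hml)
  obtain ⟨r, hr⟩ := ENat.ne_top_iff_exists.1 hr
  obtain ⟨s, hs⟩ := ENat.ne_top_iff_exists.1 (quotLength_ne_top ht isLattice_one hKn)
  obtain ⟨c, hc⟩ := ENat.ne_top_iff_exists.1 (quotLength_ne_top ht (hKl.div hKn) isLattice_one)
  obtain ⟨x, hx⟩ := ENat.ne_top_iff_exists.1 (quotLength_ne_top ht hml (hml.mul hKl))
  rw [← hr, ← hs, ← hc, ← hx] at hid
  have hid' : s + 1 = c + r + x := by exact_mod_cast hid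
  rw [← hr, ← hs, Nat.cast_le]
  constructor
  · intro hle
    refine le_antisymm ?_ hmK
    rcases Nat.eq_zero_or_pos x with h0 | h0
    · rw [← quotLength_eq_zero_iff, ← hx, h0, Nat.cast_zero]
    -- Otherwise `𝔠 = R`, so that `K = R`.
    · have hc0 : c = 0 := by omega
      rw [hc0, Nat.cast_zero, eq_comm, quotLength_eq_zero_iff, Submodule.le_div_iff_mul_le,
        one_mul] at hc
      have hK2 : K * K = K := by
        refine le_antisymm ?_ (by
          conv_lhs => rw [← one_mul K]
          exact mul_le_mul_left hK1 K)
        calc K * K ≤ K ^ n * K := mul_le_mul_left hKS K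
          _ = K ^ n := by rw [← pow_succ, hn]
          _ ≤ K := hc
      have hK3 : K ≤ 1 := by
        rw [← hK.div_self, Submodule.le_div_iff_mul_le, hK2]
      calc m * K ≤ m * 1 := mul_le_mul_right hK3 m
        _ = m := mul_one m
  · intro h
    have hx0 : x = 0 := by
      have : quotLength m (m * K) = 0 := by rw [h, quotLength_self]
      rw [← hx] at this
      exact_mod_cast this
    -- `𝔪 S = 𝔪` gives `𝔪 ⊆ 𝔠`, so that `ℓ(R / 𝔠) ≤ 1`.
    have hmS : m ≤ K / K ^ n := by
      rw [Submodule.le_div_iff_mul_le]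
      have hmj : ∀ j, m * K ^ j = m := by
        intro j
        induction j with
        | zero => rw [pow_zero, mul_one]
        | succ j ih => rw [pow_succ, ← mul_assoc, ih, h]
      rw [hmj]
      exact hm1.trans hK1
    have hS1 : K / K ^ n ≤ 1 := by
      conv_rhs => rw [← hK.div_self]
      exact div_le_div_left K hKS
    have hlen := quotLength_add hmS hS1
    have hm1' : quotLength m 1 = 1 := hm ▸ quotLength_maximalIdeal R Q
    have hc1 : c ≤ 1 := by
      have : (c : ℕ∞) ≤ 1 := by
        rw [hc, ← hm1', hlen]
        exact le_add_self
      exact_mod_cast this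
    omega

/-- `R` is almost Gorenstein if and only if `𝔪 K = 𝔪`. Every canonical ideal is a multiple `v K`,
so that `e₁` is the length of `K ^ n / R` for large `n`, whatever the ideal. -/
lemma isAlmostGorenstein_iff (ht : IsParameter R t) (hdim : ringKrullDim R = 1)
    (hcan : IsCanonicalModule R K) (hKl : IsLattice K)
    (hm : m = IsLocalization.coeSubmodule Q (IsLocalRing.maximalIdeal R))
    (hK1 : 1 ≤ K) {n : ℕ} (hn : K ^ (n + 1) = K ^ n) : IsAlmostGorenstein R ↔ m * K = m := by
  have hinj : Function.Injective (algebraMap R Q) := IsFractionRing.injective R Q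
  have hK := isDualizing_of_hasFiniteInjDim ht hKl hcan.2.1
  have hml : IsLattice m := hm ▸ isLattice_maximalIdeal ht
  have htype := bassNumber_self_one (Q := Q) ht
  rw [← hm] at htype
  have hKn := hKl.pow n
  have hs := ENat.natCast_toNat (quotLength_ne_top ht isLattice_one hKn)
  have hr := ENat.natCast_toNat
    (quotLength_ne_top ht isLattice_one ((isLattice_one (R := R) (Q := Q)).div hml))
  have hequiv : ∀ I : Ideal R, Nonempty (I ≃ₗ[R] IsLocalization.coeSubmodule Q I) := fun I =>
    ⟨Submodule.equivMapOfInjective (Algebra.linearMap R Q) hinj I⟩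
  rw [← hK.quotLength_le_iff ht hKl hm hK1 hn]
  constructor
  · rintro ⟨I, -, hI, e₀, e₁, hH, r, hrI, hle⟩
    obtain ⟨φ⟩ := hequiv I
    -- The zero ideal has vanishing Bass numbers.
    have hbot : I ≠ ⊥ := by
      rintro rfl
      have h1 := hI.2.2 1 (by rw [hdim]; rfl)
      have hzero : Limits.IsZero (ModuleCat.of R (⊥ : Ideal R)) :=
        ModuleCat.isZero_of_subsingleton _
      have : bassNumber R (⊥ : Ideal R) 1 = 0 := by
        rw [bassNumber, Module.length_eq_zero_iff]
        refine ⟨fun x y => ?_⟩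
        rw [← Ext.comp_mk₀_id x, ← Ext.comp_mk₀_id y, hzero.eq_of_src (𝟙 _) 0, Ext.mk₀_zero,
          Ext.comp_zero, Ext.comp_zero]
      rw [this] at h1
      exact zero_ne_one h1
    obtain ⟨c, hcI, hc⟩ := exists_mem_nonZeroDivisors_of_hasFiniteInjDim ht hbot hI.2.1
    have hIl : IsLattice (IsLocalization.coeSubmodule Q I) :=
      ⟨Submodule.FG.map _ (IsNoetherian.noetherian I), _, ⟨c, hcI, rfl⟩, isUnit_algebraMap hc⟩
    obtain ⟨i, hi⟩ := hI.2.1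
    have hID := isDualizing_of_hasFiniteInjDim ht hIl
      ⟨i, (ModuleCat.hasInjectiveDimensionLE_iff_of_linearEquiv (M := ModuleCat.of R I)
        (N := ModuleCat.of R (IsLocalization.coeSubmodule Q I)) φ i).1 hi⟩
    obtain ⟨v, hv, hIv⟩ := hK.exists_eq_span_mul hID hKl hIl
    obtain ⟨-, rfl⟩ := (hasHilbertCoefficients_iff ht hKl hv hIv hK1 hn e₀ e₁).1 hH
    rw [← htype, hrI, ← hs]
    exact_mod_cast hle
  -- The canonical ideal `I = t c K ⊆ 𝔪`, for a common denominator `c` of `K`.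
  · intro hle
    obtain ⟨c, hc, hcK⟩ := exists_smul_le_one hKl.fg
    have hu : IsUnit (algebraMap R Q (t * c)) :=
      isUnit_algebraMap (mul_mem ht.mem_nonZeroDivisors hc)
    let W : Submodule R Q := Submodule.span R {algebraMap R Q (t * c)} * K
    let I : Ideal R := W.comap (Algebra.linearMap R Q)
    have hWm : W ≤ m := by
      intro x hx
      obtain ⟨k, hk, rfl⟩ := Submodule.mem_span_singleton_mul.1 hx
      obtain ⟨r, hr⟩ := Submodule.mem_one.1 (hcK k hk)
      rw [hm]
      refine ⟨t * r, Ideal.mul_mem_right _ _ (ht.mem_of_isMaximal _), ?_⟩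
      change algebraMap R Q (t * r) = algebraMap R Q (t * c) * k
      rw [map_mul, map_mul, hr, Algebra.smul_def, mul_assoc]
    have hIW : IsLocalization.coeSubmodule Q I = W := by
      refine le_antisymm (Submodule.map_comap_le _ _) fun x hx => ?_
      obtain ⟨r, -, rfl⟩ := hm ▸ hWm hx
      exact ⟨r, hx, rfl⟩
    obtain ⟨φ⟩ := hequiv I
    let ψ : K ≃ₗ[R] W := LinearEquiv.ofBijective
      ((LinearMap.mulLeft R (algebraMap R Q (t * c)) ∘ₗ K.subtype).codRestrict W fun k =>
        Submodule.mem_span_singleton_mul.2 ⟨k, k.2, rfl⟩)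
      ⟨fun x y h => Subtype.ext (hu.mul_left_cancel (congrArg Subtype.val h)), by
        rintro ⟨x, hx⟩
        obtain ⟨k, hk, rfl⟩ := Submodule.mem_span_singleton_mul.1 hx
        exact ⟨⟨k, hk⟩, rfl⟩⟩
    let χ : K ≃ₗ[R] I := ψ.trans ((LinearEquiv.ofEq _ _ hIW.symm).trans φ.symm)
    obtain ⟨i, hi⟩ := hcan.2.1
    refine ⟨I, ?_, ⟨(ht.isMCM_iff I).2 ⟨inferInstance, ?_⟩,
      ⟨i, (ModuleCat.hasInjectiveDimensionLE_iff_of_linearEquiv (M := ModuleCat.of R K)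
        (N := ModuleCat.of R I) χ i).1 hi⟩, fun d hd => ?_⟩, _, _,
      (hasHilbertCoefficients_iff ht hKl hu hIW hK1 hn _ _).2 ⟨rfl, rfl⟩, _,
      htype.trans hr.symm, ?_⟩
    · rintro htop
      have h1 : algebraMap R Q 1 ∈ m := hWm (show (1 : R) ∈ I from htop ▸ Submodule.mem_top)
      rw [hm] at h1
      obtain ⟨r, hr, h1⟩ := h1
      have h2 : r = 1 := hinj h1
      exact (IsLocalRing.maximalIdeal.isMaximal R).ne_top ((Ideal.eq_top_iff_one _).2 (h2 ▸ hr))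
    · intro x y h
      exact Subtype.ext (ht.isSMulRegular (congrArg Subtype.val h))
    · rw [← bassNumber_eq_of_linearEquiv χ]
      exact hcan.2.2 d hd
    · rw [← hs, ← hr] at hle
      exact_mod_cast hle

end AlmostGorenstein

end OneDim

open OneDim

theorem corollary3p5 (R : Type u) [CommRing R] [IsLocalRing R]
    (hCM : IsCohenMacaulay R) (hdim : ringKrullDim R = 1)
    (K : Submodule R (FractionRing R)) (hK : IsFractionalCanonicalIdeal R K)
    (hDVR : ¬ ∃ _ : IsDomain R, IsDiscreteValuationRing R)
    (E : Subalgebra R (FractionRing R)) (hE : E = (IsLocalRing.maximalIdeal R).colonRing) :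
    ((catOmegaCM E).restrictTo R = catOmegaCMP R ↔ (IsLocalRing.maximalIdeal R).IsStable) ∧
    (catOmegaCMP R = (catCM E).restrictTo R ↔ IsAlmostGorenstein R) ∧
    (IsGorenstein E ↔ IsAlmostGorenstein R ∧ (IsLocalRing.maximalIdeal R).IsStable) := by
  have hnoeth : IsNoetherianRing R := hCM.1
  obtain ⟨t, ht⟩ := exists_isParameter hCM hdim
  obtain ⟨hK1, hKint, hcan⟩ := hK
  have hKfg : K.FG := Module.Finite.iff_fg.1 hcan.1.1
  have hKl : IsLattice K := ⟨hKfg, 1, Submodule.one_le.1 hK1, isUnit_one⟩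
  have hKD := isDualizing_of_hasFiniteInjDim ht hKl hcan.2.1
  obtain ⟨n, hn⟩ := exists_pow_succ_eq hK1 hKfg hKint
  obtain ⟨m, hm⟩ : ∃ m, m = IsLocalization.coeSubmodule (FractionRing R)
    (IsLocalRing.maximalIdeal R) := ⟨_, rfl⟩
  have hmm : m / m = Subalgebra.toSubmodule E := by
    ext x
    rw [Submodule.mem_div_iff_forall_mul_mem, hE, hm]
    rfl
  have h1m : 1 / m = Subalgebra.toSubmodule E := by
    rw [← hmm, hm]
    exact one_div_maximalIdeal ht hDVR
  have hext : ∀ P P' : CategoryTheory.ObjectProperty (ModuleCat.{u} R),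
      P = P' ↔ ∀ M, P M ↔ P' M := fun P P' =>
    ⟨fun h M => by rw [h], fun h => funext fun M => propext (h M)⟩
  rw [hext, hext, isStable_maximalIdeal_iff ht hm,
    isAlmostGorenstein_iff ht hdim hcan hKl hm hK1 hn]
  exact ⟨restrictTo_catOmegaCM_iff_catOmegaCMP ht hm hmm h1m hKD hKl,
    catOmegaCMP_iff_restrictTo_catCM ht hm hmm h1m hcan.2.1 hKl hn,
    isGorenstein_iff ht hm hmm h1m hKD hKl hn⟩
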